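/- **Conventions.** Let $L$ be a first-order language and $T$ an $L$-theory (not necessarily complete). Models are non-empty. A *definable set* is a definable set of $T^{eq}$ without parameters, i.e. the quotient of a definable set of tuples by a definable equivalence relation; definable maps and relations between such sets are understood accordingly, and $X(M)$ denotes the set of points of $X$ in a model $M$. For a definable set $C$, a definable set $Y$ is *in $C^{eq}$* if (in all models of $T$) it is covered by the images of finitely many definable partial maps from powers of $C$. Let $Q$, $C$ be definable sets. *Internality.* $Q$ is *$(X,f)$-internal to $C$* if $X$ is a definable set with $X(M)\neq\emptyset$ for every model $M$ of $T$, and $f:Q\times X\to Y$ is a definable map to a definable set $Y$ in $C^{eq}$, such that in every model each $f_x=f(\cdot,x)$ is injective on $Q$ and $f_x\ne f_{x'}$ for $x\neq x'$. $Q$ is *internal to $C$* if this holds for some $(X,f)$. $\mathrm{Aut}_{(X,f)}(M)$ is the group of pairs $(\tau_Q,\tau_X)$ of permutations of $Q(M)$ and $X(M)$ with $f(\tau_Q q,\tau_X x)=f(q,x)$ for all $q,x$. If for each model $M$ a group $G(M)$ of permutations of $Q(M)$ is given, $(X,f)$ is an *internality datum for $G$* if $Q$ is $(X,f)$-internal to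 $C$ and, for every $M$, each $g\in G(M)$ extends to an element $(g,\tau_X)$ of $\mathrm{Aut}_{(X,f)}(M)$. *$\omega$-groups.* An *$\omega$-group* $G$ is the intersection of a family of definable subgroups (each without parameters) of a definable group; $G(M)$ is the intersection of the corresponding subgroups in $M$. (The family has size at most $|L|+\aleph_0$ and may be taken directed; for countable $L$ it may be taken to be a chain.) A *definable action* of $G$ on $Q$ is a formula defining in every model $M$ of $T$ an action of $G(M)$ on $Q(M)$. *Stable embeddedness.* $C$ is *stably embedded* in $T$ if for every definable family of subsets of a power $C^n$ there are finitely many definable families of subsets of $C^n$, with parameters in powers of $C$, such that in every model of $T$ each member of the first family is a member of one of the latter. **Theorem.** 1. Let $Q$ be $(X,f)$-internal to $C$. (a) Let $\Delta$ be any collection of definable subsets of products $Q^a\times X^b\times Z_1\times\dots\times Z_c$ (factors in any order), where the $Z_i$ are arbitrary definable sets. For a model $M$ let $G_\Delta(M)$ be the group of those $(\tau_Q,\tau_X)\in\mathrm{Aut}_{(X,f)}(M)$ which, together with the identity on all the $Z_i(M)$, preserve all sets in $\Delta$. Then there is an $\omega$-group with definable actions on $Q$ and $X$ whose group of $M$-points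 is, for every model $M$ of $T$, identified via these actions with $G_\Delta(M)$. Moreover, it is the intersection of definable subgroups $G_{\Delta_0}$ of one definable group acting definably on $Q$ and $X$, where $\Delta_0$ runs over the finite subsets of $\Delta$ and the $M$-points of $G_{\Delta_0}$ are likewise identified with the group $G_{\Delta_0}(M)$ belonging to $\Delta_0$. (b) Conversely, let $G$ be an $\omega$-group with a definable action on $Q$ which is faithful in every model of $T$. Then there are $(X',f')$ such that $Q$ is $(X',f')$-internal to $C$, a collection $\Delta$ as in (a) (for $X'$), and a definable action of $G$ on $X'$, such that for every model $M$ of $T$ the given action on $Q$ and the action on $X'$ identify $G(M)$ with the group $G_\Delta(M)$ of (a) for $(X',f')$. 2. Let $\Delta$ be a collection of definable subsets of products of copies of $Q$ and $C$. For a model $M$ let $G(M)$ be the group of permutations of $Q(M)$ which, together with the identity of $C(M)$, preserve all sets in $\Delta$. Let $L_\Delta$ be the language with sorts $Q$, $C$ and a relation symbol for each set in $\Delta$ and each definable subset of a power of $C$, and let $T_\Delta$ be the restriction of $T$ to $L_\Delta$, i.e. the $L_\Delta$-sentences true in the $L_\Delta$-structure $M_\Delta$ obtained from each model $M$ of $T$.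 Assume that there is an internality datum for $G$ in $T$, and that $C$ is stably embedded in $T_\Delta$ (which is the case if $C$ is stably embedded in $T$). Then: (i) there is an internality datum in $T_\Delta^{eq}$, i.e. in $T_\Delta$ the sort $Q$ is internal to $C$; (ii) every $(X,f)$ such that $Q$ is $(X,f)$-internal to $C$ in $T_\Delta$ is an internality datum for $G$: for every model $M$ of $T$, each $g\in G(M)$ extends to a permutation of $X(M_\Delta)$ preserving $f$; (iii) $G$ is an $\omega$-group that does not depend on the internality datum: there is an $\omega$-group with a definable action on $Q$, through which its $M$-points are identified with $G(M)$ for every model $M$ of $T$, such that for every internality datum $(X,f)$ for $G$ in $T$ it also has a definable action on $X$ and its $M$-points are identified, for every $M$, with the group of those $(\tau_Q,\tau_X)\in\mathrm{Aut}_{(X,f)}(M)$ with $\tau_Q\in G(M)$. 3. Let $M$ be a saturated model of $T$ and $T'=\mathrm{Th}(M)$ (so $T'$ is equivalent to $T$ if $T$ is complete), and let $C$ be stably embedded in $T'$. Let $H$ be either the group of permutations of $Q(M)$ induced by automorphisms of $M$ fixing $C(M)$ pointwise, or the group of permutations of $Q(M)$ which, together with the identity of $C(M)$, preserve all definable subsets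 of products of copies of $Q$ and $C$. If $|H|\le|M|$, then in $T'$ the set $Q$ is $(X,f)$-internal to $C$ for some $(X,f)$ such that every element of $H$ extends to an element of $\mathrm{Aut}_{(X,f)}(M)$; and $H$ is the group of $M$-points of an $\omega$-group in $T'$ with a definable action on $Q$. -/

import Mathlib

open FirstOrder

universe u v w

namespace Internality

/-! ### Definable sets of `T^eq` -/

/-- A definable set of `T^eq`: the canonical family of the family of sets
`fam(a, ·)`, whose parameter `a` runs over the set defined by `dom`.  In other words, the set
defined by `dom` modulo the equivalence relation `∀ y, fam(a, y) ↔ fam(b, y)`.  Taking for `fam` a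
definable equivalence relation gives an arbitrary interpretable set, and taking for it the relation
of equality gives an ordinary definable set. -/
structure EqSet (L : FirstOrder.Language.{u, v}) where
  arity : ℕ
  dom : L.Formula (Fin arity)
  aux : ℕ
  fam : L.Formula (Fin arity ⊕ Fin aux)

variable {L : FirstOrder.Language.{u, v}}

/-- The (non-empty) models of `T`. -/
abbrev Model (T : L.Theory) := FirstOrder.Language.Theory.ModelType.{u, v, max u v} T

namespace EqSet

/-- Two parameters are equivalent if they define the same member of the family. -/
def setoid (X : EqSet L) (M : Type w) [L.Structure M] :
    Setoid {a : Fin X.arity → M // X.dom.Realize a} where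
  r a b := ∀ y : Fin X.aux → M,
    X.fam.Realize (Sum.elim a.1 y) ↔ X.fam.Realize (Sum.elim b.1 y)
  iseqv :=
    ⟨fun _ _ => Iff.rfl, fun h y => (h y).symm, fun h₁ h₂ y => (h₁ y).trans (h₂ y)⟩

/-- The set `X(M)` of points of `X` in the structure `M`. -/
def Pts (X : EqSet L) (M : Type w) [L.Structure M] : Type w := Quotient (X.setoid M)

/-- The tuple `a` of elements of `M` represents the point `x` of `X(M)`. -/
def Rep (X : EqSet L) {M : Type w} [L.Structure M] (a : Fin X.arity → M) (x : X.Pts M) : Prop :=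
  ∃ h : X.dom.Realize a, (Quotient.mk (X.setoid M) ⟨a, h⟩ : X.Pts M) = x

end EqSet

/-! ### Definable relations between definable sets

A formula in variables for representatives defines the set of all those tuples of points that have
some representatives satisfying the formula.  All definable subsets of products of sets of `T^eq`
are of this form. -/

/-- Definable subsets of `X`. -/
def Rel₁ (X : EqSet L) := L.Formula (Fin X.arity)

def Rel₁.Holds {X : EqSet L} (φ : Rel₁ X) {M : Type w} [L.Structure M] (x : X.Pts M) : Prop :=
  ∃ a, X.Rep a x ∧ FirstOrder.Language.Formula.Realize φ a

/-- Definable subsets of `X × Y × Z`. -/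
def Rel₃ (X Y Z : EqSet L) := L.Formula (Fin X.arity ⊕ (Fin Y.arity ⊕ Fin Z.arity))

def Rel₃.Holds {X Y Z : EqSet L} (φ : Rel₃ X Y Z) {M : Type w} [L.Structure M]
    (x : X.Pts M) (y : Y.Pts M) (z : Z.Pts M) : Prop :=
  ∃ a b c, X.Rep a x ∧ Y.Rep b y ∧ Z.Rep c z ∧
    FirstOrder.Language.Formula.Realize φ (Sum.elim a (Sum.elim b c))

/-- Definable subsets of `C^k × Y`. -/
def RelPow (C : EqSet L) (k : ℕ) (Y : EqSet L) :=
  L.Formula ((Fin k × Fin C.arity) ⊕ Fin Y.arity)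

def RelPow.Holds {C : EqSet L} {k : ℕ} {Y : EqSet L} (φ : RelPow C k Y)
    {M : Type w} [L.Structure M] (c : Fin k → C.Pts M) (y : Y.Pts M) : Prop :=
  ∃ (a : Fin k → Fin C.arity → M) (b : Fin Y.arity → M), (∀ i, C.Rep (a i) (c i)) ∧ Y.Rep b y ∧
    FirstOrder.Language.Formula.Realize φ (Sum.elim (fun p => a p.1 p.2) b)

/-- A definable subset of a Cartesian product `S (slot 0) × ⋯ × S (slot (len - 1))` of members of a
family `S` of definable sets. -/
structure DefRel {ι : Type w} (S : ι → EqSet L) where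
  len : ℕ
  slot : Fin len → ι
  form : L.Formula (Σ i : Fin len, Fin (S (slot i)).arity)

def DefRel.Holds {ι : Type*} {S : ι → EqSet L} (R : DefRel S) (M : Type w) [L.Structure M]
    (x : ∀ i, (S (R.slot i)).Pts M) : Prop :=
  ∃ a : ∀ i, Fin (S (R.slot i)).arity → M,
    (∀ i, (S (R.slot i)).Rep (a i) (x i)) ∧ R.form.Realize (fun p => a p.1 p.2)

/-- The group of automorphisms of the collection `S` in `M`: one permutation of each of the sets,
such that all the relations in `Δ` are preserved. -/
def autColl {ι : Type*} {S : ι → EqSet L} (Δ : Set (DefRel S)) (M : Type w) [L.Structure M] :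
    Subgroup (∀ i, Equiv.Perm ((S i).Pts M)) where
  carrier := {τ | ∀ R ∈ Δ, ∀ x : ∀ i, (S (R.slot i)).Pts M,
    R.Holds M (fun i => τ (R.slot i) (x i)) ↔ R.Holds M x}
  one_mem' := fun _ _ _ => Iff.rfl
  mul_mem' := fun {σ τ} hσ hτ R hR x =>
    (hσ R hR (fun i => τ (R.slot i) (x i))).trans (hτ R hR x)
  inv_mem' := fun {τ} hτ R hR x => by
    simpa using (hτ R hR (fun i => (τ (R.slot i))⁻¹ (x i))).symm

/-! ### Internality -/

/-- `Y` is (a definable set) in `C^eq`: it is covered by the images of finitely many definable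
partial maps on powers of `C`. -/
def InEq (T : L.Theory) (C Y : EqSet L) : Prop :=
  ∃ (r : ℕ) (k : Fin r → ℕ) (ρ : ∀ j, RelPow C (k j) Y), ∀ M : Model T,
    (∀ (j : Fin r) (c : Fin (k j) → C.Pts M) (y y' : Y.Pts M),
      (ρ j).Holds c y → (ρ j).Holds c y' → y = y') ∧
    ∀ y : Y.Pts M, ∃ (j : Fin r) (c : Fin (k j) → C.Pts M), (ρ j).Holds c y

/-- `Q` is `(X, f)`-internal to `C`, where `f : Q × X → Y ⊆ C^eq` is given by its graph. -/
structure IsInternal (T : L.Theory) (Q C X Y : EqSet L) (f : Rel₃ Q X Y) : Prop where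
  target : InEq T C Y
  nonempty : ∀ M : Model T, Nonempty (X.Pts M)
  map : ∀ (M : Model T) (q : Q.Pts M) (x : X.Pts M), ∃! y : Y.Pts M, f.Holds q x y
  injective : ∀ (M : Model T) (x : X.Pts M) (q q' : Q.Pts M) (y : Y.Pts M),
    f.Holds q x y → f.Holds q' x y → q = q'
  distinct : ∀ (M : Model T) (x x' : X.Pts M),
    (∀ (q : Q.Pts M) (y : Y.Pts M), f.Holds q x y ↔ f.Holds q x' y) → x = x'

/-- The internality group in `M`: pairs of permutations of `Q(M)` and `X(M)` with
`f(τ q, τ x) = f(q, x)`. -/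
def intGroup {Q X Y : EqSet L} (f : Rel₃ Q X Y) (M : Type w) [L.Structure M] :
    Subgroup (Equiv.Perm (Q.Pts M) × Equiv.Perm (X.Pts M)) where
  carrier := {τ | ∀ (q : Q.Pts M) (x : X.Pts M) (y : Y.Pts M),
    f.Holds (τ.1 q) (τ.2 x) y ↔ f.Holds q x y}
  one_mem' := fun _ _ _ => Iff.rfl
  mul_mem' := fun {σ τ} hσ hτ q x y => (hσ (τ.1 q) (τ.2 x) y).trans (hτ q x y)
  inv_mem' := fun {τ} hτ q x y => by
    simpa using (hτ (τ.1⁻¹ q) (τ.2⁻¹ x) y).symm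

/-- `(X, f)` is an internality datum for `G`: `Q` is `(X, f)`-internal to `C` and in every model
each element of `G(M)` extends to an element of the internality group. -/
def IsDatumFor (T : L.Theory) (Q C X Y : EqSet L) (f : Rel₃ Q X Y)
    (G : ∀ M : Model T, Set (Equiv.Perm (Q.Pts M))) : Prop :=
  IsInternal T Q C X Y f ∧
    ∀ M : Model T, ∀ g ∈ G M, ∃ τ : Equiv.Perm (X.Pts M), (g, τ) ∈ intGroup f M

/-- The sorts that may occur in a collection `Δ`: the two sets `Q` and `X`, which are moved, and
any other definable set `Z`, which is fixed pointwise. -/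
inductive Slot (L : FirstOrder.Language.{u, v}) : Type (max u v)
  | q : Slot L
  | x : Slot L
  | other (Z : EqSet L) : Slot L

/-- The definable set occupying a slot. -/
def Slot.set (Q X : EqSet L) : Slot L → EqSet L
  | .q => Q
  | .x => X
  | .other Z => Z

/-- The action of a pair of permutations of `Q(M)` and `X(M)` on all the slots. -/
def Slot.act (Q X : EqSet L) (M : Type w) [L.Structure M] :
    Equiv.Perm (Q.Pts M) × Equiv.Perm (X.Pts M) →* ∀ s : Slot L, Equiv.Perm ((s.set Q X).Pts M) where
  toFun τ
    | .q => τ.1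
    | .x => τ.2
    | .other _ => Equiv.refl _
  map_one' := by funext s; cases s <;> rfl
  map_mul' σ τ := by funext s; cases s <;> rfl

/-- The group of automorphisms of `Q(M)` and `X(M)` preserving the internality structure and all the
relations in `Δ`, and fixing pointwise all other sorts involved in `Δ`. -/
def autGroup {Q X Y : EqSet L} (f : Rel₃ Q X Y) (Δ : Set (DefRel (Slot.set Q X)))
    (M : Type w) [L.Structure M] : Subgroup (Equiv.Perm (Q.Pts M) × Equiv.Perm (X.Pts M)) :=
  intGroup f M ⊓ (autColl Δ M).comap (Slot.act Q X M)

/-! ### `ω`-groups and their actions -/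

/-- A definable group. -/
structure DefGroup (T : L.Theory) where
  carrier : EqSet L
  mul : Rel₃ carrier carrier carrier
  isGroup : ∀ M : Model T, ∃ _ : Group (carrier.Pts M),
    ∀ a b c : carrier.Pts M, mul.Holds a b c ↔ a * b = c

/-- An `ω`-group: the intersection of a family of definable subgroups of a definable group.  The
family is a set of formulas, so that it is automatically language sized.  It may be replaced by the
directed family of its finite intersections, and when the language is countable, by a chain. -/
structure OmegaGroup (T : L.Theory) extends DefGroup T where
  subs : Set (Rel₁ carrier)
  isSubgroup : ∀ σ ∈ subs, ∀ M : Model T,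
    (∃ a : carrier.Pts M, σ.Holds a) ∧
    (∀ a b c : carrier.Pts M, σ.Holds a → σ.Holds b → mul.Holds a b c → σ.Holds c) ∧
    (∀ a b e : carrier.Pts M, σ.Holds a → mul.Holds a b e → mul.Holds e e e → σ.Holds b)

/-- The points of the `ω`-group in `M`. -/
def OmegaGroup.Mem {T : L.Theory} (G : OmegaGroup T) {M : Type w} [L.Structure M]
    (g : G.carrier.Pts M) : Prop := ∀ σ ∈ G.subs, σ.Holds g

/-- In the structure `M`, the group element `g` acts (through the relation `α ⊆ G × Q × Q`) as
the permutation `p`. -/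
def Induces {G Q : EqSet L} {M : Type w} [L.Structure M] (α : Rel₃ G Q Q) (g : G.Pts M)
    (p : Equiv.Perm (Q.Pts M)) : Prop :=
  ∀ q q' : Q.Pts M, α.Holds g q q' ↔ p q = q'

/-- In every model `M` of `T`, the formula `α` defines an action on `Q(M)` of the subgroup `P M` of
the definable group `G(M)`. -/
def DefGroup.IsAction {T : L.Theory} (G : DefGroup T) (P : ∀ M : Model T, G.carrier.Pts M → Prop)
    (Q : EqSet L) (α : Rel₃ G.carrier Q Q) : Prop :=
  ∀ M : Model T,
    (∀ g, P M g → ∀ q : Q.Pts M, ∃! q' : Q.Pts M, α.Holds g q q') ∧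
    (∀ e, P M e → G.mul.Holds e e e → ∀ q : Q.Pts M, α.Holds e q q) ∧
    (∀ g h k, P M g → P M h → P M k → G.mul.Holds g h k → ∀ q q' q'' : Q.Pts M,
      α.Holds h q q' → α.Holds g q' q'' → α.Holds k q q'')

/-- In the structure `M`, the formulas `α`, `β` identify the subset `P` of `G(M)` with the set `H`
of pairs of permutations of `Q(M)` and `X(M)`. -/
def ActsAs {G Q X : EqSet L} {M : Type w} [L.Structure M] (P : G.Pts M → Prop)
    (α : Rel₃ G Q Q) (β : Rel₃ G X X)
    (H : Set (Equiv.Perm (Q.Pts M) × Equiv.Perm (X.Pts M))) : Prop :=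
  (∀ g, P g → ∃ p ∈ H, Induces α g p.1 ∧ Induces β g p.2) ∧
  ∀ p ∈ H, ∃! g, P g ∧ Induces α g p.1 ∧ Induces β g p.2

/-- In the structure `M`, the formula `α` identifies the subset `P` of `G(M)` with the set `H` of
permutations of `Q(M)`. -/
def ActsAsOn {G Q : EqSet L} {M : Type w} [L.Structure M] (P : G.Pts M → Prop)
    (α : Rel₃ G Q Q) (H : Set (Equiv.Perm (Q.Pts M))) : Prop :=
  (∀ g, P g → ∃ p ∈ H, Induces α g p) ∧ ∀ p ∈ H, ∃! g, P g ∧ Induces α g p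

/-! ### Stable embeddedness and saturation -/

/-- `C` is stably embedded in `T`: every definable family of subsets of a power of `C` has the same
fibres as (a finite union of) definable families with parameters in powers of `C`. -/
def StablyEmbedded (T : L.Theory) (C : EqSet L) : Prop :=
  ∀ (m n : ℕ) (φ : L.Formula (Fin m ⊕ (Fin n × Fin C.arity))),
    ∃ (r : ℕ) (k : Fin r → ℕ)
      (ψ : ∀ j, L.Formula ((Fin (k j) × Fin C.arity) ⊕ (Fin n × Fin C.arity))),
    ∀ (M : Model T) (z : Fin m → M), ∃ (j : Fin r) (e : Fin (k j) → C.Pts M),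
      ∀ x : Fin n → C.Pts M,
        (∃ b : Fin n → Fin C.arity → M, (∀ i, C.Rep (b i) (x i)) ∧
          φ.Realize (Sum.elim z (fun p => b p.1 p.2))) ↔
        (∃ (a : Fin (k j) → Fin C.arity → M) (b : Fin n → Fin C.arity → M),
          (∀ i, C.Rep (a i) (e i)) ∧ (∀ i, C.Rep (b i) (x i)) ∧
          (ψ j).Realize (Sum.elim (fun p => a p.1 p.2) (fun p => b p.1 p.2)))

/-- `M` is saturated: every type over a set of parameters of cardinality less than that of `M` is
realised in `M`. -/
def IsSaturated (L : FirstOrder.Language.{u, v}) (M : Type w) [L.Structure M] : Prop :=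
  ∀ A : Set M, Cardinal.mk A < Cardinal.mk M → ∀ p : Set (L[[A]].Formula Unit),
    (∀ p₀ ⊆ p, p₀.Finite → ∃ a : M, ∀ φ ∈ p₀, φ.Realize (fun _ => a)) →
    ∃ a : M, ∀ φ ∈ p, φ.Realize (fun _ => a)

/-- The permutations of `Q(M)` induced by automorphisms of the structure `M` fixing `C(M)`
pointwise, that is `Aut(M/C(M)) / Aut(M/Q(M), C(M))`. -/
def restrictedAut (Q C : EqSet L) (M : Type w) [L.Structure M] : Set (Equiv.Perm (Q.Pts M)) :=
  {p | ∃ σ : M ≃[L] M, (∀ (a : Fin C.arity → M) (c : C.Pts M), C.Rep a c → C.Rep (σ ∘ a) c) ∧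
    ∀ (a : Fin Q.arity → M) (q : Q.Pts M), Q.Rep a q → Q.Rep (σ ∘ a) (p q)}

/-! ### Structure on `Q` and `C` only -/

/-- The two sorts `Q` and `C`. -/
inductive QC : Type
  | q : QC
  | c : QC

def QC.set (Q C : EqSet L) : QC → EqSet L
  | .q => Q
  | .c => C

/-- A permutation of `Q(M)`, together with the identity of `C(M)`. -/
def QC.act (Q C : EqSet L) (M : Type w) [L.Structure M] :
    Equiv.Perm (Q.Pts M) →* ∀ s : QC, Equiv.Perm ((s.set Q C).Pts M) where
  toFun τ
    | .q => τ
    | .c => Equiv.refl _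
  map_one' := by funext s; cases s <;> rfl
  map_mul' σ τ := by funext s; cases s <;> rfl

/-- The group of automorphisms of `Q(M)` over `C(M)`: the permutations of `Q(M)` which, together with
the identity on `C(M)`, preserve all the relations in `Δ`. -/
def autOver {Q C : EqSet L} (Δ : Set (DefRel (QC.set Q C))) (M : Type w) [L.Structure M] :
    Subgroup (Equiv.Perm (Q.Pts M)) :=
  (autColl Δ M).comap (QC.act Q C M)

/-- For `Δ` involving only `Q` and `C`: the automorphisms of `Q(M)` and `X(M)` preserving `Δ` and the
internality structure and fixing `C(M)`. -/
def autOverDatum {Q C X Y : EqSet L} (f : Rel₃ Q X Y) (Δ : Set (DefRel (QC.set Q C)))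
    (M : Type w) [L.Structure M] : Subgroup (Equiv.Perm (Q.Pts M) × Equiv.Perm (X.Pts M)) :=
  intGroup f M ⊓ (autOver Δ M).comap (MonoidHom.fst _ _)

/-- The relation symbols of the language `L_Δ`: the two sorts, all sets in `Δ` and all definable
subsets of powers of `C`. -/
inductive DeltaRel {Q C : EqSet L} (Δ : Set (DefRel (QC.set Q C))) : ℕ → Type (max u v)
  | sort (s : QC) : DeltaRel Δ 1
  | rel (R : DefRel (QC.set Q C)) (h : R ∈ Δ ∨ ∀ i, R.slot i = QC.c) : DeltaRel Δ R.len

/-- The language `L_Δ`. -/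
def deltaLang {Q C : EqSet L} (Δ : Set (DefRel (QC.set Q C))) : FirstOrder.Language.{0, max u v} where
  Functions := fun _ => Empty
  Relations := DeltaRel Δ

/-- The universe of the `L_Δ`-structure `M_Δ`: the disjoint union of the sorts `Q(M)` and `C(M)`. -/
def DeltaModel {Q C : EqSet L} (_Δ : Set (DefRel (QC.set Q C))) (M : Type w) [L.Structure M] :
    Type w :=
  Q.Pts M ⊕ C.Pts M

/-- The inclusion of a sort in `M_Δ`. -/
def DeltaModel.incl {Q C : EqSet L} (Δ : Set (DefRel (QC.set Q C))) (M : Type w) [L.Structure M] :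
    ∀ s : QC, (s.set Q C).Pts M → DeltaModel Δ M
  | .q => fun x => (Sum.inl x : Q.Pts M ⊕ C.Pts M)
  | .c => fun x => (Sum.inr x : Q.Pts M ⊕ C.Pts M)

instance deltaStructure {Q C : EqSet L} (Δ : Set (DefRel (QC.set Q C))) (M : Type w) [L.Structure M] :
    (deltaLang Δ).Structure (DeltaModel Δ M) where
  funMap := fun f _ => Empty.elim f
  RelMap := fun {_} r => match r with
    | .sort s => fun x => ∃ z, x 0 = DeltaModel.incl Δ M s z
    | .rel R _ => fun x => ∃ z : ∀ i, ((R.slot i).set Q C).Pts M,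
        (∀ i, x i = DeltaModel.incl Δ M (R.slot i) (z i)) ∧ R.Holds M z

/-- The theory `T_Δ`: the restriction of `T` to the language `L_Δ`. -/
def deltaTheory (T : L.Theory) {Q C : EqSet L} (Δ : Set (DefRel (QC.set Q C))) :
    (deltaLang Δ).Theory :=
  {σ | ∀ M : Model T, DeltaModel Δ M ⊨ σ}

/-- The sort `Q` or `C`, as a definable set of `T_Δ`. -/
def deltaSort {Q C : EqSet L} (Δ : Set (DefRel (QC.set Q C))) (s : QC) : EqSet (deltaLang Δ) where
  arity := 1
  dom := FirstOrder.Language.Relations.formula₁ (L := deltaLang Δ) (DeltaRel.sort s : DeltaRel Δ 1)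
    (FirstOrder.Language.Term.var 0)
  aux := 1
  fam := FirstOrder.Language.Term.equal (FirstOrder.Language.Term.var (Sum.inl 0)) (FirstOrder.Language.Term.var (Sum.inr 0))

/-- `(X, f)` is, in the model `M_Δ`, preserved by the permutation `g` of `Q(M)` and the
permutation `τ` of `X(M_Δ)`. -/
def DeltaPreserves {Q C : EqSet L} {Δ : Set (DefRel (QC.set Q C))} (M : Type w) [L.Structure M]
    {X Y : EqSet (deltaLang Δ)} (f : Rel₃ (deltaSort Δ .q) X Y) (g : Equiv.Perm (Q.Pts M))
    (τ : Equiv.Perm (X.Pts (DeltaModel Δ M))) : Prop :=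
  ∀ (q : Q.Pts M) (q₁ q₂ : (deltaSort Δ .q).Pts (DeltaModel Δ M)),
    (deltaSort Δ .q).Rep (fun _ => DeltaModel.incl Δ M .q q) q₁ →
    (deltaSort Δ .q).Rep (fun _ => DeltaModel.incl Δ M .q (g q)) q₂ →
    ∀ (x : X.Pts (DeltaModel Δ M)) (y : Y.Pts (DeltaModel Δ M)),
      f.Holds q₂ (τ x) y ↔ f.Holds q₁ x y

end Internality

open Internality

/-!
Everything rests on a calculus of uniform definability. `DefOn` expresses that a family of relations
between points of definable sets of `T^eq`, one in each model, is given by one formula; it is closed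
under the logical operations and quantification over points, and definable equivalence relations have
quotients (`exists_quotient`).

*The group of an internality structure.* If `τ` is in the group of `(X, f)`, then `τ q` is the only
`q'` with `f(q', τ x₀) = f(q, x₀)`. Hence `τ` is determined by `(x₀, τ x₀)` for any single `x₀`, and
the pairs `(x₀, x₁)` arising in this way form a definable set. The group is the quotient of this set
by equality of the induced permutations, and so is definable (`IsInternal.exists_defGroup`).
Stabilizers of definable relations are definable subgroups, so that arbitrary collections of relations
have `ω`-groups as automorphism groups (`IsInternal.exists_omegaGroup_autGroup`). Conversely, let an
`ω`-group `G` act faithfully on `Q`. By compactness, some definable group `G₀` containing it acts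
faithfully (`OmegaGroup.exists_definable_overgroup`). The translates of the maps `f(·, x)` by `G₀` form
a new set `X'`. A permutation of `X'` preserving the maps from `X'` to its quotients by the orbits of
`G₀` and of the defining subgroups of `G` agrees at one point with an element of each of them, and thus
is in `G` (`IsInternal.exists_realisation`).

*Internality from separation.* Suppose that, over finitely many parameters, finitely many definable
families of subsets of powers of `C` distinguish any two points of `Q`. Mapping a point of `Q` to the
sets that it defines is then injective, and by stable embeddedness these sets are points of `C^eq`.
This makes `Q` internal to `C` (`SepData.exists_isInternal`). Internality thus follows if the failure
of separation (`¬ Separated`) can be refuted. Two facts are used for this. Without separation, there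
are, over few parameters and in a sufficiently saturated situation, points `q₁ ≠ q₂` of `Q` with the
same type over `C`. By stable embeddedness, a map preserving types over `C` (`CEq`) can be extended to
further points, although `C` itself may be large: finite parts of types over `C` need only finitely
many parameters in `C` (`CEq.exists_same`). So a partial map can be extended in two ways, since both
`q₁` and `q₂` may be mapped to the same point, and for each prescribed permutation one of these ways
disagrees with it.

*Saturated models.* If `Q` is not separated in the saturated model `M`, then a back-and-forth
construction of length `|M|` produces a permutation that differs from each of `|M|` given ones
(`exists_perm_avoiding`). For `|H| ≤ |M|` this contradicts the choice of `H`, so that `Q` is separated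
and hence internal to `C` (`exists_internality_of_isSaturated`).

*The theory `T_Δ`.* Elements of `G(M)` are automorphisms of `M_Δ`, and therefore extend to the sort `X`
of any internality structure of `T_Δ` (`exists_deltaPreserves`). The construction of the `ω`-group of a
datum depends on the datum only through the permutations of `Q` (`exists_omegaGroup_of_datum`). For the
internality of `Q` to `C` in `T_Δ`, assume that separation fails in some `M_Δ`, and let `(X, f)` be a
datum in `T`. An extension of `g ∈ G` to `X` is determined by the image `x₁` of one point `x₀`, and it
determines `g`. In an elementary extension of `M`, a partial map of `Q` preserving types over `C` in
`M_Δ` can be extended so as to exclude all points `x₁` of `X(M)` as images of `x₀`: if its range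
contains `Q(M)`, at most one `x₁` is compatible with it, and this one can be avoided
(`QElem.exists_step`). The union of a countable elementary chain of such extensions has an element of
`G` that does not extend to `X`, which is a contradiction (`separated_of_datum`). By compactness,
separation is uniform in all `M_Δ`, and this is a property of `T_Δ` because formulas of `L_Δ` translate
into formulas of `L` (`DefOn.realize_bounded`, `exists_isInternal_delta`).
-/

namespace Internality

variable {L : FirstOrder.Language.{u, v}}

/-! ### Points and their representatives -/

namespace EqSet

variable {X : EqSet L} {M : Type w} [L.Structure M]

theorem exists_rep (x : X.Pts M) : ∃ a, X.Rep a x := by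
  obtain ⟨⟨a, h⟩, rfl⟩ := Quotient.exists_rep x
  exact ⟨a, h, rfl⟩

theorem exists_rep_of_dom {a : Fin X.arity → M} (h : X.dom.Realize a) :
    ∃ x : X.Pts M, X.Rep a x := ⟨_, h, rfl⟩

theorem Rep.dom {a : Fin X.arity → M} {x : X.Pts M} (h : X.Rep a x) : X.dom.Realize a := h.1

theorem Rep.unique {a : Fin X.arity → M} {x y : X.Pts M} (h : X.Rep a x) (h' : X.Rep a y) :
    x = y := by
  obtain ⟨h, rfl⟩ := h
  obtain ⟨h', rfl⟩ := h'
  rfl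

theorem Rep.eq_iff {a b : Fin X.arity → M} {x y : X.Pts M} (h : X.Rep a x) (h' : X.Rep b y) :
    x = y ↔ ∀ z : Fin X.aux → M,
      X.fam.Realize (Sum.elim a z) ↔ X.fam.Realize (Sum.elim b z) := by
  obtain ⟨h, rfl⟩ := h
  obtain ⟨h', rfl⟩ := h'
  exact Quotient.eq (r := X.setoid M)

theorem exists_reps {ι : Type*} {S : ι → EqSet L} (x : ∀ i, (S i).Pts M) :
    ∃ a : ∀ i, Fin (S i).arity → M, ∀ i, (S i).Rep (a i) (x i) :=
  ⟨fun i => (exists_rep (x i)).choose, fun i => (exists_rep (x i)).choose_spec⟩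

end EqSet

theorem realize_congr {M : Type w} [L.Structure M] {α : Type*} (φ : L.Formula α) {v v' : α → M}
    (h : ∀ i, v i = v' i) : φ.Realize v ↔ φ.Realize v' := by
  rw [funext h]

/-! ### Definable relations on tuples of elements -/

section RawDef

variable {J : Type*} {N : J → Type w} [∀ j, L.Structure (N j)]

/-- A family of relations, one in each structure `N j`, that is defined by a single formula. -/
def RawDef (N : J → Type w) [∀ j, L.Structure (N j)] {α : Type*}
    (R : ∀ j, (α → N j) → Prop) : Prop :=
  ∃ φ : L.Formula α, ∀ j v, φ.Realize v ↔ R j v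

namespace RawDef

variable {α β : Type*} {P R : ∀ j, (α → N j) → Prop}

theorem formula (φ : L.Formula α) : RawDef (L := L) N (fun _ v => φ.Realize v) :=
  ⟨φ, fun _ _ => Iff.rfl⟩

theorem congr (h : RawDef (L := L) N P) (e : ∀ j v, P j v ↔ R j v) : RawDef (L := L) N R := by
  obtain ⟨φ, hφ⟩ := h
  exact ⟨φ, fun j v => (hφ j v).trans (e j v)⟩

theorem and (h : RawDef (L := L) N P) (h' : RawDef (L := L) N R) :
    RawDef (L := L) N (fun j v => P j v ∧ R j v) := by
  obtain ⟨φ, hφ⟩ := h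
  obtain ⟨ψ, hψ⟩ := h'
  exact ⟨φ ⊓ ψ, fun j v => by simp [hφ, hψ]⟩

theorem imp (h : RawDef (L := L) N P) (h' : RawDef (L := L) N R) :
    RawDef (L := L) N (fun j v => P j v → R j v) := by
  obtain ⟨φ, hφ⟩ := h
  obtain ⟨ψ, hψ⟩ := h'
  exact ⟨φ.imp ψ, fun j v => by simp [hφ, hψ]⟩

theorem iff (h : RawDef (L := L) N P) (h' : RawDef (L := L) N R) :
    RawDef (L := L) N (fun j v => (P j v ↔ R j v)) :=
  ((h.imp h').and (h'.imp h)).congr fun _ _ => iff_def.symm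

theorem all [Finite β] {P : ∀ j, (α → N j) → (β → N j) → Prop}
    (h : RawDef (L := L) N (fun j (v : α ⊕ β → N j) => P j (v ∘ Sum.inl) (v ∘ Sum.inr))) :
    RawDef (L := L) N (fun j v => ∀ z, P j v z) := by
  obtain ⟨φ, hφ⟩ := h
  refine ⟨φ.iAlls β, fun j v => ?_⟩
  rw [Language.Formula.realize_iAlls]
  exact forall_congr' fun z => hφ j (Sum.elim v z)

theorem ex [Finite β] {P : ∀ j, (α → N j) → (β → N j) → Prop}
    (h : RawDef (L := L) N (fun j (v : α ⊕ β → N j) => P j (v ∘ Sum.inl) (v ∘ Sum.inr))) :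
    RawDef (L := L) N (fun j v => ∃ z, P j v z) := by
  obtain ⟨φ, hφ⟩ := h
  refine ⟨φ.iExs β, fun j v => ?_⟩
  rw [Language.Formula.realize_iExs]
  exact exists_congr fun z => hφ j (Sum.elim v z)

theorem finiteAll [Finite β] {P : β → ∀ j, (α → N j) → Prop}
    (h : ∀ b, RawDef (L := L) N (P b)) : RawDef (L := L) N (fun j v => ∀ b, P b j v) := by
  choose φ hφ using h
  exact ⟨Language.Formula.iInf φ, fun j v => by simp [Language.Formula.realize_iInf, hφ]⟩

theorem comap {P : ∀ j, (β → N j) → Prop} (h : RawDef (L := L) N P) (σ : β → α) :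
    RawDef (L := L) N (fun j v => P j (v ∘ σ)) := by
  obtain ⟨φ, hφ⟩ := h
  exact ⟨φ.relabel σ, fun j v => by rw [Language.Formula.realize_relabel, hφ]⟩

end RawDef

end RawDef

/-! ### Definable relations on tuples of points -/

section DefOn

variable {J : Type*} {N : J → Type w} [∀ j, L.Structure (N j)]

/-- A family of relations, one in each structure `N j`, on tuples of points of the definable sets
`S i`, that is defined by a single formula in terms of arbitrary representatives. -/
def DefOn (N : J → Type w) [∀ j, L.Structure (N j)] {ι : Type*} (S : ι → EqSet L)
    (R : ∀ j, (∀ i, (S i).Pts (N j)) → Prop) : Prop :=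
  ∃ φ : L.Formula (Σ i, Fin (S i).arity), ∀ j (a : ∀ i, Fin (S i).arity → N j) x,
    (∀ i, (S i).Rep (a i) (x i)) → (φ.Realize (fun p => a p.1 p.2) ↔ R j x)

/-- A family of maps taking tuples of points of the sets `S i` to points of `Z`, in such a way that
a representative of the value consists of entries of representatives of the arguments.  This covers
the coordinate maps, up to identifications of equal sets. -/
def DVar (N : J → Type w) [∀ j, L.Structure (N j)] {ι : Type*} (S : ι → EqSet L) {Z : EqSet L}
    (t : ∀ j, (∀ i, (S i).Pts (N j)) → Z.Pts (N j)) : Prop :=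
  ∃ σ : Fin Z.arity → Σ i, Fin (S i).arity, ∀ j (a : ∀ i, Fin (S i).arity → N j) x,
    (∀ i, (S i).Rep (a i) (x i)) → Z.Rep (fun k => a (σ k).1 (σ k).2) (t j x)

namespace DVar

variable {ι : Type*} {S : ι → EqSet L}

theorem var (i : ι) : DVar N S (fun _ x => x i) :=
  ⟨fun k => ⟨i, k⟩, fun _ _ _ h => h i⟩

end DVar

namespace DefOn

variable {ι κ : Type*} {S : ι → EqSet L} {P R : ∀ j, (∀ i, (S i).Pts (N j)) → Prop}

theorem of_rawDef {R' : ∀ j, ((Σ i, Fin (S i).arity) → N j) → Prop} (h : RawDef (L := L) N R')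
    (e : ∀ j (a : ∀ i, Fin (S i).arity → N j) x, (∀ i, (S i).Rep (a i) (x i)) →
      (R' j (fun p => a p.1 p.2) ↔ R j x)) : DefOn N S R := by
  obtain ⟨φ, hφ⟩ := h
  exact ⟨φ, fun j a x h => (hφ _ _).trans (e j a x h)⟩

theorem congr (h : DefOn N S P) (e : ∀ j x, P j x ↔ R j x) : DefOn N S R := by
  obtain ⟨φ, hφ⟩ := h
  exact ⟨φ, fun j a x h => (hφ j a x h).trans (e j x)⟩

theorem not (h : DefOn N S P) : DefOn N S (fun j x => ¬ P j x) := by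
  obtain ⟨φ, hφ⟩ := h
  exact ⟨φ.not, fun j a x h => by simp [hφ j a x h]⟩

theorem and (h : DefOn N S P) (h' : DefOn N S R) : DefOn N S (fun j x => P j x ∧ R j x) := by
  obtain ⟨φ, hφ⟩ := h
  obtain ⟨ψ, hψ⟩ := h'
  exact ⟨φ ⊓ ψ, fun j a x h => by simp [hφ j a x h, hψ j a x h]⟩

theorem imp (h : DefOn N S P) (h' : DefOn N S R) : DefOn N S (fun j x => P j x → R j x) := by
  obtain ⟨φ, hφ⟩ := h
  obtain ⟨ψ, hψ⟩ := h'
  exact ⟨φ.imp ψ, fun j a x h => by simp [hφ j a x h, hψ j a x h]⟩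

theorem or (h : DefOn N S P) (h' : DefOn N S R) : DefOn N S (fun j x => P j x ∨ R j x) :=
  (h.not.imp h').congr fun _ _ => or_iff_not_imp_left.symm

theorem iff (h : DefOn N S P) (h' : DefOn N S R) :
    DefOn N S (fun j x => (P j x ↔ R j x)) :=
  ((h.imp h').and (h'.imp h)).congr fun _ _ => iff_def.symm

theorem true : DefOn N S (fun _ _ => True) :=
  ⟨⊤, fun _ _ _ _ => by simp⟩

/-- Quantification over a finite tuple of points. -/
theorem exFam [Finite κ] {Z : κ → EqSet L}
    {P : ∀ j, (∀ i, (S i).Pts (N j)) → (∀ k, (Z k).Pts (N j)) → Prop}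
    (h : DefOn N (Sum.elim S Z) (fun j x => P j (fun i => x (Sum.inl i)) (fun k => x (Sum.inr k)))) :
    DefOn N S (fun j x => ∃ z, P j x z) := by
  obtain ⟨φ, hφ⟩ := h
  have h1 : RawDef (L := L) N (fun j (v : (Σ i, Fin (S i).arity) → N j) =>
      ∃ b : (Σ k, Fin (Z k).arity) → N j, (∀ k, (Z k).dom.Realize (fun l => b ⟨k, l⟩)) ∧
        φ.Realize (fun p : Σ i, Fin (Sum.elim S Z i).arity =>
          match p with
          | ⟨.inl i, l⟩ => v ⟨i, l⟩
          | ⟨.inr k, l⟩ => b ⟨k, l⟩)) := by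
    refine RawDef.ex (RawDef.and (RawDef.finiteAll fun k => ?_) ?_)
    · exact (RawDef.formula (Z k).dom).comap
        (fun l => (Sum.inr ⟨k, l⟩ : (Σ i, Fin (S i).arity) ⊕ Σ k, Fin (Z k).arity))
    · refine ((RawDef.formula φ).comap (fun p : Σ i, Fin (Sum.elim S Z i).arity =>
          match p with
          | ⟨.inl i, l⟩ => Sum.inl ⟨i, l⟩
          | ⟨.inr k, l⟩ => Sum.inr ⟨k, l⟩)).congr fun j v => ?_
      refine iff_of_eq (congrArg _ (funext fun p => ?_))
      rcases p with ⟨i | k, l⟩ <;> rfl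
  refine of_rawDef h1 fun j a x hx => ?_
  have key : ∀ (b : (Σ k, Fin (Z k).arity) → N j) (z : ∀ k, (Z k).Pts (N j)),
      (∀ k, (Z k).Rep (fun l => b ⟨k, l⟩) (z k)) →
      (φ.Realize (fun p : Σ i, Fin (Sum.elim S Z i).arity =>
          match p with
          | ⟨.inl i, l⟩ => a i l
          | ⟨.inr k, l⟩ => b ⟨k, l⟩) ↔ P j x z) := by
    intro b z hz
    refine (realize_congr φ fun p => ?_).trans (hφ j (fun i => match i with
      | .inl i => a i
      | .inr k => fun l => b ⟨k, l⟩) (fun i => match i with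
      | .inl i => x i
      | .inr k => z k) (fun i => by rcases i with i | k; exacts [hx i, hz k]))
    rcases p with ⟨i | k, l⟩ <;> rfl
  constructor
  · rintro ⟨b, hb, h⟩
    choose z hz using fun k => EqSet.exists_rep_of_dom (hb k)
    exact ⟨z, (key b z hz).1 h⟩
  · rintro ⟨z, h⟩
    obtain ⟨b, hb⟩ := EqSet.exists_reps z
    exact ⟨fun p => b p.1 p.2, fun k => (hb k).dom, (key (fun p => b p.1 p.2) z hb).2 h⟩

theorem allFam [Finite κ] {Z : κ → EqSet L}
    {P : ∀ j, (∀ i, (S i).Pts (N j)) → (∀ k, (Z k).Pts (N j)) → Prop}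
    (h : DefOn N (Sum.elim S Z) (fun j x => P j (fun i => x (Sum.inl i)) (fun k => x (Sum.inr k)))) :
    DefOn N S (fun j x => ∀ z, P j x z) :=
  (exFam (P := fun j x z => ¬ P j x z) h.not).not.congr fun _ _ => by simp

theorem finiteAll [Finite κ] {P : κ → ∀ j, (∀ i, (S i).Pts (N j)) → Prop}
    (h : ∀ k, DefOn N S (P k)) : DefOn N S (fun j x => ∀ k, P k j x) := by
  choose φ hφ using h
  exact ⟨Language.Formula.iInf φ, fun j a x h => by
    simp only [Language.Formula.realize_iInf, fun k => hφ k j a x h]⟩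

theorem subst {T : κ → EqSet L} {P : ∀ j, (∀ k, (T k).Pts (N j)) → Prop} (h : DefOn N T P)
    {t : ∀ k j, (∀ i, (S i).Pts (N j)) → (T k).Pts (N j)} (ht : ∀ k, DVar N S (t k)) :
    DefOn N S (fun j x => P j (fun k => t k j x)) := by
  obtain ⟨φ, hφ⟩ := h
  choose σ hσ using ht
  refine ⟨φ.relabel (fun p => σ p.1 p.2), fun j a x hx => ?_⟩
  exact Language.Formula.realize_relabel.trans
    (hφ j (fun k l => a (σ k l).1 (σ k l).2) _ (fun k => hσ k j a x hx))

theorem ex {Z : EqSet L} {P : ∀ j, (∀ i, (S i).Pts (N j)) → Z.Pts (N j) → Prop}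
    (h : DefOn N (Sum.elim S (fun _ : Unit => Z))
      (fun j x => P j (fun i => x (Sum.inl i)) (x (Sum.inr ())))) :
    DefOn N S (fun j x => ∃ z, P j x z) :=
  (exFam (κ := Unit) (Z := fun _ => Z) (P := fun j x z => P j x (z ())) h).congr fun _ _ =>
    ⟨fun ⟨z, h⟩ => ⟨z (), h⟩, fun ⟨z, h⟩ => ⟨fun _ => z, h⟩⟩

theorem all {Z : EqSet L} {P : ∀ j, (∀ i, (S i).Pts (N j)) → Z.Pts (N j) → Prop}
    (h : DefOn N (Sum.elim S (fun _ : Unit => Z))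
      (fun j x => P j (fun i => x (Sum.inl i)) (x (Sum.inr ())))) :
    DefOn N S (fun j x => ∀ z, P j x z) :=
  (ex (P := fun j x z => ¬ P j x z) h.not).not.congr fun _ _ => by simp

theorem eq {Z : EqSet L} {t s : ∀ j, (∀ i, (S i).Pts (N j)) → Z.Pts (N j)}
    (ht : DVar N S t) (hs : DVar N S s) : DefOn N S (fun j x => t j x = s j x) := by
  obtain ⟨σ, hσ⟩ := ht
  obtain ⟨τ, hτ⟩ := hs
  have h1 : RawDef (L := L) N (fun j (v : (Σ i, Fin (S i).arity) → N j) =>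
      ∀ y : Fin Z.aux → N j, Z.fam.Realize (Sum.elim (fun k => v (σ k)) y) ↔
        Z.fam.Realize (Sum.elim (fun k => v (τ k)) y)) := by
    refine RawDef.all (RawDef.iff ?_ ?_)
    · refine ((RawDef.formula Z.fam).comap (Sum.map σ id)).congr fun j v => ?_
      refine iff_of_eq (congrArg _ (funext fun p => ?_))
      rcases p with i | k <;> rfl
    · refine ((RawDef.formula Z.fam).comap (Sum.map τ id)).congr fun j v => ?_
      refine iff_of_eq (congrArg _ (funext fun p => ?_))
      rcases p with i | k <;> rfl
  exact of_rawDef h1 fun j a x hx => ((hσ j a x hx).eq_iff (hτ j a x hx)).symm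

/-- The relation consisting of the tuples that have some representatives satisfying a formula. -/
theorem holds [Finite ι] (φ : L.Formula (Σ i, Fin (S i).arity)) :
    DefOn N S (fun j x => ∃ a : ∀ i, Fin (S i).arity → N j,
      (∀ i, (S i).Rep (a i) (x i)) ∧ φ.Realize (fun p => a p.1 p.2)) := by
  have h1 : RawDef (L := L) N (fun j (v : (Σ i, Fin (S i).arity) → N j) =>
      ∃ b : (Σ i, Fin (S i).arity) → N j, (∀ i, (S i).dom.Realize (fun l => b ⟨i, l⟩) ∧
        ∀ y : Fin (S i).aux → N j, (S i).fam.Realize (Sum.elim (fun k => b ⟨i, k⟩) y) ↔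
        (S i).fam.Realize (Sum.elim (fun k => v ⟨i, k⟩) y)) ∧ φ.Realize b) := by
    refine RawDef.ex (RawDef.and (RawDef.finiteAll fun i => RawDef.and ?_
      (RawDef.all (RawDef.iff ?_ ?_))) ?_)
    · exact (RawDef.formula (S i).dom).comap
        (fun l => (Sum.inr ⟨i, l⟩ : (Σ i, Fin (S i).arity) ⊕ Σ i, Fin (S i).arity))
    · refine ((RawDef.formula (S i).fam).comap
        (Sum.map (fun l => Sum.inr ⟨i, l⟩) id)).congr fun j v => ?_
      refine iff_of_eq (congrArg _ (funext fun p => ?_))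
      rcases p with i | k <;> rfl
    · refine ((RawDef.formula (S i).fam).comap
        (Sum.map (fun l => Sum.inl ⟨i, l⟩) id)).congr fun j v => ?_
      refine iff_of_eq (congrArg _ (funext fun p => ?_))
      rcases p with i | k <;> rfl
    · exact (RawDef.formula φ).comap Sum.inr
  refine of_rawDef h1 fun j a x hx => ?_
  constructor
  · rintro ⟨b, hb, h⟩
    refine ⟨fun i l => b ⟨i, l⟩, fun i => ?_, h⟩
    obtain ⟨y, hy⟩ := EqSet.exists_rep_of_dom (hb i).1
    rwa [← (hy.eq_iff (hx i)).2 (hb i).2]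
  · rintro ⟨b, hb, h⟩
    exact ⟨fun p => b p.1 p.2, fun i => ⟨(hb i).dom, ((hb i).eq_iff (hx i)).1 rfl⟩, h⟩

end DefOn

/-! ### The various notions of definable relation -/

theorem DefOn.rel₁ {ι : Type*} {S : ι → EqSet L} {X : EqSet L} (φ : Rel₁ X)
    {t : ∀ j, (∀ i, (S i).Pts (N j)) → X.Pts (N j)} (ht : DVar N S t) :
    DefOn N S (fun j x => φ.Holds (t j x)) := by
  have h := DefOn.holds (N := N) (S := fun _ : Unit => X)
    (Language.Formula.relabel (fun l => (⟨(), l⟩ : Σ _ : Unit, Fin X.arity)) φ)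
  refine ((h.congr (R := fun j x => φ.Holds (x ())) fun j x => ?_).subst
    (t := fun _ => t) fun _ => ht)
  constructor
  · rintro ⟨a, ha, h⟩
    have h' := Language.Formula.realize_relabel.1 h
    exact ⟨a (), ha (), h'⟩
  · rintro ⟨a, ha, h⟩
    exact ⟨fun _ => a, fun _ => ha, Language.Formula.realize_relabel.2 h⟩

theorem DefOn.exists_rel₁ {X : EqSet L} {R : ∀ j, X.Pts (N j) → Prop}
    (h : DefOn N (fun _ : Unit => X) (fun j x => R j (x ()))) :
    ∃ φ : Rel₁ X, ∀ j x, φ.Holds x ↔ R j x := by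
  obtain ⟨φ, hφ⟩ := h
  have key : ∀ j (a : Fin X.arity → N j) x, X.Rep a x →
      (Language.Formula.Realize (Language.Formula.relabel Sigma.snd φ) a ↔ R j x) := by
    intro j a x ha
    exact Language.Formula.realize_relabel.trans (hφ j (fun _ => a) (fun _ => x) (fun _ => ha))
  refine ⟨Language.Formula.relabel Sigma.snd φ, fun j x => ?_⟩
  constructor
  · rintro ⟨a, ha, h⟩
    exact (key j a x ha).1 h
  · intro h
    obtain ⟨a, ha⟩ := EqSet.exists_rep x
    exact ⟨a, ha, (key j a x ha).2 h⟩

/-- The three factors of a product. -/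
abbrev triple (X Y Z : EqSet L) : Unit ⊕ (Unit ⊕ Unit) → EqSet L :=
  Sum.elim (fun _ => X) (Sum.elim (fun _ => Y) (fun _ => Z))

theorem DefOn.rel₃ {ι : Type*} {S : ι → EqSet L} {X Y Z : EqSet L} (φ : Rel₃ X Y Z)
    {t : ∀ j, (∀ i, (S i).Pts (N j)) → X.Pts (N j)} {s : ∀ j, (∀ i, (S i).Pts (N j)) → Y.Pts (N j)}
    {r : ∀ j, (∀ i, (S i).Pts (N j)) → Z.Pts (N j)}
    (ht : DVar N S t) (hs : DVar N S s) (hr : DVar N S r) :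
    DefOn N S (fun j x => φ.Holds (t j x) (s j x) (r j x)) := by
  have h := DefOn.holds (N := N) (S := triple X Y Z)
    (Language.Formula.relabel (fun l => match l with
      | .inl l => ⟨.inl (), l⟩
      | .inr (.inl l) => ⟨.inr (.inl ()), l⟩
      | .inr (.inr l) => ⟨.inr (.inr ()), l⟩) φ)
  refine ((h.congr (R := fun j x => φ.Holds (x (.inl ())) (x (.inr (.inl ())))
    (x (.inr (.inr ())))) fun j x => ?_).subst (t := fun k => match k with
      | .inl _ => t
      | .inr (.inl _) => s
      | .inr (.inr _) => r) fun k => ?_)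
  · constructor
    · rintro ⟨a, ha, h⟩
      refine ⟨a (.inl ()), a (.inr (.inl ())), a (.inr (.inr ())), ha (.inl ()), ha (.inr (.inl ())),
        ha (.inr (.inr ())), (realize_congr (L := L) φ fun l => ?_).1
          (Language.Formula.realize_relabel.1 h)⟩
      rcases l with l | l | l <;> rfl
    · rintro ⟨a, b, c, ha, hb, hc, h⟩
      refine ⟨fun k => match k with
        | .inl _ => a
        | .inr (.inl _) => b
        | .inr (.inr _) => c, fun k => ?_, ?_⟩
      · rcases k with k | k | k
        exacts [ha, hb, hc]
      · refine Language.Formula.realize_relabel.2 ((realize_congr (L := L) φ fun l => ?_).1 h)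
        rcases l with l | l | l <;> rfl
  · rcases k with k | k | k
    exacts [ht, hs, hr]

/-- A ternary relation that is definable in the sense of `DefOn` is given by an element of `Rel₃`. -/
theorem DefOn.exists_rel₃ {X Y Z : EqSet L} {R : ∀ j, X.Pts (N j) → Y.Pts (N j) → Z.Pts (N j) → Prop}
    (h : DefOn N (triple X Y Z) (fun j x => R j (x (.inl ())) (x (.inr (.inl ())))
      (x (.inr (.inr ()))))) :
    ∃ φ : Rel₃ X Y Z, ∀ j x y z, φ.Holds x y z ↔ R j x y z := by
  obtain ⟨φ, hφ⟩ := h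
  let φ' : Rel₃ X Y Z := Language.Formula.relabel (fun p => match p with
    | ⟨.inl _, l⟩ => .inl l
    | ⟨.inr (.inl _), l⟩ => .inr (.inl l)
    | ⟨.inr (.inr _), l⟩ => .inr (.inr l)) φ
  have key : ∀ j (a : Fin X.arity → N j) b c x y z, X.Rep a x → Y.Rep b y → Z.Rep c z →
      (Language.Formula.Realize φ' (Sum.elim a (Sum.elim b c)) ↔ R j x y z) := by
    intro j a b c x y z ha hb hc
    refine Language.Formula.realize_relabel.trans ((realize_congr φ fun p => ?_).trans
      (hφ j (fun k => match k with
        | .inl _ => a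
        | .inr (.inl _) => b
        | .inr (.inr _) => c) (fun k => match k with
        | .inl _ => x
        | .inr (.inl _) => y
        | .inr (.inr _) => z) (fun k => by
          rcases k with k | k | k
          exacts [ha, hb, hc])))
    rcases p with ⟨k | k | k, l⟩ <;> rfl
  refine ⟨φ', fun j x y z => ?_⟩
  constructor
  · rintro ⟨a, b, c, ha, hb, hc, h⟩
    exact (key j a b c x y z ha hb hc).1 h
  · intro h
    obtain ⟨a, ha⟩ := EqSet.exists_rep x
    obtain ⟨b, hb⟩ := EqSet.exists_rep y
    obtain ⟨c, hc⟩ := EqSet.exists_rep z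
    exact ⟨a, b, c, ha, hb, hc, (key j a b c x y z ha hb hc).2 h⟩

theorem DefOn.relPow {ι : Type*} {S : ι → EqSet L} {C Y : EqSet L} {k : ℕ} (φ : RelPow C k Y)
    {t : ∀ j, (∀ i, (S i).Pts (N j)) → Fin k → C.Pts (N j)}
    {s : ∀ j, (∀ i, (S i).Pts (N j)) → Y.Pts (N j)}
    (ht : ∀ i, DVar N S (fun j x => t j x i)) (hs : DVar N S s) :
    DefOn N S (fun j x => φ.Holds (t j x) (s j x)) := by
  have h := DefOn.holds (N := N) (S := Sum.elim (fun _ : Fin k => C) (fun _ : Unit => Y))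
    (Language.Formula.relabel (fun l => match l with
      | .inl (i, l) => ⟨.inl i, l⟩
      | .inr l => ⟨.inr (), l⟩) φ)
  refine ((h.congr (R := fun j x => φ.Holds (fun i => x (.inl i)) (x (.inr ())))
    fun j x => ?_).subst (t := fun k => match k with
      | .inl i => fun j x => t j x i
      | .inr _ => s) fun k => ?_)
  · constructor
    · rintro ⟨a, ha, h⟩
      refine ⟨fun i => a (.inl i), a (.inr ()), fun i => ha (.inl i), ha (.inr ()),
        (realize_congr (L := L) φ fun l => ?_).1 (Language.Formula.realize_relabel.1 h)⟩
      rcases l with l | l <;> rfl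
    · rintro ⟨a, b, ha, hb, h⟩
      refine ⟨fun k => match k with
        | .inl i => a i
        | .inr _ => b, fun k => ?_, ?_⟩
      · rcases k with k | k
        exacts [ha k, hb]
      · refine Language.Formula.realize_relabel.2 ((realize_congr (L := L) φ fun l => ?_).1 h)
        rcases l with l | l <;> rfl
  · rcases k with k | k
    exacts [ht k, hs]

theorem DefOn.exists_relPow {C Y : EqSet L} {k : ℕ}
    {R : ∀ j, (Fin k → C.Pts (N j)) → Y.Pts (N j) → Prop}
    (h : DefOn N (Sum.elim (fun _ : Fin k => C) (fun _ : Unit => Y))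
      (fun j x => R j (fun i => x (.inl i)) (x (.inr ())))) :
    ∃ φ : RelPow C k Y, ∀ j x y, φ.Holds x y ↔ R j x y := by
  obtain ⟨φ, hφ⟩ := h
  let φ' : RelPow C k Y := Language.Formula.relabel (fun p => match p with
    | ⟨.inl i, l⟩ => .inl (i, l)
    | ⟨.inr _, l⟩ => .inr l) φ
  have key : ∀ j (a : Fin k → Fin C.arity → N j) b x y, (∀ i, C.Rep (a i) (x i)) → Y.Rep b y →
      (Language.Formula.Realize φ' (Sum.elim (fun p => a p.1 p.2) b) ↔ R j x y) := by
    intro j a b x y ha hb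
    refine Language.Formula.realize_relabel.trans ((realize_congr φ fun p => ?_).trans
      (hφ j (fun k => match k with
        | .inl i => a i
        | .inr _ => b) (fun k => match k with
        | .inl i => x i
        | .inr _ => y) (fun k => by
          rcases k with k | k
          exacts [ha k, hb])))
    rcases p with ⟨k | k, l⟩ <;> rfl
  refine ⟨φ', fun j x y => ?_⟩
  constructor
  · rintro ⟨a, b, ha, hb, h⟩
    exact (key j a b x y ha hb).1 h
  · intro h
    obtain ⟨a, ha⟩ := EqSet.exists_reps x
    obtain ⟨b, hb⟩ := EqSet.exists_rep y
    exact ⟨a, b, ha, hb, (key j a b x y ha hb).2 h⟩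

theorem DefOn.defRel {ι κ : Type*} {S : ι → EqSet L} {S' : κ → EqSet L} (R : DefRel S')
    {t : ∀ i j, (∀ i, (S i).Pts (N j)) → (S' (R.slot i)).Pts (N j)} (ht : ∀ i, DVar N S (t i)) :
    DefOn N S (fun j x => R.Holds (N j) (fun i => t i j x)) :=
  (DefOn.holds (N := N) (S := fun i => S' (R.slot i)) R.form).subst ht

theorem DefOn.exists_defRel {κ : Type*} {S : κ → EqSet L} {n : ℕ} (slot : Fin n → κ)
    {R : ∀ j, (∀ i, (S (slot i)).Pts (N j)) → Prop} (h : DefOn N (fun i => S (slot i)) R) :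
    ∃ φ : L.Formula (Σ i : Fin n, Fin (S (slot i)).arity), ∀ j x,
      (DefRel.mk n slot φ : DefRel S).Holds (N j) x ↔ R j x := by
  obtain ⟨φ, hφ⟩ := h
  refine ⟨φ, fun j x => ⟨?_, fun h => ?_⟩⟩
  · rintro ⟨a, ha, h⟩
    exact (hφ j a x ha).1 h
  · obtain ⟨a, ha⟩ := EqSet.exists_reps x
    exact ⟨a, ha, (hφ j a x ha).2 h⟩

/-! ### Quotients -/

/-- Every definable equivalence relation on a definable subset of a finite product of definable sets
has a quotient among the definable sets. -/
theorem exists_quotient {ι : Type*} [Finite ι] {S : ι → EqSet L}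
    {D : ∀ j, (∀ i, (S i).Pts (N j)) → Prop} (hD : DefOn N S D)
    {E : ∀ j, (∀ i, (S i).Pts (N j)) → (∀ i, (S i).Pts (N j)) → Prop}
    (hE : DefOn N (Sum.elim S S) (fun j x => E j (fun i => x (.inl i)) (fun i => x (.inr i))))
    (hequiv : ∀ j, Equivalence (fun x y : {x // D j x} => E j x.1 y.1)) :
    ∃ (Z : EqSet L) (mk : ∀ j, {x // D j x} → Z.Pts (N j)),
      (∀ j, Function.Surjective (mk j)) ∧ (∀ j x y, mk j x = mk j y ↔ E j x.1 y.1) ∧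
      DefOn N (Sum.elim S (fun _ : Unit => Z))
        (fun j x => ∃ h : D j (fun i => x (.inl i)), mk j ⟨_, h⟩ = x (.inr ())) := by
  obtain ⟨δ, hδ⟩ := hD
  obtain ⟨ε, hε⟩ := hE
  obtain ⟨n, ⟨e⟩⟩ := Finite.exists_equiv_fin (Σ i, Fin (S i).arity)
  -- representatives of points of the quotient are representatives of tuples
  have hdom : RawDef (L := L) N (fun j (v : Fin n → N j) =>
      (∀ i, (S i).dom.Realize (fun l => v (e ⟨i, l⟩))) ∧ δ.Realize (fun p => v (e p))) :=
    (RawDef.finiteAll fun i => (RawDef.formula (S i).dom).comap _).and ((RawDef.formula δ).comap _)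
  obtain ⟨dom, hdom⟩ := hdom
  have hfam : RawDef (L := L) N (fun j (v : Fin n ⊕ Fin n → N j) =>
      dom.Realize (fun k => v (.inr k)) ∧
      ε.Realize (fun p : Σ i, Fin (Sum.elim S S i).arity => match p with
        | ⟨.inl i, l⟩ => v (.inl (e ⟨i, l⟩))
        | ⟨.inr i, l⟩ => v (.inr (e ⟨i, l⟩)))) := by
    refine ((RawDef.formula dom).comap _).and (((RawDef.formula ε).comap
      (fun p : Σ i, Fin (Sum.elim S S i).arity => match p with
        | ⟨.inl i, l⟩ => .inl (e ⟨i, l⟩)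
        | ⟨.inr i, l⟩ => .inr (e ⟨i, l⟩))).congr fun j v => ?_)
    refine iff_of_eq (congrArg _ (funext fun p => ?_))
    rcases p with ⟨k | k, l⟩ <;> rfl
  obtain ⟨fam, hfam⟩ := hfam
  -- a representative of a tuple, viewed as a parameter, defines the set of representatives of its class
  let Z : EqSet L := ⟨n, dom, n, fam⟩
  have hes : ∀ {j} (a : ∀ i, Fin (S i).arity → N j) p,
      a (e.symm (e p)).1 (e.symm (e p)).2 = a p.1 p.2 := by
    intro j a p
    rw [Equiv.symm_apply_apply]
  have hfam' : ∀ j (a b : ∀ i, Fin (S i).arity → N j) x y, (∀ i, (S i).Rep (a i) (x i)) →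
      (∀ i, (S i).Rep (b i) (y i)) →
      (fam.Realize (Sum.elim (fun k => a (e.symm k).1 (e.symm k).2)
        (fun k => b (e.symm k).1 (e.symm k).2)) ↔ D j y ∧ E j x y) := by
    intro j a b x y ha hb
    refine (hfam j _).trans (and_congr ((hdom _ _).trans ?_) ?_)
    · refine (and_congr (forall_congr' fun i => realize_congr _ fun l => hes b ⟨i, l⟩)
        (realize_congr _ fun p => hes b p)).trans ?_
      exact (and_iff_right fun i => (hb i).dom).trans (hδ j b y hb)
    · refine (realize_congr ε fun p => ?_).trans (hε j (fun k => match k with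
        | .inl i => a i
        | .inr i => b i) (fun k => match k with
        | .inl i => x i
        | .inr i => y i) (fun k => by rcases k with k | k; exacts [ha k, hb k]))
      rcases p with ⟨k | k, l⟩
      exacts [hes a ⟨k, l⟩, hes b ⟨k, l⟩]
  have hrep : ∀ j (a : ∀ i, Fin (S i).arity → N j) x, (∀ i, (S i).Rep (a i) (x i)) → D j x →
      ∃ z : Z.Pts (N j), Z.Rep (fun k => a (e.symm k).1 (e.symm k).2) z := by
    intro j a x ha hx
    exact EqSet.exists_rep_of_dom ((hdom _ _).2
      ⟨fun i => (realize_congr _ fun l => hes a ⟨i, l⟩).2 (ha i).dom,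
        (realize_congr _ fun p => hes a p).2 ((hδ j a x ha).2 hx)⟩)
  -- points with given representatives are equal if the tuples are equivalent
  have hEq : ∀ j (a b : ∀ i, Fin (S i).arity → N j) x y, (∀ i, (S i).Rep (a i) (x i)) →
      (∀ i, (S i).Rep (b i) (y i)) → D j x → D j y → ∀ z z' : Z.Pts (N j),
      Z.Rep (fun k => a (e.symm k).1 (e.symm k).2) z →
      Z.Rep (fun k => b (e.symm k).1 (e.symm k).2) z' → (z = z' ↔ E j x y) := by
    intro j a b x y ha hb hx hy z z' hz hz'
    rw [hz.eq_iff hz']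
    constructor
    · intro h
      have := (h (fun k => b (e.symm k).1 (e.symm k).2)).2
        ((hfam' j b b y y hb hb).2 ⟨hy, (hequiv j).refl ⟨y, hy⟩⟩)
      exact ((hfam' j a b x y ha hb).1 this).2
    · intro h c
      have hc : fam.Realize (Sum.elim (fun k => a (e.symm k).1 (e.symm k).2) c) ∨
          fam.Realize (Sum.elim (fun k => b (e.symm k).1 (e.symm k).2) c) →
          ∃ (c' : ∀ i, Fin (S i).arity → N j) (w : ∀ i, (S i).Pts (N j)),
          (∀ i, (S i).Rep (c' i) (w i)) ∧ c = fun k => c' (e.symm k).1 (e.symm k).2 := by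
        intro hc
        have : dom.Realize c := by
          rcases hc with hc | hc <;> exact ((hfam _ _).1 hc).1
        choose w hw using fun i => EqSet.exists_rep_of_dom (((hdom _ _).1 this).1 i)
        exact ⟨fun i l => c (e ⟨i, l⟩), w, hw, by simp⟩
      constructor
      · intro h1
        obtain ⟨c', w, hw, rfl⟩ := hc (Or.inl h1)
        have h2 := (hfam' j a c' x w ha hw).1 h1
        refine (hfam' j b c' y w hb hw).2 ⟨h2.1, ?_⟩
        exact (hequiv j).trans (x := ⟨y, hy⟩) (y := ⟨x, hx⟩) (z := ⟨w, h2.1⟩)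
          ((hequiv j).symm (x := ⟨x, hx⟩) (y := ⟨y, hy⟩) h) h2.2
      · intro h1
        obtain ⟨c', w, hw, rfl⟩ := hc (Or.inr h1)
        have h2 := (hfam' j b c' y w hb hw).1 h1
        refine (hfam' j a c' x w ha hw).2 ⟨h2.1, ?_⟩
        exact (hequiv j).trans (x := ⟨x, hx⟩) (y := ⟨y, hy⟩) (z := ⟨w, h2.1⟩) h h2.2
  choose rp hrp using fun j (x : ∀ i, (S i).Pts (N j)) => EqSet.exists_reps x
  choose mk hmk using fun j (x : {x // D j x}) => hrep j (rp j x.1) x.1 (hrp j x.1) x.2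
  refine ⟨Z, mk, fun j z => ?_, fun j x y => ?_, ?_⟩
  · obtain ⟨c, hc⟩ := EqSet.exists_rep z
    have hd := (hdom _ _).1 hc.dom
    choose w hw using fun i => EqSet.exists_rep_of_dom (hd.1 i)
    have hw' : D j w := (hδ j (fun i l => c (e ⟨i, l⟩)) w hw).1 hd.2
    refine ⟨⟨w, hw'⟩, (hEq j (rp j w) (fun i l => c (e ⟨i, l⟩)) w w (hrp j w) hw hw' hw' _ _
      (hmk j ⟨w, hw'⟩) ?_).2 ((hequiv j).refl ⟨w, hw'⟩)⟩
    simpa using hc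
  · exact hEq j _ _ _ _ (hrp j x.1) (hrp j y.1) x.2 y.2 _ _ (hmk j x) (hmk j y)
  · have h1 : RawDef (L := L) N
        (fun j (v : (Σ i, Fin (Sum.elim S (fun _ : Unit => Z) i).arity) → N j) =>
        δ.Realize (fun p => v ⟨.inl p.1, p.2⟩) ∧ fam.Realize (fun k => match k with
          | .inl k => v ⟨.inr (), k⟩
          | .inr k => v ⟨.inl (e.symm k).1, (e.symm k).2⟩)) := by
      refine ((RawDef.formula δ).comap _).and (((RawDef.formula fam).comap
        (fun k => match k with
          | .inl k => ⟨.inr (), k⟩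
          | .inr k => ⟨.inl (e.symm k).1, (e.symm k).2⟩)).congr fun j v => ?_)
      refine iff_of_eq (congrArg _ (funext fun p => ?_))
      rcases p with k | k <;> rfl
    refine DefOn.of_rawDef h1 fun j a x hx => ?_
    have hxl := fun i => hx (.inl i)
    -- the type of `x (.inr ())` is `Z.Pts (N j)` only up to reduction, which obstructs rewriting
    obtain ⟨c, hac⟩ : ∃ c : Fin n → N j, c = a (.inr ()) := ⟨_, rfl⟩
    obtain ⟨z, hxz⟩ : ∃ z : Z.Pts (N j), z = x (.inr ()) := ⟨_, rfl⟩
    have hxr : Z.Rep c z := by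
      rw [hac, hxz]
      exact hx (.inr ())
    have hd := (hdom _ _).1 hxr.dom
    choose w hw using fun i => EqSet.exists_rep_of_dom (hd.1 i)
    have hw' : D j w := (hδ j (fun i l => c (e ⟨i, l⟩)) w hw).1 hd.2
    have hr : c = fun k => (fun i l => c (e ⟨i, l⟩) :
        ∀ i, Fin (S i).arity → N j) (e.symm k).1 (e.symm k).2 := by
      funext k
      exact congrArg c (e.apply_symm_apply k).symm
    have h3 := hfam' j (fun i l => c (e ⟨i, l⟩)) (fun i => a (.inl i)) w
      (fun i => x (.inl i)) hw hxl
    rw [← hr] at h3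
    have h2 : ∀ h : D j (fun i => x (.inl i)), mk j ⟨_, h⟩ = z ↔
        E j w (fun i => x (.inl i)) := by
      intro h
      refine (hEq j _ (fun i l => c (e ⟨i, l⟩)) _ w (hrp j _) hw h hw' _ _ (hmk j ⟨_, h⟩)
        (hr ▸ hxr)).trans ?_
      exact ⟨fun h' => (hequiv j).symm (x := ⟨_, h⟩) (y := ⟨w, hw'⟩) h',
        fun h' => (hequiv j).symm (y := ⟨_, h⟩) (x := ⟨w, hw'⟩) h'⟩
    have h4 : fam.Realize (fun k => match k with
          | .inl k => a (.inr ()) k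
          | .inr k => a (.inl (e.symm k).1) (e.symm k).2) ↔
        fam.Realize (Sum.elim c fun k => a (.inl (e.symm k).1) (e.symm k).2) := by
      refine realize_congr _ fun p => ?_
      rcases p with k | k
      exacts [(congrFun hac k).symm, rfl]
    refine (and_congr (hδ j (fun i => a (.inl i)) (fun i => x (.inl i)) hxl) (h4.trans h3)).trans ?_
    constructor
    · rintro ⟨h, -, h'⟩
      exact ⟨h, ((h2 h).2 h').trans hxz⟩
    · rintro ⟨h, h'⟩
      exact ⟨h, h, (h2 h).1 (h'.trans hxz.symm)⟩

/-- Substitution in the graph of a quotient map. -/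
theorem DefOn.graph {ι κ : Type*} {S : ι → EqSet L} {S' : κ → EqSet L} {Z : EqSet L}
    {D : ∀ j, (∀ i, (S i).Pts (N j)) → Prop} {mk : ∀ j, {x // D j x} → Z.Pts (N j)}
    (h : DefOn N (Sum.elim S (fun _ : Unit => Z))
      (fun j x => ∃ h : D j (fun i => x (.inl i)), mk j ⟨_, h⟩ = x (.inr ())))
    {t : ∀ i j, (∀ k, (S' k).Pts (N j)) → (S i).Pts (N j)}
    {r : ∀ j, (∀ k, (S' k).Pts (N j)) → Z.Pts (N j)}
    (ht : ∀ i, DVar N S' (t i)) (hr : DVar N S' r) :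
    DefOn N S' (fun j x => ∃ h : D j (fun i => t i j x), mk j ⟨_, h⟩ = r j x) :=
  h.subst (t := fun k => match k with
    | .inl i => t i
    | .inr _ => r) fun k => by
      rcases k with k | k
      exacts [ht k, hr]

end DefOn

/-! ### The internality group -/

/-- The underlying sets of the models of `T`, as a family of structures. -/
abbrev carriers (T : L.Theory) (M : Model T) : Type (max u v) := M

section IntGroup

variable {T : L.Theory} {Q C X Y : EqSet L} {f : Rel₃ Q X Y}

namespace IsInternal

/-- The value of the map `f` at `(q, x)`. -/
noncomputable def val (h : IsInternal T Q C X Y f) {M : Model T} (q : Q.Pts M) (x : X.Pts M) :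
    Y.Pts M := (h.map M q x).choose

variable (h : IsInternal T Q C X Y f) {M : Model T}

include h in
theorem holds_iff {q : Q.Pts M} {x : X.Pts M} {y : Y.Pts M} : f.Holds q x y ↔ h.val q x = y :=
  ⟨fun hy => ((h.map M q x).choose_spec.2 y hy).symm,
    fun hy => hy ▸ (h.map M q x).choose_spec.1⟩

theorem val_injective {q q' : Q.Pts M} {x : X.Pts M} (e : h.val q x = h.val q' x) : q = q' :=
  h.injective M x q q' _ (h.holds_iff.2 rfl) (h.holds_iff.2 e.symm)

theorem val_ext {x x' : X.Pts M} (e : ∀ q : Q.Pts M, h.val q x = h.val q x') : x = x' :=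
  h.distinct M x x' fun q y => by rw [h.holds_iff, h.holds_iff, e q]

theorem mem_intGroup {τ : Equiv.Perm (Q.Pts M) × Equiv.Perm (X.Pts M)} :
    τ ∈ intGroup f M ↔ ∀ q x, h.val (τ.1 q) (τ.2 x) = h.val q x := by
  constructor
  · intro hτ q x
    exact h.holds_iff.1 ((hτ q x _).2 (h.holds_iff.2 rfl))
  · intro hτ q x y
    rw [h.holds_iff, h.holds_iff, hτ]

/-- An element of the internality group is determined on `Q` by its effect on a single point of `X`. -/
theorem fst_eq_iff {τ : Equiv.Perm (Q.Pts M) × Equiv.Perm (X.Pts M)} (hτ : τ ∈ intGroup f M)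
    {x₀ x₁ : X.Pts M} (e : τ.2 x₀ = x₁) {q q' : Q.Pts M} :
    τ.1 q = q' ↔ h.val q x₀ = h.val q' x₁ := by
  rw [← h.mem_intGroup.1 hτ q x₀, e]
  exact ⟨fun e => e ▸ rfl, fun e => h.val_injective e⟩

/-- The permutation of `X` in an element of the internality group is determined by that of `Q`. -/
theorem snd_eq_iff {τ : Equiv.Perm (Q.Pts M) × Equiv.Perm (X.Pts M)} (hτ : τ ∈ intGroup f M)
    {x x' : X.Pts M} : τ.2 x = x' ↔ ∀ q q', τ.1 q = q' → h.val q x = h.val q' x' := by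
  constructor
  · rintro rfl q _ rfl
    exact (h.mem_intGroup.1 hτ q x).symm
  · intro e
    refine h.val_ext fun q => ?_
    obtain ⟨q, rfl⟩ := τ.1.surjective q
    rw [h.mem_intGroup.1 hτ, e q _ rfl]

include h in
/-- An element of the internality group is determined by the permutation of `Q`. -/
theorem intGroup_ext {τ σ : Equiv.Perm (Q.Pts M) × Equiv.Perm (X.Pts M)} (hτ : τ ∈ intGroup f M)
    (hσ : σ ∈ intGroup f M) (e : τ.1 = σ.1) : τ = σ := by
  refine Prod.ext e (Equiv.ext fun x => ?_)
  rw [h.snd_eq_iff hτ, e]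
  exact (h.snd_eq_iff hσ).1 rfl

section Def

variable {ι : Type*} {S : ι → EqSet L}

theorem defOn_val {t : ∀ M : Model T, (∀ i, (S i).Pts M) → Q.Pts M}
    {s : ∀ M : Model T, (∀ i, (S i).Pts M) → X.Pts M}
    {r : ∀ M : Model T, (∀ i, (S i).Pts M) → Y.Pts M}
    (ht : DVar (carriers T) S t) (hs : DVar (carriers T) S s) (hr : DVar (carriers T) S r) :
    DefOn (carriers T) S (fun M x => h.val (t M x) (s M x) = r M x) :=
  (DefOn.rel₃ f ht hs hr).congr fun _ _ => h.holds_iff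

theorem defOn_val_eq {t t' : ∀ M : Model T, (∀ i, (S i).Pts M) → Q.Pts M}
    {s s' : ∀ M : Model T, (∀ i, (S i).Pts M) → X.Pts M}
    (ht : DVar (carriers T) S t) (hs : DVar (carriers T) S s)
    (ht' : DVar (carriers T) S t') (hs' : DVar (carriers T) S s') :
    DefOn (carriers T) S (fun M x => h.val (t M x) (s M x) = h.val (t' M x) (s' M x)) := by
  have key : DefOn (carriers T) S (fun M x => ∃ y : Y.Pts M,
      f.Holds (t M x) (s M x) y ∧ f.Holds (t' M x) (s' M x) y) := by
    obtain ⟨a, ha⟩ := ht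
    obtain ⟨b, hb⟩ := hs
    obtain ⟨a', ha'⟩ := ht'
    obtain ⟨b', hb'⟩ := hs'
    refine DefOn.ex (DefOn.and (DefOn.rel₃ f ?_ ?_ (.var _)) (DefOn.rel₃ f ?_ ?_ (.var _)))
    · exact ⟨fun k => ⟨.inl (a k).1, (a k).2⟩, fun j c x hx => ha j _ _ fun i => hx (.inl i)⟩
    · exact ⟨fun k => ⟨.inl (b k).1, (b k).2⟩, fun j c x hx => hb j _ _ fun i => hx (.inl i)⟩
    · exact ⟨fun k => ⟨.inl (a' k).1, (a' k).2⟩, fun j c x hx => ha' j _ _ fun i => hx (.inl i)⟩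
    · exact ⟨fun k => ⟨.inl (b' k).1, (b' k).2⟩, fun j c x hx => hb' j _ _ fun i => hx (.inl i)⟩
  refine key.congr fun M x => ?_
  simp only [h.holds_iff]
  exact ⟨fun ⟨y, h1, h2⟩ => h1.trans h2.symm, fun h => ⟨_, h, rfl⟩⟩

end Def

/-- First-order description of the pairs of points of `X` that correspond under some element of the
internality group. -/
theorem exists_mem_intGroup_iff (x₀ x₁ : X.Pts M) :
    (∃ τ ∈ intGroup f M, τ.2 x₀ = x₁) ↔
      (∀ q, ∃ q', h.val q x₀ = h.val q' x₁) ∧ (∀ q', ∃ q, h.val q x₀ = h.val q' x₁) ∧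
      (∀ x, ∃ x', ∀ q q', h.val q x₀ = h.val q' x₁ → h.val q x = h.val q' x') ∧
      (∀ x', ∃ x, ∀ q q', h.val q x₀ = h.val q' x₁ → h.val q x = h.val q' x') := by
  constructor
  · rintro ⟨τ, hτ, e⟩
    refine ⟨fun q => ⟨τ.1 q, (h.fst_eq_iff hτ e).1 rfl⟩, fun q => ⟨τ.1.symm q, ?_⟩,
      fun x => ⟨τ.2 x, ?_⟩, fun x => ⟨τ.2.symm x, ?_⟩⟩
    · exact (h.fst_eq_iff hτ e).1 (by simp)
    · intro q q' e'
      exact (h.snd_eq_iff hτ).1 rfl _ _ ((h.fst_eq_iff hτ e).2 e')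
    · intro q q' e'
      exact (h.snd_eq_iff hτ).1 (by simp) _ _ ((h.fst_eq_iff hτ e).2 e')
  · rintro ⟨h1, h2, h3, h4⟩
    choose a ha using h1
    choose b hb using h3
    have ha' : Function.Bijective a := by
      refine ⟨fun q q' e => h.val_injective (x := x₀) ((ha q).trans ((ha q').trans ?_).symm), ?_⟩
      · rw [e]
      · intro q'
        obtain ⟨q, hq⟩ := h2 q'
        exact ⟨q, h.val_injective ((ha q).symm.trans hq)⟩
    have huniq : ∀ x x' : X.Pts M, (∀ q q', h.val q x₀ = h.val q' x₁ → h.val q x = h.val q' x') →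
        b x = x' := by
      intro x x' hx
      refine h.val_ext fun q' => ?_
      obtain ⟨q, hq⟩ := h2 q'
      rw [← hb x q q' hq, hx q q' hq]
    have hb' : Function.Bijective b := by
      refine ⟨fun x x' e => h.val_ext fun q => ?_, fun x' => ?_⟩
      · rw [hb x q _ (ha q), hb x' q _ (ha q), e]
      · obtain ⟨x, hx⟩ := h4 x'
        exact ⟨x, huniq x x' hx⟩
    refine ⟨(Equiv.ofBijective a ha', Equiv.ofBijective b hb'), h.mem_intGroup.2 fun q x => ?_, ?_⟩
    · exact (hb x q _ (ha q)).symm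
    · exact huniq x₀ x₁ fun q q' e => e

include h in
/-- The internality group is a definable group, acting definably: an element is a pair of points of
`X` corresponding under it, up to the equality of the permutations of `Q`. -/
theorem exists_defGroup : ∃ (G : DefGroup T) (α : Rel₃ G.carrier Q Q) (β : Rel₃ G.carrier X X)
    (ev : ∀ M : Model T, G.carrier.Pts M ≃ intGroup f M),
    (∀ (M : Model T) (a b c : G.carrier.Pts M), G.mul.Holds a b c ↔ ev M a * ev M b = ev M c) ∧
    (∀ (M : Model T) (g : G.carrier.Pts M) q q', α.Holds g q q' ↔ (ev M g).1.1 q = q') ∧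
    ∀ (M : Model T) (g : G.carrier.Pts M) x x', β.Holds g x x' ↔ (ev M g).1.2 x = x' := by
  let S : Bool → EqSet L := fun _ => X
  -- `D` consists of the corresponding pairs, `E` says that two pairs induce the same permutation of `Q`
  let D : ∀ M : Model T, (∀ i, (S i).Pts M) → Prop := fun M x =>
    ∃ τ ∈ intGroup f M, τ.2 (x false) = x true
  let E : ∀ M : Model T, (∀ i, (S i).Pts M) → (∀ i, (S i).Pts M) → Prop := fun M x y =>
    ∀ q q', h.val q (x false) = h.val q' (x true) ↔ h.val q (y false) = h.val q' (y true)
  have hD : DefOn (carriers T) S D := by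
    refine DefOn.congr ?_ fun M x => (h.exists_mem_intGroup_iff (x false) (x true)).symm
    refine DefOn.and ?_ (DefOn.and ?_ (DefOn.and ?_ ?_))
    · exact DefOn.all (DefOn.ex (h.defOn_val_eq (.var _) (.var _) (.var _)
        (.var _)))
    · exact DefOn.all (DefOn.ex (h.defOn_val_eq (.var _) (.var _) (.var _)
        (.var _)))
    · exact DefOn.all (DefOn.ex (DefOn.all (DefOn.all (DefOn.imp
        (h.defOn_val_eq (.var _) (.var _) (.var _)
          (.var _)) (h.defOn_val_eq (.var _) (.var _) (.var _)
            (.var _))))))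
    · exact DefOn.all (DefOn.ex (DefOn.all (DefOn.all (DefOn.imp
        (h.defOn_val_eq (.var _) (.var _) (.var _)
          (.var _)) (h.defOn_val_eq (.var _) (.var _) (.var _)
            (.var _))))))
  have hE : DefOn (carriers T) (Sum.elim S S)
      (fun M x => E M (fun i => x (.inl i)) (fun i => x (.inr i))) :=
    DefOn.all (DefOn.all (DefOn.iff
      (h.defOn_val_eq (.var _) (.var _) (.var _) (.var _))
      (h.defOn_val_eq (.var _) (.var _) (.var _)
        (.var _))))
  obtain ⟨Z, mk, hmk, hmk', hmkdef⟩ := exists_quotient hD hE fun M =>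
    ⟨fun _ _ _ => Iff.rfl, fun e q q' => (e q q').symm, fun e e' q q' => (e q q').trans (e' q q')⟩
  choose τ hτ hτ' using fun (M : Model T) (x : {x // D M x}) => x.2
  have hτE : ∀ (M : Model T) (x y : {x // D M x}), τ M x = τ M y ↔ E M x.1 y.1 := by
    intro M x y
    constructor
    · intro e q q'
      rw [← h.fst_eq_iff (hτ M x) (hτ' M x), ← h.fst_eq_iff (hτ M y) (hτ' M y), e]
    · intro e
      refine h.intGroup_ext (hτ M x) (hτ M y) (Equiv.ext fun q => ?_)
      rw [h.fst_eq_iff (hτ M x) (hτ' M x)]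
      exact (e _ _).2 ((h.fst_eq_iff (hτ M y) (hτ' M y)).1 rfl)
  -- the element of the internality group given by a point of the quotient
  choose x hx using fun (M : Model T) (z : Z.Pts M) => hmk M z
  have hbij : ∀ M : Model T, Function.Bijective
      (fun z : Z.Pts M => (⟨τ M (x M z), hτ M (x M z)⟩ : intGroup f M)) := by
    intro M
    constructor
    · intro z z' e
      rw [← hx M z, ← hx M z', hmk', ← hτE]
      exact congrArg Subtype.val e
    · rintro ⟨σ, hσ⟩
      obtain ⟨x₀⟩ := h.nonempty M
      let y : {x // D M x} := ⟨fun b => if b then σ.2 x₀ else x₀, σ, hσ, by simp⟩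
      refine ⟨mk M y, Subtype.ext ?_⟩
      have e1 : τ M (x M (mk M y)) = τ M y := by
        rw [hτE, ← hmk', hx]
      refine e1.trans (h.intGroup_ext (hτ M y) hσ (Equiv.ext fun q => ?_))
      rw [h.fst_eq_iff (hτ M y) (hτ' M y), ← h.fst_eq_iff hσ (x₀ := y.1 false) (x₁ := y.1 true)]
      simp [y]
  let ev : ∀ M : Model T, Z.Pts M ≃ intGroup f M := fun M => Equiv.ofBijective _ (hbij M)
  have hev : ∀ (M : Model T) (y : {x // D M x}), (ev M (mk M y)).1 = τ M y := by
    intro M y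
    change τ M (x M (mk M y)) = τ M y
    rw [hτE, ← hmk', hx]
  have hα : DefOn (carriers T) (triple Z Q Q) (fun M x => (ev M (x (.inl ()))).1.1
      (x (.inr (.inl ()))) = x (.inr (.inr ()))) := by
    have h1 : DefOn (carriers T) (triple Z Q Q) (fun M x => ∃ y : ∀ i, (S i).Pts M,
        (∃ hy : D M y, mk M ⟨y, hy⟩ = x (.inl ())) ∧
        h.val (x (.inr (.inl ()))) (y false) = h.val (x (.inr (.inr ()))) (y true)) := by
      refine DefOn.exFam (DefOn.and ?_ (h.defOn_val_eq (.var _)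
        (.var _) (.var _) (.var _)))
      exact DefOn.graph (S' := Sum.elim (triple Z Q Q) S) hmkdef (t := fun i _ x => x (Sum.inr i))
        (r := fun _ x => x (Sum.inl (Sum.inl ()))) (fun _ => .var _) (.var _)
    have h2 : ∀ (M : Model T) (z : Z.Pts M) (q q' : Q.Pts M), (∃ y : ∀ i, (S i).Pts M,
        (∃ hy : D M y, mk M ⟨y, hy⟩ = z) ∧ h.val q (y false) = h.val q' (y true)) ↔
        (ev M z).1.1 q = q' := by
      intro M z q q'
      constructor
      · rintro ⟨y, ⟨hy, e⟩, e'⟩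
        rw [← e, hev, h.fst_eq_iff (hτ M _) (hτ' M _)]
        exact e'
      · obtain ⟨y, rfl⟩ := hmk M z
        rw [hev, h.fst_eq_iff (hτ M _) (hτ' M _)]
        exact fun e' => ⟨y.1, ⟨y.2, rfl⟩, e'⟩
    exact h1.congr fun M x => h2 M _ _ _
  obtain ⟨α, hα⟩ := DefOn.exists_rel₃ (N := carriers T)
    (R := fun M g q q' => (ev M g).1.1 q = q') hα
  have hβ : DefOn (carriers T) (triple Z X X) (fun M x => (ev M (x (.inl ()))).1.2
      (x (.inr (.inl ()))) = x (.inr (.inr ()))) := by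
    have h1 : DefOn (carriers T) (triple Z X X) (fun M x => ∀ q q' : Q.Pts M,
        α.Holds (x (.inl ()) : Z.Pts M) q q' →
          h.val q (x (.inr (.inl ()))) = h.val q' (x (.inr (.inr ())))) :=
      DefOn.all (DefOn.all (DefOn.imp (DefOn.rel₃ α (.var _) (.var _) (.var _))
        (h.defOn_val_eq (.var _) (.var _) (.var _)
          (.var _))))
    have h2 : ∀ (M : Model T) (z : Z.Pts M) (x x' : X.Pts M), (∀ q q' : Q.Pts M,
        α.Holds z q q' → h.val q x = h.val q' x') ↔ (ev M z).1.2 x = x' := by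
      intro M z x x'
      simp only [hα]
      exact (h.snd_eq_iff (ev M _).2).symm
    exact h1.congr fun M x => h2 M _ _ _
  obtain ⟨β, hβ⟩ := DefOn.exists_rel₃ (N := carriers T)
    (R := fun M g q q' => (ev M g).1.2 q = q') hβ
  have hμ : DefOn (carriers T) (triple Z Z Z) (fun M x => ev M (x (.inl ())) *
      ev M (x (.inr (.inl ()))) = ev M (x (.inr (.inr ())))) := by
    have h1 : DefOn (carriers T) (triple Z Z Z) (fun M x => ∀ q q' q'' : Q.Pts M,
        α.Holds (x (.inr (.inl ())) : Z.Pts M) q q' → α.Holds (x (.inl ()) : Z.Pts M) q' q'' →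
        α.Holds (x (.inr (.inr ())) : Z.Pts M) q q'') :=
      DefOn.all (DefOn.all (DefOn.all (DefOn.imp
        (DefOn.rel₃ α (.var _) (.var _) (.var _))
        (DefOn.imp (DefOn.rel₃ α (.var _) (.var _) (.var _))
        (DefOn.rel₃ α (.var _) (.var _) (.var _))))))
    have h2 : ∀ (M : Model T) (a b c : Z.Pts M), (∀ q q' q'' : Q.Pts M,
        α.Holds b q q' → α.Holds a q' q'' → α.Holds c q q'') ↔ ev M a * ev M b = ev M c := by
      intro M a b c
      simp only [hα]
      constructor
      · intro e
        refine Subtype.ext (h.intGroup_ext (Subtype.property _) (Subtype.property _)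
          (Equiv.ext fun q => ?_))
        exact (e q _ _ rfl rfl).symm
      · rintro e q _ _ rfl rfl
        rw [← e]
        rfl
    exact h1.congr fun M x => h2 M _ _ _
  obtain ⟨μ, hμ⟩ := DefOn.exists_rel₃ (N := carriers T)
    (R := fun M a b c => ev M a * ev M b = ev M c) hμ
  refine ⟨⟨Z, μ, fun M => ⟨(ev M).group, fun a b c => ?_⟩⟩, α, β, ev, hμ, hα, hβ⟩
  rw [hμ]
  exact (Equiv.symm_apply_eq (ev M)).symm

end IsInternal

end IntGroup

/-! ### Definable subgroups of the internality group -/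

section Stabilizer

variable {T : L.Theory}

/-- The stabilizer of a definable relation under a uniformly definable family of permutations is
definable. -/
theorem defOn_stabilizer {κ : Type*} {S : κ → EqSet L} {Z : EqSet L} (R : DefRel S)
    (act : ∀ M : Model T, Z.Pts M → ∀ i, Equiv.Perm ((S i).Pts M))
    (hact : ∀ i, DefOn (carriers T) (triple Z (S i) (S i)) (fun M x =>
      act M (x (.inl ())) i (x (.inr (.inl ()))) = x (.inr (.inr ())))) :
    DefOn (carriers T) (fun _ : Unit => Z) (fun M z => ∀ x : ∀ i, (S (R.slot i)).Pts M,
      R.Holds M (fun i => act M (z ()) (R.slot i) (x i)) ↔ R.Holds M x) := by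
  have h1 : DefOn (carriers T) (fun _ : Unit => Z) (fun M z => ∀ x y : ∀ i, (S (R.slot i)).Pts M,
      (∀ i, act M (z ()) (R.slot i) (x i) = y i) → (R.Holds M y ↔ R.Holds M x)) := by
    refine DefOn.allFam (DefOn.allFam (DefOn.imp (DefOn.finiteAll fun i => ?_)
      (DefOn.iff (DefOn.defRel R fun i => .var _) (DefOn.defRel R fun i => .var _))))
    exact (hact (R.slot i)).subst (S := Sum.elim (Sum.elim (fun _ : Unit => Z)
        fun i => S (R.slot i)) fun i => S (R.slot i)) (t := fun k => match k with
        | .inl _ => fun _ x => x (.inl (.inl ()))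
        | .inr (.inl _) => fun _ x => x (.inl (.inr i))
        | .inr (.inr _) => fun _ x => x (.inr i)) fun k => by
          rcases k with k | k | k
          exacts [.var _, .var _, .var _]
  refine h1.congr fun M z => forall_congr' fun x => ⟨fun h => h _ fun i => rfl, fun h y hy => ?_⟩
  rw [← funext hy]
  exact h

variable {Q C X Y : EqSet L} {f : Rel₃ Q X Y} {G : DefGroup T}
  {ev : ∀ M : Model T, G.carrier.Pts M ≃ intGroup f M}

theorem isSubgroup_of_mem (hμ : ∀ (M : Model T) (a b c : G.carrier.Pts M),
      G.mul.Holds a b c ↔ ev M a * ev M b = ev M c) {σ : Rel₁ G.carrier} {M : Model T}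
    (H : Subgroup (Equiv.Perm (Q.Pts M) × Equiv.Perm (X.Pts M)))
    (hσ : ∀ g : G.carrier.Pts M, σ.Holds g ↔ (ev M g).1 ∈ H) :
    (∃ a : G.carrier.Pts M, σ.Holds a) ∧
    (∀ a b c : G.carrier.Pts M, σ.Holds a → σ.Holds b → G.mul.Holds a b c → σ.Holds c) ∧
    (∀ a b e : G.carrier.Pts M, σ.Holds a → G.mul.Holds a b e → G.mul.Holds e e e →
      σ.Holds b) := by
  simp only [hσ, hμ]
  refine ⟨⟨(ev M).symm 1, by simp⟩, fun a b c ha hb e => ?_,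
    fun a b e ha he he' => ?_⟩
  · rw [← e]
    exact H.mul_mem ha hb
  · have h1 : ev M e = 1 := by simpa using he'
    rw [h1] at he
    rw [eq_inv_of_mul_eq_one_right he]
    exact H.inv_mem ha

theorem isAction_of_induces {Z : EqSet L} {α : Rel₃ G.carrier Z Z}
    {P : ∀ M : Model T, G.carrier.Pts M → Prop}
    (hμ : ∀ (M : Model T) (a b c : G.carrier.Pts M),
      G.mul.Holds a b c ↔ ev M a * ev M b = ev M c)
    (act : ∀ M : Model T, intGroup f M →* Equiv.Perm (Z.Pts M))
    (hα : ∀ (M : Model T) (g : G.carrier.Pts M), P M g → Induces α g (act M (ev M g))) :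
    G.IsAction P Z α := by
  refine fun M => ⟨fun g hg q => ⟨act M (ev M g) q, (hα M g hg _ _).2 rfl,
    fun q' h => ((hα M g hg _ _).1 h).symm⟩, fun e he h q => ?_, fun g h k hg hh hk e q q' q'' => ?_⟩
  · have h1 : ev M e = 1 := by simpa using (hμ M _ _ _).1 h
    rw [hα M e he, h1, map_one]
    rfl
  · rw [hα M g hg, hα M h hh, hα M k hk]
    rintro rfl rfl
    rw [← (hμ M _ _ _).1 e, map_mul]
    rfl

theorem actsAs_of_mem {α : Rel₃ G.carrier Q Q} {β : Rel₃ G.carrier X X} {M : Model T}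
    (hα : ∀ g : G.carrier.Pts M, Induces α g (ev M g).1.1)
    (hβ : ∀ g : G.carrier.Pts M, Induces β g (ev M g).1.2) {P : G.carrier.Pts M → Prop}
    {H : Set (Equiv.Perm (Q.Pts M) × Equiv.Perm (X.Pts M))}
    (hP : ∀ g, P g ↔ (ev M g).1 ∈ H) (hH : H ⊆ intGroup f M) : ActsAs P α β H := by
  refine ⟨fun g hg => ⟨_, (hP g).1 hg, hα g, hβ g⟩, fun p hp => ?_⟩
  obtain ⟨g, hg⟩ := (ev M).surjective ⟨p, hH hp⟩
  refine ⟨g, ⟨(hP g).2 ?_, ?_, ?_⟩, fun g' hg' => ?_⟩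
  · rw [hg]
    exact hp
  · have := hα g
    rwa [hg] at this
  · have := hβ g
    rwa [hg] at this
  · refine (ev M).injective (Subtype.ext ?_)
    rw [hg]
    refine Prod.ext (Equiv.ext fun q => ?_) (Equiv.ext fun x => ?_)
    · exact (hα g' _ _).1 ((hg'.2.1 _ _).2 rfl)
    · exact (hβ g' _ _).1 ((hg'.2.2 _ _).2 rfl)

/-- The points of an `ω`-group act faithfully on `Q`, provided that the permutations in question
extend to the internality group. -/
theorem actsAsOn_of_mem (h : IsInternal T Q C X Y f) {α : Rel₃ G.carrier Q Q} {M : Model T}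
    (hα : ∀ g : G.carrier.Pts M, Induces α g (ev M g).1.1) {P : G.carrier.Pts M → Prop}
    {H : Set (Equiv.Perm (Q.Pts M))} (hP : ∀ g, P g ↔ (ev M g).1.1 ∈ H)
    (hH : ∀ p ∈ H, ∃ τ, (p, τ) ∈ intGroup f M) : ActsAsOn P α H := by
  refine ⟨fun g hg => ⟨_, (hP g).1 hg, hα g⟩, fun p hp => ?_⟩
  obtain ⟨τ, hτ⟩ := hH p hp
  obtain ⟨g, hg⟩ := (ev M).surjective ⟨_, hτ⟩
  refine ⟨g, ⟨(hP g).2 ?_, ?_⟩, fun g' hg' => ?_⟩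
  · rw [hg]
    exact hp
  · have := hα g
    rwa [hg] at this
  · refine (ev M).injective (Subtype.ext (h.intGroup_ext (Subtype.property _) (Subtype.property _)
      (Equiv.ext fun q => ?_)))
    rw [hg]
    exact (hα g' _ _).1 ((hg'.2 _ _).2 rfl)

end Stabilizer

section Aut

variable {T : L.Theory} {Q C X Y : EqSet L} {f : Rel₃ Q X Y}

/-- The automorphism groups of internality structures are the points of `ω`-groups. -/
theorem IsInternal.exists_omegaGroup_autGroup (h : IsInternal T Q C X Y f)
    (Δ : Set (DefRel (Slot.set Q X))) :
    ∃ (G : OmegaGroup T) (α : Rel₃ G.carrier Q Q) (β : Rel₃ G.carrier X X)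
      (γ : Set (DefRel (Slot.set Q X)) → Rel₁ G.carrier),
      G.IsAction (fun _ _ => True) Q α ∧ G.IsAction (fun _ _ => True) X β ∧
      (∀ M : Model T, ActsAs (M := M) G.Mem α β (autGroup f Δ M)) ∧
      G.subs = γ '' {Δ₀ | Δ₀.Finite ∧ Δ₀ ⊆ Δ} ∧
      ∀ Δ₀ : Set (DefRel (Slot.set Q X)), Δ₀.Finite → Δ₀ ⊆ Δ → ∀ M : Model T,
        ActsAs (M := M) (γ Δ₀).Holds α β (autGroup f Δ₀ M) := by
  obtain ⟨G, α, β, ev, hμ, hα, hβ⟩ := h.exists_defGroup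
  have hact : ∀ i : Slot L, DefOn (carriers T) (triple G.carrier (i.set Q X) (i.set Q X))
      (fun M x => Slot.act Q X M (ev M (x (.inl ()))).1 i (x (.inr (.inl ()))) =
        x (.inr (.inr ()))) := by
    rintro (_ | _ | Z)
    · exact (DefOn.rel₃ (S := triple G.carrier Q Q) α (.var _) (.var _) (.var _)).congr
        fun M x => hα M _ _ _
    · exact (DefOn.rel₃ (S := triple G.carrier X X) β (.var _) (.var _) (.var _)).congr
        fun M x => hβ M _ _ _
    · exact DefOn.eq (S := triple G.carrier Z Z) (.var _) (.var _)
  have hγ : ∀ Δ₀ : Set (DefRel (Slot.set Q X)), ∃ γ : Rel₁ G.carrier, Δ₀.Finite →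
      ∀ (M : Model T) g, γ.Holds g ↔ (ev M g).1 ∈ autGroup f Δ₀ M := by
    intro Δ₀
    by_cases hΔ : Δ₀.Finite
    · have := hΔ.to_subtype
      obtain ⟨γ, hγ⟩ := DefOn.exists_rel₁ (N := carriers T) (X := G.carrier)
        (R := fun M z => ∀ (R : Δ₀) (x : ∀ i, ((R.1.slot i).set Q X).Pts M),
          R.1.Holds M (fun i => Slot.act Q X M (ev M z).1 (R.1.slot i) (x i)) ↔ R.1.Holds M x)
        (DefOn.finiteAll fun R => defOn_stabilizer (S := Slot.set Q X) R.1
          (fun M z => Slot.act Q X M (ev M z).1) hact)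
      refine ⟨γ, fun _ M g => (hγ M g).trans ⟨fun hg => ⟨(ev M g).2, fun R hR => hg ⟨R, hR⟩⟩,
        fun hg R => hg.2 R.1 R.2⟩⟩
    · exact ⟨(⊥ : L.Formula _), fun h => absurd h hΔ⟩
  choose γ hγ using hγ
  have hind : ∀ (M : Model T) g, Induces α g (ev M g).1.1 := fun M g q q' => hα M g q q'
  have hind' : ∀ (M : Model T) g, Induces β g (ev M g).1.2 := fun M g q q' => hβ M g q q'
  refine ⟨⟨G, γ '' {Δ₀ | Δ₀.Finite ∧ Δ₀ ⊆ Δ}, ?_⟩, α, β, γ, ?_, ?_, fun M => ?_, rfl,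
    fun Δ₀ hΔ _ M => ?_⟩
  · rintro _ ⟨Δ₀, hΔ, rfl⟩ M
    exact isSubgroup_of_mem hμ (autGroup f Δ₀ M) (hγ Δ₀ hΔ.1 M)
  · exact isAction_of_induces hμ (fun M => (MonoidHom.fst _ _).comp (Subgroup.subtype _))
      fun M g _ => hind M g
  · exact isAction_of_induces hμ (fun M => (MonoidHom.snd _ _).comp (Subgroup.subtype _))
      fun M g _ => hind' M g
  · refine actsAs_of_mem (hind M) (hind' M) (fun g => ?_) inf_le_left
    constructor
    · intro hg
      refine ⟨(ev M g).2, fun R hR => ?_⟩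
      exact ((hγ {R} (Set.finite_singleton R) M g).1 (hg _ ⟨{R}, ⟨Set.finite_singleton R, by
        simpa using hR⟩, rfl⟩)).2 R rfl
    · rintro hg _ ⟨Δ₀, hΔ, rfl⟩
      exact (hγ Δ₀ hΔ.1 M g).2 ⟨hg.1, fun R hR => hg.2 R (hΔ.2 hR)⟩
  · exact actsAs_of_mem (hind M) (hind' M) (hγ Δ₀ hΔ M) inf_le_left

/-- The group of automorphisms of `Q` over `C` that extend to the internality group is the group of
points of an `ω`-group. -/
theorem IsInternal.exists_omegaGroup_autOver (h : IsInternal T Q C X Y f)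
    (Δ : Set (DefRel (QC.set Q C))) :
    ∃ (G : OmegaGroup T) (α : Rel₃ G.carrier Q Q)
      (ev : ∀ M : Model T, G.carrier.Pts M ≃ intGroup f M),
      (∀ (M : Model T) (a b c : G.carrier.Pts M), G.mul.Holds a b c ↔ ev M a * ev M b = ev M c) ∧
      (∀ (M : Model T) (g : G.carrier.Pts M), Induces α g (ev M g).1.1) ∧
      ∀ (M : Model T) (g : G.carrier.Pts M), G.Mem g ↔ (ev M g).1.1 ∈ autOver Δ M := by
  obtain ⟨G, α, β, ev, hμ, hα, hβ⟩ := h.exists_defGroup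
  have hact : ∀ i : QC, DefOn (carriers T) (triple G.carrier (i.set Q C) (i.set Q C))
      (fun M x => QC.act Q C M (ev M (x (.inl ()))).1.1 i (x (.inr (.inl ()))) =
        x (.inr (.inr ()))) := by
    rintro (_ | _)
    · exact (DefOn.rel₃ (S := triple G.carrier Q Q) α (.var _) (.var _) (.var _)).congr
        fun M x => hα M _ _ _
    · exact DefOn.eq (S := triple G.carrier C C) (.var _) (.var _)
  choose γ hγ using fun R : DefRel (QC.set Q C) => DefOn.exists_rel₁ (N := carriers T)
    (X := G.carrier) (R := fun M z => ∀ x : ∀ i, ((R.slot i).set Q C).Pts M,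
      R.Holds M (fun i => QC.act Q C M (ev M z).1.1 (R.slot i) (x i)) ↔ R.Holds M x)
    (defOn_stabilizer (S := QC.set Q C) R (fun M z => QC.act Q C M (ev M z).1.1) hact)
  refine ⟨⟨G, γ '' Δ, ?_⟩, α, ev, hμ, fun M g q q' => hα M g q q', fun M g => ?_⟩
  · rintro _ ⟨R, hR, rfl⟩ M
    refine isSubgroup_of_mem hμ ((autOver {R} M).comap (MonoidHom.fst _ _)) fun g => ?_
    rw [hγ]
    exact ⟨fun h R' hR' => by rw [Set.mem_singleton_iff.1 hR']; exact h, fun h => h R rfl⟩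
  · refine ⟨fun hg R hR => (hγ R M g).1 (hg _ ⟨R, hR, rfl⟩), ?_⟩
    rintro hg _ ⟨R, hR, rfl⟩
    exact (hγ R M g).2 (hg R hR)

/-- The group of automorphisms of `Q` over `C` is the group of points of an `ω`-group, as soon as there
is an internality datum for it.  The `ω`-group constructed from one datum acts definably on the set
`X'` of any other one, since `g` maps `x` to `x'` if and only if `f'(q, x) = f'(g q, x')` for all `q`. -/
theorem exists_omegaGroup_of_datum (Δ : Set (DefRel (QC.set Q C)))
    (h : IsDatumFor T Q C X Y f (fun M => (autOver Δ M : Set (Equiv.Perm (Q.Pts M))))) :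
    ∃ (G : OmegaGroup T) (α : Rel₃ G.carrier Q Q),
      G.IsAction (fun _ g => G.Mem g) Q α ∧
      (∀ M : Model T, ActsAsOn (M := M) G.Mem α (autOver Δ M)) ∧
      ∀ (X Y : EqSet L) (f : Rel₃ Q X Y),
        IsDatumFor T Q C X Y f (fun M => (autOver Δ M : Set (Equiv.Perm (Q.Pts M)))) →
        ∃ β : Rel₃ G.carrier X X, G.IsAction (fun _ g => G.Mem g) X β ∧
          ∀ M : Model T, ActsAs (M := M) G.Mem α β (autOverDatum f Δ M) := by
  obtain ⟨h, hext⟩ := h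
  obtain ⟨G, α, ev, hμ, hα, hG⟩ := h.exists_omegaGroup_autOver Δ
  refine ⟨G, α, ?_, fun M => actsAsOn_of_mem h (hα M) (hG M) (hext M), ?_⟩
  · exact isAction_of_induces hμ (fun M => (MonoidHom.fst _ _).comp (Subgroup.subtype _))
      fun M g _ => hα M g
  · intro X' Y' f' ⟨h', hext'⟩
    obtain ⟨β, hβ⟩ := DefOn.exists_rel₃ (N := carriers T) (X := G.carrier) (Y := X') (Z := X')
      (R := fun M g x x' => ∀ q q' : Q.Pts M, α.Holds g q q' → h'.val q x = h'.val q' x')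
      (DefOn.all (DefOn.all (DefOn.imp (DefOn.rel₃ α (.var _) (.var _) (.var _))
        (h'.defOn_val_eq (.var _) (.var _) (.var _) (.var _)))))
    -- the permutation of `X'` induced by a member of the group
    have hβ' : ∀ (M : Model T) (g : G.carrier.Pts M) τ, ((ev M g).1.1, τ) ∈ intGroup f' M →
        Induces β g τ := by
      intro M g τ hτ x x'
      rw [hβ, h'.snd_eq_iff hτ]
      exact forall_congr' fun q => forall_congr' fun q' => by rw [hα M g q q']
    have hext'' : ∀ (M : Model T) (g : G.carrier.Pts M), G.Mem g →
        ∃ τ, ((ev M g).1.1, τ) ∈ intGroup f' M := fun M g hg => hext' M _ ((hG M g).1 hg)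
    refine ⟨β, fun M => ⟨fun g hg x => ?_, fun e he hee x => ?_,
      fun a b c ha hb hc habc x x' x'' hx hx' => ?_⟩, fun M => ⟨fun g hg => ?_, fun p hp => ?_⟩⟩
    · obtain ⟨τ, hτ⟩ := hext'' M g hg
      exact ⟨τ x, (hβ' M g τ hτ _ _).2 rfl, fun x' hx' => ((hβ' M g τ hτ _ _).1 hx').symm⟩
    · have h1 : ev M e = 1 := by simpa using (hμ M _ _ _).1 hee
      rw [hβ' M e 1 (by rw [h1]; exact (intGroup f' M).one_mem)]
      rfl
    · rw [hβ] at hx hx' ⊢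
      intro q q' hq
      obtain ⟨r, hr⟩ : ∃ r, r = (ev M b).1.1 q := ⟨_, rfl⟩
      rw [hx q r ((hα M b _ _).2 hr.symm)]
      refine hx' r q' ((hα M a _ _).2 ?_)
      rw [← (hα M c _ _).1 hq, ← (hμ M _ _ _).1 habc, hr]
      rfl
    · obtain ⟨τ, hτ⟩ := hext'' M g hg
      exact ⟨((ev M g).1.1, τ), ⟨hτ, (hG M g).1 hg⟩, hα M g, hβ' M g τ hτ⟩
    · obtain ⟨g, ⟨hg, hg'⟩, hu⟩ := (actsAsOn_of_mem h (hα M) (hG M) (hext M)).2 p.1 hp.2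
      refine ⟨g, ⟨hg, hg', hβ' M g p.2 ?_⟩, fun g' hg' => hu g' ⟨hg'.1, hg'.2.1⟩⟩
      have : (ev M g).1.1 = p.1 := Equiv.ext fun q => (hα M g _ _).1 ((hg' _ _).2 rfl)
      rw [this]
      exact hp.1

end Aut

/-! ### Compactness -/

section Compactness

open FirstOrder.Language

/-- A set of formulas that is finitely satisfiable in models of `T` is satisfiable in a model. -/
theorem exists_model_realize {T : L.Theory} {α : Type (max u v)} (Γ : Set (L.Formula α))
    (h : ∀ Γ₀ : Set (L.Formula α), Γ₀ ⊆ Γ → Γ₀.Finite →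
      ∃ (M : Model T) (v : α → M), ∀ φ ∈ Γ₀, φ.Realize v) :
    ∃ (M : Model T) (v : α → M), ∀ φ ∈ Γ, φ.Realize v := by
  let T' : L[[α]].Theory := (L.lhomWithConstants α).onTheory T ∪ Formula.equivSentence '' Γ
  have hsat : T'.IsSatisfiable := by
    rw [Theory.isSatisfiable_iff_isFinitelySatisfiable]
    intro T₀ hT₀
    obtain ⟨M, v, hv⟩ := h {φ ∈ Γ | Formula.equivSentence φ ∈ T₀} (Set.sep_subset _ _)
      ((T₀.finite_toSet.preimage Formula.equivSentence.injective.injOn).subset fun φ hφ => hφ.2)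
    let _ : (constantsOn α).Structure M := constantsOn.structure v
    have : (M : Type (max u v)) ⊨ (T₀ : L[[α]].Theory) := by
      refine ⟨fun φ hφ => ?_⟩
      rcases hT₀ hφ with h1 | ⟨ψ, hψ, rfl⟩
      · exact ((LHom.onTheory_model _ T).2 inferInstance).realize_of_mem φ h1
      · exact (Formula.realize_equivSentence M ψ).2 (hv ψ ⟨hψ, hφ⟩)
    exact ⟨Theory.ModelType.of _ M⟩
  obtain ⟨M⟩ := hsat
  let _ : L.Structure M := (L.lhomWithConstants α).reduct M
  have : (L.lhomWithConstants α).IsExpansionOn M := LHom.isExpansionOn_reduct _ _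
  have : (M : Type (max u v)) ⊨ T := by
    rw [← LHom.onTheory_model (L.lhomWithConstants α)]
    exact M.is_model.mono Set.subset_union_left
  refine ⟨Theory.ModelType.of T M, fun a => (L.con a : M), fun φ hφ => ?_⟩
  exact (Formula.realize_equivSentence M φ).1
    (M.is_model.realize_of_mem _ (Or.inr ⟨φ, hφ, rfl⟩))

/-- A set of formulas with parameters in a model that is finitely satisfiable in it is satisfiable in
an elementary extension. -/
theorem exists_elementaryExtension {T : L.Theory} (M : Model T) {β : Type (max u v)}
    (Γ : Set (L.Formula (M ⊕ β)))
    (h : ∀ Γ₀ : Set (L.Formula (M ⊕ β)), Γ₀ ⊆ Γ → Γ₀.Finite →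
      ∃ v : β → M, ∀ φ ∈ Γ₀, φ.Realize (Sum.elim id v)) :
    ∃ (M' : Model T) (j : M ↪ₑ[L] M') (v : β → M'), ∀ φ ∈ Γ, φ.Realize (Sum.elim j v) := by
  let D : Set (L.Formula (M ⊕ β)) := {φ | ∃ ψ : L.Formula M, ψ.Realize id ∧ ψ.relabel Sum.inl = φ}
  obtain ⟨M', v, hv⟩ := exists_model_realize (T := T) (D ∪ Γ) fun Γ₀ hΓ₀ hfin => by
    obtain ⟨v, hv⟩ := h (Γ₀ ∩ Γ) Set.inter_subset_right (hfin.subset Set.inter_subset_left)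
    refine ⟨M, Sum.elim id v, fun φ hφ => ?_⟩
    rcases hΓ₀ hφ with ⟨ψ, hψ, rfl⟩ | h1
    · exact Formula.realize_relabel.2 hψ
    · exact hv φ ⟨hφ, h1⟩
  have key : ∀ ψ : L.Formula M, ψ.Realize id → ψ.Realize (fun m => v (Sum.inl m)) := fun ψ hψ =>
    Formula.realize_relabel.1 (hv _ (Or.inl ⟨ψ, hψ, rfl⟩))
  refine ⟨M', ⟨fun m => v (Sum.inl m), fun n φ x => ?_⟩, fun b => v (Sum.inr b), fun φ hφ => ?_⟩
  · constructor
    · intro h1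
      by_contra h2
      have := key (Formula.not (φ.relabel x)) (by
        rw [Formula.realize_not, Formula.realize_relabel]
        exact h2)
      rw [Formula.realize_not, Formula.realize_relabel] at this
      exact this h1
    · intro h1
      exact Formula.realize_relabel.1 (key (φ.relabel x) (Formula.realize_relabel.2 h1))
  · refine (realize_congr φ fun i => ?_).1 (hv φ (Or.inr hφ))
    rcases i with i | i <;> rfl

/-- If infinitely many definable relations together imply another one, then finitely many do. -/
theorem exists_finset_of_forall_imp {T : L.Theory} {ι : Type} [Finite ι] {S : ι → EqSet L}
    {K : Type*} {P : K → ∀ M : Model T, (∀ i, (S i).Pts M) → Prop}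
    (hP : ∀ k, DefOn (carriers T) S (P k)) {R : ∀ M : Model T, (∀ i, (S i).Pts M) → Prop}
    (hR : DefOn (carriers T) S R) (h : ∀ M x, (∀ k, P k M x) → R M x) :
    ∃ F : Finset K, ∀ M x, (∀ k ∈ F, P k M x) → R M x := by
  classical
  by_contra! hF
  choose φ hφ using hP
  obtain ⟨ψ, hψ⟩ := hR
  let up : (Σ i, Fin (S i).arity) → ULift.{max u v} (Σ i, Fin (S i).arity) := ULift.up
  let A : Set (L.Formula (ULift.{max u v} (Σ i, Fin (S i).arity))) :=
    {θ | (∃ i, θ = ((S i).dom.relabel fun l => up ⟨i, l⟩)) ∨ θ = Formula.not (ψ.relabel up)}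
  obtain ⟨M, v, hv⟩ := exists_model_realize (T := T) (A ∪ Set.range fun k => (φ k).relabel up)
    fun Γ₀ hΓ₀ hfin => by
      choose k hk using fun θ : {θ ∈ Γ₀ | θ ∈ Set.range fun k => (φ k).relabel up} => θ.2.2
      have : Finite {θ ∈ Γ₀ | θ ∈ Set.range fun k => (φ k).relabel up} :=
        (hfin.subset (Set.sep_subset _ _)).to_subtype
      obtain ⟨M, x, hx, hx'⟩ := hF (Set.finite_range k).toFinset
      obtain ⟨a, ha⟩ := EqSet.exists_reps x
      refine ⟨M, fun p => a p.down.1 p.down.2, fun θ hθ => ?_⟩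
      rcases hΓ₀ hθ with (⟨i, rfl⟩ | rfl) | hθ'
      · exact Formula.realize_relabel.2 (ha i).dom
      · rw [Formula.realize_not, Formula.realize_relabel]
        exact fun h1 => hx' ((hψ M a x ha).1 h1)
      · have h1 := hk ⟨θ, hθ, hθ'⟩
        have h2 : (φ (k ⟨θ, hθ, hθ'⟩)).relabel up = θ := h1
        rw [← h2, Formula.realize_relabel]
        exact (hφ _ M a x ha).2 (hx _ ((Set.Finite.mem_toFinset _).2 ⟨_, rfl⟩))
  choose x hx using fun i => EqSet.exists_rep_of_dom (X := S i) (Formula.realize_relabel.1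
    (hv _ (Or.inl (Or.inl ⟨i, rfl⟩))))
  have hn := hv _ (Or.inl (Or.inr rfl))
  rw [Formula.realize_not, Formula.realize_relabel] at hn
  refine hn ((hψ M (fun i l => v (up ⟨i, l⟩)) x hx).2 (h M x fun k => ?_))
  exact (hφ k M (fun i l => v (up ⟨i, l⟩)) x hx).1
    (Formula.realize_relabel.1 (hv _ (Or.inr ⟨k, rfl⟩)))

end Compactness

/-! ### Realising an `ω`-group as an automorphism group -/

section Converse

variable {T : L.Theory} {Q C X Y : EqSet L} {f : Rel₃ Q X Y}

/-- An `ω`-group acting faithfully on `Q` is contained in a definable group acting faithfully. -/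
theorem OmegaGroup.exists_definable_overgroup (G : OmegaGroup T) (α : Rel₃ G.carrier Q Q)
    (hα : G.IsAction (fun _ g => G.Mem g) Q α)
    (hfaith : ∀ (M : Model T) (g h : G.carrier.Pts M), G.Mem g → G.Mem h →
      (∀ q q' : Q.Pts M, α.Holds g q q' ↔ α.Holds h q q') → g = h) :
    ∃ G₀ : Rel₁ G.carrier, ∀ M : Model T, ∃ (_ : Group (G.carrier.Pts M))
      (K : Subgroup (G.carrier.Pts M)) (ρ : K →* Equiv.Perm (Q.Pts M)),
      (∀ a b c : G.carrier.Pts M, G.mul.Holds a b c ↔ a * b = c) ∧ (∀ g, g ∈ K ↔ G₀.Holds g) ∧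
      (∀ g : K, Induces α g.1 (ρ g)) ∧ Function.Injective ρ ∧
      (∀ g : G.carrier.Pts M, G.Mem g → g ∈ K) ∧
      ∀ σ ∈ G.subs, ∃ H : Subgroup (G.carrier.Pts M), ∀ g, g ∈ H ↔ σ.Holds g := by
  -- the axioms of a faithful action: all triples of elements of the `ω`-group satisfy `R`, so that
  -- finitely many of the defining subgroups suffice for this
  let R : ∀ M : Model T, G.carrier.Pts M → G.carrier.Pts M → G.carrier.Pts M → Prop :=
    fun M g h k => (∀ q : Q.Pts M, ∃ q' : Q.Pts M, α.Holds g q q') ∧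
      (∀ q q' q'' : Q.Pts M, α.Holds g q q' → α.Holds g q q'' → q' = q'') ∧
      (G.mul.Holds g g g → ∀ q : Q.Pts M, α.Holds g q q) ∧
      (G.mul.Holds g h k → ∀ q q' q'' : Q.Pts M,
        α.Holds h q q' → α.Holds g q' q'' → α.Holds k q q'') ∧
      ((∀ q q' : Q.Pts M, α.Holds g q q' ↔ α.Holds h q q') → g = h)
  have hR : DefOn (carriers T) (triple G.carrier G.carrier G.carrier)
      (fun M x => R M (x (.inl ())) (x (.inr (.inl ()))) (x (.inr (.inr ())))) := by
    refine DefOn.and ?_ (DefOn.and ?_ (DefOn.and ?_ (DefOn.and ?_ ?_)))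
    · exact DefOn.all (DefOn.ex (DefOn.rel₃ α (.var _) (.var _) (.var _)))
    · exact DefOn.all (DefOn.all (DefOn.all (DefOn.imp (DefOn.rel₃ α (.var _) (.var _) (.var _))
        (DefOn.imp (DefOn.rel₃ α (.var _) (.var _) (.var _)) (DefOn.eq (.var _) (.var _))))))
    · exact DefOn.imp (DefOn.rel₃ G.mul (.var _) (.var _) (.var _))
        (DefOn.all (DefOn.rel₃ α (.var _) (.var _) (.var _)))
    · exact DefOn.imp (DefOn.rel₃ G.mul (.var _) (.var _) (.var _)) (DefOn.all (DefOn.all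
        (DefOn.all (DefOn.imp (DefOn.rel₃ α (.var _) (.var _) (.var _))
        (DefOn.imp (DefOn.rel₃ α (.var _) (.var _) (.var _))
          (DefOn.rel₃ α (.var _) (.var _) (.var _)))))))
    · exact DefOn.imp (DefOn.all (DefOn.all (DefOn.iff (DefOn.rel₃ α (.var _) (.var _) (.var _))
        (DefOn.rel₃ α (.var _) (.var _) (.var _))))) (DefOn.eq (.var _) (.var _))
  obtain ⟨F, hF⟩ := exists_finset_of_forall_imp (K := G.subs)
    (P := fun σ M x => σ.1.Holds (x (.inl ())) ∧ σ.1.Holds (x (.inr (.inl ()))) ∧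
      σ.1.Holds (x (.inr (.inr ()))))
    (fun σ => (DefOn.rel₁ σ.1 (DVar.var (S := triple G.carrier G.carrier G.carrier) (Sum.inl ()))).and
      ((DefOn.rel₁ σ.1 (DVar.var (S := triple G.carrier G.carrier G.carrier) (Sum.inr (Sum.inl ())))).and
      (DefOn.rel₁ σ.1 (DVar.var (S := triple G.carrier G.carrier G.carrier) (Sum.inr (Sum.inr ())))))) hR fun M x hx => by
    have hg : G.Mem (x (.inl ())) := fun σ hσ => (hx ⟨σ, hσ⟩).1
    have hh : G.Mem (x (.inr (.inl ()))) := fun σ hσ => (hx ⟨σ, hσ⟩).2.1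
    have hk : G.Mem (x (.inr (.inr ()))) := fun σ hσ => (hx ⟨σ, hσ⟩).2.2
    exact ⟨fun q => ((hα M).1 _ hg q).exists, fun q q' q'' h1 h2 => ((hα M).1 _ hg q).unique h1 h2,
      (hα M).2.1 _ hg, (hα M).2.2 _ _ _ hg hh hk, hfaith M _ _ hg hh⟩
  have hF' : ∀ (M : Model T) (g h k : G.carrier.Pts M), (∀ σ ∈ F, σ.1.Holds g) →
      (∀ σ ∈ F, σ.1.Holds h) → (∀ σ ∈ F, σ.1.Holds k) → R M g h k := by
    intro M g h k hg hh hk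
    exact hF M (fun i => match i with
      | .inl _ => g
      | .inr (.inl _) => h
      | .inr (.inr _) => k) fun σ hσ => ⟨hg σ hσ, hh σ hσ, hk σ hσ⟩
  obtain ⟨G₀, hG₀⟩ := DefOn.exists_rel₁ (N := carriers T) (X := G.carrier)
    (R := fun M g => ∀ σ : F, σ.1.1.Holds g) (DefOn.finiteAll fun σ => DefOn.rel₁ σ.1.1 (.var _))
  refine ⟨G₀, fun M => ?_⟩
  obtain ⟨inst, hmul⟩ := G.isGroup M
  have hsub : ∀ σ ∈ G.subs, ∃ H : Subgroup (G.carrier.Pts M), ∀ g, g ∈ H ↔ σ.Holds g := by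
    intro σ hσ
    obtain ⟨⟨a, ha⟩, h2, h3⟩ := G.isSubgroup σ hσ M
    have hinv : ∀ a : G.carrier.Pts M, σ.Holds a → σ.Holds a⁻¹ := fun a ha =>
      h3 a a⁻¹ 1 ha ((hmul _ _ _).2 (mul_inv_cancel a)) ((hmul _ _ _).2 (mul_one 1))
    have hm : ∀ a b : G.carrier.Pts M, σ.Holds a → σ.Holds b → σ.Holds (a * b) := fun a b ha hb =>
      h2 a b _ ha hb ((hmul _ _ _).2 rfl)
    exact ⟨{ carrier := {g | σ.Holds g}
             one_mem' := by simpa using hm a _ ha (hinv a ha)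
             mul_mem' := fun {a b} ha hb => hm a b ha hb
             inv_mem' := fun {a} ha => hinv a ha }, fun g => Iff.rfl⟩
  choose H hH using hsub
  let K : Subgroup (G.carrier.Pts M) := ⨅ σ : F, H σ.1.1 σ.1.2
  have hK : ∀ g, g ∈ K ↔ ∀ σ ∈ F, σ.1.Holds g := by
    intro g
    simp only [K, Subgroup.mem_iInf, hH]
    exact ⟨fun h σ hσ => h ⟨σ, hσ⟩, fun h σ => h σ.1 σ.2⟩
  have hKR : ∀ g h k : K, R M g h k := fun g h k =>
    hF' M g h k ((hK _).1 g.2) ((hK _).1 h.2) ((hK _).1 k.2)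
  choose a ha using fun g : K => (hKR g g g).1
  have ha' : ∀ (g : K) q q', α.Holds g.1 q q' ↔ a g q = q' := fun g q q' =>
    ⟨fun h => (hKR g g g).2.1 _ _ _ (ha g q) h, fun h => h ▸ ha g q⟩
  have ha1 : ∀ q, a 1 q = q := fun q =>
    (ha' 1 q q).1 ((hKR 1 1 1).2.2.1 ((hmul _ _ _).2 (mul_one 1)) q)
  have ham : ∀ (g h : K) q, a (g * h) q = a g (a h q) := fun g h q =>
    (ha' _ _ _).1 ((hKR g h (g * h)).2.2.2.1 ((hmul _ _ _).2 rfl) _ _ _ (ha h q) (ha g _))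
  let ρ : K →* Equiv.Perm (Q.Pts M) := MonoidHom.toHomPerm
    { toFun := a
      map_one' := funext ha1
      map_mul' := fun g h => funext (ham g h) }
  refine ⟨inst, K, ρ, hmul, fun g => ?_, ha', fun g h e => ?_, fun g hg => ?_,
    fun σ hσ => ⟨H σ hσ, hH σ hσ⟩⟩
  · rw [hK, hG₀]
    exact ⟨fun h σ => h σ.1 σ.2, fun h σ hσ => h ⟨σ, hσ⟩⟩
  · refine Subtype.ext ((hKR g h g).2.2.2.2 fun q q' => ?_)
    rw [ha', ha']
    have : a g = a h := congrArg (fun p : Equiv.Perm (Q.Pts M) => (p : Q.Pts M → Q.Pts M)) e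
    rw [this]
  · exact (hK g).2 fun σ _ => hg σ.1 σ.2

end Converse

section Converse

variable {T : L.Theory} {Q C X Y : EqSet L} {f : Rel₃ Q X Y}

/-- A permutation of `Q` extends to the internality group if it permutes the maps `f(·, x)`. -/
theorem IsInternal.exists_mem_intGroup (h : IsInternal T Q C X Y f) {M : Model T}
    (p : Equiv.Perm (Q.Pts M)) (h₁ : ∀ x : X.Pts M, ∃ x' : X.Pts M, ∀ q, h.val (p q) x' = h.val q x)
    (h₂ : ∀ x' : X.Pts M, ∃ x : X.Pts M, ∀ q, h.val (p q) x' = h.val q x) :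
    ∃ τ, (p, τ) ∈ intGroup f M := by
  choose a ha using h₁
  choose b hb using h₂
  refine ⟨⟨a, b, fun x => h.val_ext fun q => ?_, fun x => h.val_ext fun q => ?_⟩,
    h.mem_intGroup.2 fun q x => ha x q⟩
  · rw [← hb, ha]
  · obtain ⟨q, rfl⟩ := p.surjective q
    rw [ha, hb]

/-- An `ω`-group acting faithfully on `Q` is the automorphism group of an internality structure:
the translates of the maps `f(·, x)` by the group form the new family of maps, and the orbit
equivalence relations of the defining subgroups on this family cut out the group. -/
theorem IsInternal.exists_realisation (h : IsInternal T Q C X Y f) (G : OmegaGroup T)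
    (α : Rel₃ G.carrier Q Q) (hα : G.IsAction (fun _ g => G.Mem g) Q α)
    (hfaith : ∀ (M : Model T) (g h : G.carrier.Pts M), G.Mem g → G.Mem h →
      (∀ q q' : Q.Pts M, α.Holds g q q' ↔ α.Holds h q q') → g = h) :
    ∃ (X' Y' : EqSet L) (f' : Rel₃ Q X' Y') (Δ : Set (DefRel (Slot.set Q X')))
      (β : Rel₃ G.carrier X' X'),
      IsInternal T Q C X' Y' f' ∧ G.IsAction (fun _ g => G.Mem g) X' β ∧
      ∀ M : Model T, ActsAs (M := M) G.Mem α β (autGroup f' Δ M) := by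
  obtain ⟨G₀, hG₀⟩ := G.exists_definable_overgroup α hα hfaith
  choose inst K ρ hmul hK hρ hinj hmem hsub using hG₀
  let S : Unit ⊕ Unit → EqSet L := Sum.elim (fun _ => X) (fun _ => G.carrier)
  let D : ∀ M : Model T, (∀ i, (S i).Pts M) → Prop := fun M x => G₀.Holds (x (.inr ()))
  -- `F M x g` is the graph of the translate `f(g⁻¹ ·, x)`
  let F : ∀ M : Model T, X.Pts M → G.carrier.Pts M → Q.Pts M → Y.Pts M → Prop :=
    fun M x g q y => ∃ q₀ : Q.Pts M, α.Holds g q₀ q ∧ h.val q₀ x = y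
  let E : ∀ M : Model T, (∀ i, (S i).Pts M) → (∀ i, (S i).Pts M) → Prop := fun M x x' =>
    ∀ (q : Q.Pts M) (y : Y.Pts M), F M (x (.inl ())) (x (.inr ())) q y ↔
      F M (x' (.inl ())) (x' (.inr ())) q y
  have hD : DefOn (carriers T) S D := DefOn.rel₁ G₀ (DVar.var (S := S) (Sum.inr ()))
  have hE : DefOn (carriers T) (Sum.elim S S)
      (fun M x => E M (fun i => x (.inl i)) (fun i => x (.inr i))) := by
    refine DefOn.all (DefOn.all (DefOn.iff (DefOn.ex (DefOn.and ?_ ?_))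
      (DefOn.ex (DefOn.and ?_ ?_))))
    · exact DefOn.rel₃ α (.var _) (.var _) (.var _)
    · exact h.defOn_val (.var _) (.var _) (.var _)
    · exact DefOn.rel₃ α (.var _) (.var _) (.var _)
    · exact h.defOn_val (.var _) (.var _) (.var _)
  obtain ⟨X', mk, hmk, hmk', hmkdef⟩ := exists_quotient hD hE fun M =>
    ⟨fun _ _ _ => Iff.rfl, fun e q q' => (e q q').symm, fun e e' q q' => (e q q').trans (e' q q')⟩
  -- the pair consisting of a point of `X` and an element of the group
  let pr : ∀ M : Model T, X.Pts M → K M → {x // D M x} := fun M x g =>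
    ⟨fun i => match i with
      | .inl _ => x
      | .inr _ => g.1, (hK M _).1 g.2⟩
  have hpr : ∀ (M : Model T) (x' : X'.Pts M), ∃ x g, mk M (pr M x g) = x' := by
    intro M x'
    obtain ⟨⟨x, hx⟩, rfl⟩ := hmk M x'
    refine ⟨x (.inl ()), ⟨x (.inr ()), (hK M _).2 hx⟩, congrArg (mk M) (Subtype.ext ?_)⟩
    funext i
    rcases i with i | i <;> rfl
  choose px pg hp using hpr
  have hF : ∀ (M : Model T) x (g : K M) q y, F M x g.1 q y ↔ h.val ((ρ M g)⁻¹ q) x = y := by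
    intro M x g q y
    constructor
    · rintro ⟨q₀, h1, rfl⟩
      simp [← (hρ M g _ _).1 h1]
    · rintro rfl
      exact ⟨_, (hρ M g _ _).2 (by simp), rfl⟩
  have hmkF : ∀ (M : Model T) x g x' g', mk M (pr M x g) = mk M (pr M x' g') ↔
      ∀ q, h.val ((ρ M g)⁻¹ q) x = h.val ((ρ M g')⁻¹ q) x' := by
    intro M x g x' g'
    refine (hmk' M _ _).trans (forall_congr' fun q => ?_)
    refine (forall_congr' fun y => iff_congr (hF M x g q y) (hF M x' g' q y)).trans ?_
    exact ⟨fun e => ((e _).1 rfl).symm, fun e y => by rw [e]⟩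
  have hf' : DefOn (carriers T) (triple Q X' Y) (fun M x =>
      h.val ((ρ M (pg M (x (.inr (.inl ())))))⁻¹ (x (.inl ()))) (px M (x (.inr (.inl ())))) =
        x (.inr (.inr ()))) := by
    have h1 : DefOn (carriers T) (triple Q X' Y) (fun M x => ∃ z : ∀ i, (S i).Pts M,
        (∃ hz : D M z, mk M ⟨z, hz⟩ = x (.inr (.inl ()))) ∧ ∃ q₀ : Q.Pts M,
          α.Holds (z (.inr ()) : G.carrier.Pts M) q₀ (x (.inl ())) ∧
          h.val q₀ (z (.inl ()) : X.Pts M) = x (.inr (.inr ()))) := by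
      refine DefOn.exFam (DefOn.and ?_ (DefOn.ex (DefOn.and ?_ ?_)))
      · exact DefOn.graph (S' := Sum.elim (triple Q X' Y) S) hmkdef (t := fun i _ x => x (Sum.inr i))
          (r := fun _ x => x (Sum.inl (Sum.inr (Sum.inl ())))) (fun _ => .var _) (.var _)
      · exact DefOn.rel₃ α (.var _) (.var _) (.var _)
      · exact h.defOn_val (.var _) (.var _) (.var _)
    have h2 : ∀ (M : Model T) (q : Q.Pts M) (x' : X'.Pts M) (y : Y.Pts M),
        (∃ z : ∀ i, (S i).Pts M, (∃ hz : D M z, mk M ⟨z, hz⟩ = x') ∧ ∃ q₀ : Q.Pts M,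
          α.Holds (z (.inr ()) : G.carrier.Pts M) q₀ q ∧ h.val q₀ (z (.inl ()) : X.Pts M) = y) ↔
        h.val ((ρ M (pg M x'))⁻¹ q) (px M x') = y := by
      intro M q x' y
      constructor
      · rintro ⟨z, ⟨hz, rfl⟩, h1⟩
        have h3 := (hmk' M (pr M (px M (mk M ⟨z, hz⟩)) (pg M (mk M ⟨z, hz⟩))) ⟨z, hz⟩).1
          (hp M _) q y
        exact (hF M _ _ q y).1 (h3.2 h1)
      · intro h1
        exact ⟨(pr M (px M x') (pg M x')).1, ⟨(pr M (px M x') (pg M x')).2, hp M x'⟩,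
          (hF M _ _ q y).2 h1⟩
    exact h1.congr fun M x => h2 M _ _ _
  obtain ⟨f', hf'⟩ := DefOn.exists_rel₃ (N := carriers T) (R := fun M q x' y =>
    h.val ((ρ M (pg M x'))⁻¹ q) (px M x') = y) hf'
  have hint : IsInternal T Q C X' Y f' := by
    refine ⟨h.target, fun M => ?_, fun M q x' => ?_, fun M x' q q' y h1 h2 => ?_,
      fun M x x' e => ?_⟩
    · obtain ⟨x⟩ := h.nonempty M
      exact ⟨mk M (pr M x 1)⟩
    · exact ⟨_, (hf' M _ _ _).2 rfl, fun y hy => ((hf' M _ _ _).1 hy).symm⟩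
    · rw [hf'] at h1 h2
      exact (ρ M (pg M x'))⁻¹.injective (h.val_injective (h1.trans h2.symm))
    · rw [← hp M x, ← hp M x', hmkF]
      intro q
      exact ((hf' M _ _ _).1 ((e q _).1 ((hf' M _ _ _).2 rfl))).symm
  have hval : ∀ (M : Model T) q x (g : K M),
      hint.val q (mk M (pr M x g)) = h.val ((ρ M g)⁻¹ q) x := by
    intro M q x g
    refine ((hf' M _ _ _).1 (hint.holds_iff.2 rfl)).symm.trans ?_
    exact (hmkF M _ _ _ _).1 (hp M _) q
  obtain ⟨β, hβ⟩ := DefOn.exists_rel₃ (N := carriers T) (X := G.carrier) (Y := X') (Z := X')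
    (R := fun M g x x' => ∀ q q' : Q.Pts M, α.Holds g q q' → hint.val q x = hint.val q' x')
    (DefOn.all (DefOn.all (DefOn.imp (DefOn.rel₃ α (.var _) (.var _) (.var _))
      (hint.defOn_val_eq (.var _) (.var _) (.var _) (.var _)))))
  have hext : ∀ (M : Model T) (g : K M), ∃ τ, (ρ M g, τ) ∈ intGroup f' M := by
    intro M g
    refine hint.exists_mem_intGroup _ (fun x => ?_) fun x => ?_
    · obtain ⟨y, k, rfl⟩ : ∃ y k, mk M (pr M y k) = x := ⟨_, _, hp M x⟩
      refine ⟨mk M (pr M y (g * k)), fun q => ?_⟩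
      simp [hval]
    · obtain ⟨y, k, rfl⟩ : ∃ y k, mk M (pr M y k) = x := ⟨_, _, hp M x⟩
      refine ⟨mk M (pr M y (g⁻¹ * k)), fun q => ?_⟩
      rw [hval, hval, map_mul, mul_inv_rev, Equiv.Perm.mul_apply, map_inv, inv_inv]
  choose τ hτ using hext
  have hτβ : ∀ (M : Model T) (g : K M), Induces β g.1 (τ M g) := by
    intro M g x x'
    rw [hβ, hint.snd_eq_iff (hτ M g)]
    exact forall_congr' fun q => forall_congr' fun q' => by rw [hρ M g q q']
  have hτ1 : ∀ M : Model T, τ M 1 = 1 := fun M => congrArg Prod.snd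
    (hint.intGroup_ext (hτ M 1) (intGroup f' M).one_mem (map_one (ρ M)))
  have hτm : ∀ (M : Model T) (g k : K M), τ M (g * k) = τ M g * τ M k := fun M g k =>
    congrArg Prod.snd (hint.intGroup_ext (hτ M (g * k)) ((intGroup f' M).mul_mem (hτ M g) (hτ M k))
      (map_mul (ρ M) g k))
  -- the graph of the map from `X'` to its quotient by the orbits of a definable subgroup is preserved
  -- by the permutations that preserve all orbits
  have hquot : ∀ σ : (insert G₀ G.subs : Set (Rel₁ G.carrier)), ∃ R : DefRel (Slot.set Q X'),
      ∀ (M : Model T) (p : Equiv.Perm (Q.Pts M) × Equiv.Perm (X'.Pts M)),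
        (∀ x : ∀ i, ((R.slot i).set Q X').Pts M,
          R.Holds M (fun i => Slot.act Q X' M p (R.slot i) (x i)) ↔ R.Holds M x) ↔
        ∀ x, ∃ g : K M, σ.1.Holds g.1 ∧ τ M g x = p.2 x := by
    rintro ⟨σ, hσ⟩
    have hH : ∀ M : Model T, ∃ H : Subgroup (G.carrier.Pts M), ∀ g, g ∈ H ↔ σ.Holds g := by
      rcases hσ with rfl | hσ
      · exact fun M => ⟨K M, hK M⟩
      · exact fun M => hsub M σ hσ
    choose H hH using hH
    let E' : ∀ M : Model T, (Unit → X'.Pts M) → (Unit → X'.Pts M) → Prop := fun M x x' =>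
      ∃ g : G.carrier.Pts M, G₀.Holds g ∧ σ.Holds g ∧ β.Holds g (x ()) (x' ())
    have hE'τ : ∀ (M : Model T) x x', E' M x x' ↔ ∃ g : K M, σ.Holds g.1 ∧ τ M g (x ()) = x' () := by
      intro M x x'
      constructor
      · rintro ⟨g, h1, h2, h3⟩
        exact ⟨⟨g, (hK M g).2 h1⟩, h2, (hτβ M ⟨g, (hK M g).2 h1⟩ _ _).1 h3⟩
      · rintro ⟨g, h1, h2⟩
        exact ⟨g, (hK M _).1 g.2, h1, (hτβ M g _ _).2 h2⟩
    obtain ⟨Z, mq, hmq, hmq', hmqdef⟩ := exists_quotient (N := carriers T) (S := fun _ : Unit => X')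
      (D := fun _ _ => True) DefOn.true (E := E')
      (DefOn.ex (DefOn.and (DefOn.rel₁ G₀ (.var _)) (DefOn.and (DefOn.rel₁ σ (.var _))
        (DefOn.rel₃ β (.var _) (.var _) (.var _))))) fun M => by
      refine ⟨fun x => (hE'τ M _ _).2 ⟨1, (hH M _).1 (H M).one_mem, by rw [hτ1]; rfl⟩,
        fun {x y} e => ?_, fun {x y z} e e' => ?_⟩
      · obtain ⟨g, h1, h2⟩ := (hE'τ M _ _).1 e
        refine (hE'τ M _ _).2 ⟨g⁻¹, (hH M _).1 ((H M).inv_mem ((hH M _).2 h1)), ?_⟩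
        rw [← h2, ← Equiv.Perm.mul_apply, ← hτm, inv_mul_cancel, hτ1]
        rfl
      · obtain ⟨g, h1, h2⟩ := (hE'τ M _ _).1 e
        obtain ⟨g', h1', h2'⟩ := (hE'τ M _ _).1 e'
        refine (hE'τ M _ _).2 ⟨g' * g, (hH M _).1 ((H M).mul_mem ((hH M _).2 h1')
          ((hH M _).2 h1)), ?_⟩
        rw [hτm, Equiv.Perm.mul_apply, h2, h2']
    obtain ⟨φ, hφ⟩ := DefOn.exists_defRel (N := carriers T) (S := Slot.set Q X')
      (slot := ![Slot.x, Slot.other Z])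
      (R := fun M x => mq M ⟨fun _ => x 0, trivial⟩ = x 1)
      ((DefOn.graph hmqdef (S' := fun i => Slot.set Q X' (![Slot.x, Slot.other Z] i))
        (t := fun _ _ x => x 0) (r := fun _ x => x 1)
        (fun _ => DVar.var (S := fun i => Slot.set Q X' (![Slot.x, Slot.other Z] i)) 0)
        (DVar.var (S := fun i => Slot.set Q X' (![Slot.x, Slot.other Z] i)) 1)).congr fun M x =>
          ⟨fun ⟨_, e⟩ => e, fun e => ⟨trivial, e⟩⟩)
    refine ⟨⟨2, ![Slot.x, Slot.other Z], φ⟩, fun M p => ?_⟩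
    have key : ∀ x : X'.Pts M, mq M ⟨fun _ => p.2 x, trivial⟩ = mq M ⟨fun _ => x, trivial⟩ ↔
        ∃ g : K M, σ.Holds g.1 ∧ τ M g x = p.2 x := fun x =>
      eq_comm.trans ((hmq' M _ _).trans (hE'τ M _ _))
    constructor
    · intro e x
      have h1 := e (fun i => match i with
        | 0 => x
        | 1 => mq M ⟨fun _ => x, trivial⟩)
      exact (key x).1 (((hφ M _).symm.trans (h1.trans (hφ M _))).2 rfl)
    · intro e x
      refine (hφ M _).trans (Iff.trans ?_ (hφ M _).symm)
      have h1 := (key (x 0)).2 (e (x 0))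
      exact ⟨fun h2 => h1.symm.trans h2, fun h2 => h1.trans h2⟩
  choose R hR using hquot
  refine ⟨X', Y, f', Set.range R, β, hint, fun M => ⟨fun g hg x => ?_, fun e he hee x => ?_,
      fun a b c ha hb hc habc x x' x'' hx hx' => ?_⟩, fun M => ⟨fun g hg => ?_, fun p hp => ?_⟩⟩
  · let g' : K M := ⟨g, hmem M g hg⟩
    exact ⟨τ M g' x, (hτβ M g' _ _).2 rfl, fun x' hx' => ((hτβ M g' _ _).1 hx').symm⟩
  · have h1 : e = 1 := by simpa using (hmul M _ _ _).1 hee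
    subst h1
    refine (hτβ M 1 _ _).2 ?_
    rw [hτ1]
    rfl
  · let a' : K M := ⟨a, hmem M a ha⟩
    let b' : K M := ⟨b, hmem M b hb⟩
    have hc' : c = (a' * b').1 := ((hmul M _ _ _).1 habc).symm
    rw [hc']
    refine (hτβ M (a' * b') _ _).2 ?_
    rw [hτm, Equiv.Perm.mul_apply, (hτβ M b' _ _).1 hx, (hτβ M a' _ _).1 hx']
  · let g' : K M := ⟨g, hmem M g hg⟩
    refine ⟨(ρ M g', τ M g'), ⟨hτ M g', ?_⟩, hρ M g', hτβ M g'⟩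
    rintro _ ⟨σ, rfl⟩
    refine (hR σ M _).2 fun x => ⟨g', ?_, rfl⟩
    rcases σ with ⟨σ, rfl | hσ⟩
    · exact (hK M g).1 g'.2
    · exact hg σ hσ
  · -- on `Q`, a permutation preserving the orbits agrees with an element of each of the subgroups,
    -- and by faithfulness these elements are all equal
    obtain ⟨x₀⟩ := hint.nonempty M
    have hg : ∀ σ ∈ insert G₀ G.subs, ∃ g : K M, σ.Holds g.1 ∧ ρ M g = p.1 := by
      intro σ hσ
      obtain ⟨g, h1, h2⟩ := (hR ⟨σ, hσ⟩ M p).1 (fun x => hp.2 _ ⟨⟨σ, hσ⟩, rfl⟩ x) x₀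
      refine ⟨g, h1, Equiv.ext fun q => ?_⟩
      rw [hint.fst_eq_iff (hτ M g) h2]
      exact (hint.fst_eq_iff hp.1 rfl).1 rfl
    obtain ⟨g, -, hgp⟩ := hg G₀ (Or.inl rfl)
    have hgm : G.Mem g.1 := by
      intro σ hσ
      obtain ⟨g', h1, h2⟩ := hg σ (Or.inr hσ)
      rwa [hinj M (hgp.trans h2.symm)]
    have hgi : Induces α g.1 p.1 := hgp ▸ hρ M g
    have hτp : τ M g = p.2 := congrArg Prod.snd (hint.intGroup_ext (hτ M g) hp.1 hgp)
    refine ⟨g, ⟨hgm, hgi, hτp ▸ hτβ M g⟩, fun g' hg' => ?_⟩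
    exact hfaith M _ _ hg'.1 hgm fun q q' => (hg'.2.1 q q').trans (hgi q q').symm

end Converse

universe w'

/-! ### Elementary maps on points -/

section PtsMap

variable {M : Type w} [L.Structure M] {M' : Type w'} [L.Structure M']

/-- The formula expressing that two tuples represent the same point. -/
noncomputable def EqSet.eqForm (X : EqSet L) : L.Formula (Fin X.arity ⊕ Fin X.arity) :=
  Language.Formula.iAlls (Fin X.aux) (Language.Formula.iff (X.fam.relabel (Sum.map Sum.inl id))
    (X.fam.relabel (Sum.map Sum.inr id)))

theorem EqSet.Rep.realize_eqForm {X : EqSet L} {a b : Fin X.arity → M} {x y : X.Pts M}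
    (ha : X.Rep a x) (hb : X.Rep b y) : X.eqForm.Realize (Sum.elim a b) ↔ x = y := by
  rw [ha.eq_iff hb]
  simp only [EqSet.eqForm, Language.Formula.realize_iAlls, Language.Formula.realize_iff,
    Language.Formula.realize_relabel]
  refine forall_congr' fun t => iff_congr (realize_congr _ fun i => ?_) (realize_congr _ fun i => ?_)
  all_goals rcases i with i | i <;> rfl

theorem EqSet.exists_map (X : EqSet L) (e : M ↪ₑ[L] M') (x : X.Pts M) :
    ∃ y : X.Pts M', ∀ a, X.Rep a x → X.Rep (e ∘ a) y := by
  obtain ⟨a, ha⟩ := EqSet.exists_rep x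
  obtain ⟨y, hy⟩ := EqSet.exists_rep_of_dom ((e.map_formula X.dom a).2 ha.dom)
  refine ⟨y, fun b hb => ?_⟩
  obtain ⟨z, hz⟩ := EqSet.exists_rep_of_dom ((e.map_formula X.dom b).2 hb.dom)
  have h1 := (e.map_formula X.eqForm (Sum.elim b a)).2 ((hb.realize_eqForm ha).2 rfl)
  rw [Sum.comp_elim] at h1
  rw [← (hz.realize_eqForm hy).1 h1]
  exact hz

/-- The map induced on points by an elementary map. -/
noncomputable def EqSet.map (X : EqSet L) (e : M ↪ₑ[L] M') (x : X.Pts M) : X.Pts M' :=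
  (X.exists_map e x).choose

theorem EqSet.Rep.map {X : EqSet L} {a : Fin X.arity → M} {x : X.Pts M} (h : X.Rep a x)
    (e : M ↪ₑ[L] M') : X.Rep (e ∘ a) (X.map e x) := (X.exists_map e x).choose_spec a h

/-- The permutation of points induced by an automorphism. -/
noncomputable def EqSet.perm (X : EqSet L) (σ : M ≃[L] M) : Equiv.Perm (X.Pts M) where
  toFun := X.map σ.toElementaryEmbedding
  invFun := X.map σ.symm.toElementaryEmbedding
  left_inv x := by
    obtain ⟨a, ha⟩ := EqSet.exists_rep x
    refine ((ha.map σ.toElementaryEmbedding).map σ.symm.toElementaryEmbedding).unique ?_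
    convert ha
    funext i
    exact σ.symm_apply_apply (a i)
  right_inv x := by
    obtain ⟨a, ha⟩ := EqSet.exists_rep x
    refine ((ha.map σ.symm.toElementaryEmbedding).map σ.toElementaryEmbedding).unique ?_
    convert ha
    funext i
    exact σ.apply_symm_apply (a i)

theorem EqSet.Rep.perm {X : EqSet L} {a : Fin X.arity → M} {x : X.Pts M} (h : X.Rep a x)
    (σ : M ≃[L] M) : X.Rep (σ ∘ a) (X.perm σ x) := h.map σ.toElementaryEmbedding

end PtsMap

/-- Elementary maps preserve and reflect definable relations between points. -/
theorem DefOn.map_iff {J : Type*} {N : J → Type w} [∀ j, L.Structure (N j)] {ι : Type*}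
    {S : ι → EqSet L} {R : ∀ j, (∀ i, (S i).Pts (N j)) → Prop} (h : DefOn N S R) {j j' : J}
    (e : N j ↪ₑ[L] N j') (x : ∀ i, (S i).Pts (N j)) :
    R j' (fun i => (S i).map e (x i)) ↔ R j x := by
  obtain ⟨φ, hφ⟩ := h
  obtain ⟨a, ha⟩ := EqSet.exists_reps x
  rw [← hφ j a x ha, ← hφ j' (fun i => e ∘ a i) _ fun i => (ha i).map e]
  exact e.map_formula φ _

theorem EqSet.map_injective {M M' : Type w} [L.Structure M] [L.Structure M'] (X : EqSet L)
    (e : M ↪ₑ[L] M') : Function.Injective (X.map e) := by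
  intro x y h
  obtain ⟨a, ha⟩ := EqSet.exists_rep x
  obtain ⟨b, hb⟩ := EqSet.exists_rep y
  refine (ha.realize_eqForm hb).1 ((e.map_formula X.eqForm _).1 ?_)
  rw [Sum.comp_elim]
  exact ((ha.map e).realize_eqForm (hb.map e)).2 h

/-- Automorphisms fixing `C` pointwise preserve internality structures. -/
theorem IsInternal.holds_perm_iff {T : L.Theory} {Q C X Y : EqSet L} {f : Rel₃ Q X Y}
    (h : IsInternal T Q C X Y f) {M : Model T} (σ : M ≃[L] M) (hσ : ∀ c, C.perm σ c = c)
    (q : Q.Pts M) (x : X.Pts M) (y : Y.Pts M) :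
    f.Holds (Q.perm σ q) (X.perm σ x) y ↔ f.Holds q x y := by
  obtain ⟨r, k, ρ, hρ⟩ := h.target
  have hy : Y.perm σ y = y := by
    obtain ⟨j, c, hc⟩ := (hρ M).2 y
    refine (hρ M).1 j c _ _ ?_ hc
    have h1 := (DefOn.map_iff (N := carriers T) (j := M) (j' := M)
      (DefOn.relPow (S := Sum.elim (fun _ : Fin (k j) => C) (fun _ : Unit => Y)) (ρ j)
        (t := fun _ x i => x (.inl i)) (s := fun _ x => x (.inr ()))
        (fun _ => .var _) (.var _)) σ.toElementaryEmbedding (fun i => match i with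
          | .inl i => c i
          | .inr _ => y)).2 hc
    have h2 : (fun i => C.perm σ (c i)) = c := funext fun i => hσ (c i)
    rw [← h2]
    exact h1
  have h1 := DefOn.map_iff (N := carriers T) (j := M) (j' := M)
    (DefOn.rel₃ f (DVar.var (S := triple Q X Y) (Sum.inl ()))
      (DVar.var (S := triple Q X Y) (Sum.inr (Sum.inl ())))
      (DVar.var (S := triple Q X Y) (Sum.inr (Sum.inr ())))) σ.toElementaryEmbedding (fun i => match i with
          | .inl _ => q
          | .inr (.inl _) => x
          | .inr (.inr _) => y)
  refine Iff.trans ?_ h1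
  change _ ↔ f.Holds (Q.perm σ q) (X.perm σ x) (Y.perm σ y)
  rw [hy]

/-! ### The structure on `Q` and `C` -/

section Delta

variable {Q C : EqSet L} (Δ : Set (DefRel (QC.set Q C)))

theorem realize_dom_deltaSort {M : Type w} [L.Structure M] {s : QC} {a : Fin 1 → DeltaModel Δ M} :
    (deltaSort Δ s).dom.Realize a ↔ ∃ x, a 0 = DeltaModel.incl Δ M s x :=
  Language.Formula.realize_rel₁ (L := deltaLang Δ) (M := DeltaModel Δ M)
    (R := (DeltaRel.sort s : DeltaRel Δ 1)) (t := Language.Term.var 0) (v := a)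

/-- The point of a sort of `M_Δ` that corresponds to a point of `Q(M)` or `C(M)`. -/
def deltaPt (M : Type w) [L.Structure M] (s : QC) (x : (s.set Q C).Pts M) :
    (deltaSort Δ s).Pts (DeltaModel Δ M) :=
  Quotient.mk _ ⟨fun _ => DeltaModel.incl Δ M s x, (realize_dom_deltaSort Δ).2 ⟨x, rfl⟩⟩

variable {Δ}

theorem DeltaModel.incl_injective {M : Type w} [L.Structure M] (s : QC) :
    Function.Injective (DeltaModel.incl Δ M s) := by
  cases s
  exacts [Sum.inl_injective, Sum.inr_injective]

theorem rep_deltaPt {M : Type w} [L.Structure M] {s : QC} {a : Fin 1 → DeltaModel Δ M}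
    {x : (s.set Q C).Pts M} :
    (deltaSort Δ s).Rep a (deltaPt Δ M s x) ↔ a = fun _ => DeltaModel.incl Δ M s x := by
  have h0 : (deltaSort Δ s).Rep (fun _ => DeltaModel.incl Δ M s x) (deltaPt Δ M s x) := ⟨_, rfl⟩
  constructor
  · intro h
    have h1 := (h.eq_iff h0).1 rfl (fun _ => DeltaModel.incl Δ M s x)
    simp only [deltaSort, Language.Formula.realize_equal, Language.Term.realize_var,
      Sum.elim_inl, Sum.elim_inr, iff_true] at h1
    funext i
    rw [Subsingleton.elim i 0]
    exact h1
  · rintro rfl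
    exact h0

theorem deltaPt_bijective {M : Type w} [L.Structure M] (s : QC) :
    Function.Bijective (deltaPt Δ M s) := by
  refine ⟨fun x y h => ?_, fun z => ?_⟩
  · have h1 : (deltaSort Δ s).Rep (fun _ => DeltaModel.incl Δ M s x) (deltaPt Δ M s y) :=
      h ▸ rep_deltaPt.2 rfl
    exact DeltaModel.incl_injective s (congrFun (rep_deltaPt.1 h1) 0)
  · obtain ⟨a, ha⟩ := EqSet.exists_rep z
    obtain ⟨x, hx⟩ := (realize_dom_deltaSort Δ).1 ha.dom
    exact ⟨x, EqSet.Rep.unique (rep_deltaPt.2 (funext fun i : Fin 1 =>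
      (congrArg (fun j : Fin 1 => a j) (Subsingleton.elim i 0)).trans hx)) ha⟩

/-- The structure `M_Δ` as a model of `T_Δ`. -/
def deltaModel {T : L.Theory} (Δ : Set (DefRel (QC.set Q C))) (M : Model T)
    [Nonempty (DeltaModel Δ M)] : Model (deltaTheory T Δ) where
  Carrier := DeltaModel Δ M
  is_model := ⟨fun _ hσ => hσ M⟩

/-- The automorphism of `M_Δ` given by an automorphism of `Q(M)` over `C(M)`. -/
def deltaAut {M : Type w} [L.Structure M] {g : Equiv.Perm (Q.Pts M)} (hg : g ∈ autOver Δ M) :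
    DeltaModel Δ M ≃[deltaLang Δ] DeltaModel Δ M where
  toEquiv := (Equiv.sumCongr g (Equiv.refl (C.Pts M)) : Q.Pts M ⊕ C.Pts M ≃ Q.Pts M ⊕ C.Pts M)
  map_fun' f := f.elim
  map_rel' {n} r x := by
    have key : ∀ (s : QC) (z : (s.set Q C).Pts M),
        Equiv.sumCongr g (Equiv.refl (C.Pts M)) (DeltaModel.incl Δ M s z) =
          DeltaModel.incl Δ M s (QC.act Q C M g s z) := by
      intro s z
      cases s <;> rfl
    have hinj : Function.Injective (Equiv.sumCongr g (Equiv.refl (C.Pts M))) := Equiv.injective _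
    rcases r with s | ⟨R, h⟩
    · constructor
      · rintro ⟨z, hz⟩
        refine ⟨(QC.act Q C M g s).symm z, hinj (hz.trans ?_)⟩
        rw [key, Equiv.apply_symm_apply]
      · rintro ⟨z, hz⟩
        exact ⟨QC.act Q C M g s z, (congrArg _ hz).trans (key s z)⟩
    · have hR : ∀ z : ∀ i, ((R.slot i).set Q C).Pts M,
          R.Holds M (fun i => QC.act Q C M g (R.slot i) (z i)) ↔ R.Holds M z := by
        intro z
        rcases h with h | h
        · exact hg R h z
        · have : (fun i => QC.act Q C M g (R.slot i) (z i)) = z := by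
            funext i
            have h1 : ∀ (s : QC) (y : (s.set Q C).Pts M), s = QC.c → QC.act Q C M g s y = y := by
              rintro _ y rfl
              rfl
            exact h1 _ _ (h i)
          rw [this]
      constructor
      · rintro ⟨z, hz, hz'⟩
        refine ⟨fun i => (QC.act Q C M g (R.slot i)).symm (z i), fun i => hinj ((hz i).trans ?_), ?_⟩
        · rw [key, Equiv.apply_symm_apply]
        · rw [← hR]
          simpa using hz'
      · rintro ⟨z, hz, hz'⟩
        exact ⟨fun i => QC.act Q C M g (R.slot i) (z i), fun i =>
          (congrArg _ (hz i)).trans (key _ _), (hR z).2 hz'⟩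

/-- Elements of `G(M)` extend to `X(M_Δ)`, since they give automorphisms of `M_Δ`. -/
theorem exists_deltaPreserves {T : L.Theory} {X Y : EqSet (deltaLang Δ)}
    {f : Rel₃ (deltaSort Δ .q) X Y}
    (h : IsInternal (deltaTheory T Δ) (deltaSort Δ .q) (deltaSort Δ .c) X Y f) (M : Model T)
    {g : Equiv.Perm (Q.Pts M)} (hg : g ∈ autOver Δ M) : ∃ τ, DeltaPreserves M f g τ := by
  by_cases hM : Nonempty (DeltaModel Δ M)
  · let σ : deltaModel Δ M ≃[deltaLang Δ] deltaModel Δ M := deltaAut hg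
    refine ⟨X.perm σ, fun q q₁ q₂ h₁ h₂ x y => ?_⟩
    have hσ : ∀ c, (deltaSort Δ .c).perm σ c = c := by
      intro c
      obtain ⟨c, rfl⟩ := (deltaPt_bijective (Δ := Δ) (M := M) .c).2 c
      exact ((rep_deltaPt (Δ := Δ) (M := M)).2 rfl : (deltaSort Δ .c).Rep _ _).perm σ |>.unique
        (rep_deltaPt.2 rfl)
    have h3 := h.holds_perm_iff (M := deltaModel Δ M) σ hσ q₁ x y
    have h4 : (deltaSort Δ .q).perm σ q₁ = q₂ := (EqSet.Rep.perm (M := deltaModel Δ M) h₁ σ).unique h₂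
    rw [h4] at h3
    exact h3
  · exact ⟨1, fun q => (hM ⟨DeltaModel.incl Δ M .q q⟩).elim⟩

end Delta

/-! ### Types over `C` -/

/-- A formula contains only finitely many of its variables. -/
theorem exists_finite_support {α : Type*} (φ : L.Formula α) :
    ∃ (s : Finset α) (φ' : L.Formula s), ∀ (M : Type w) [L.Structure M] (v : α → M),
      φ.Realize v ↔ φ'.Realize (fun i => v i) := by
  classical
  refine ⟨Language.BoundedFormula.freeVarFinset φ,
    Language.BoundedFormula.restrictFreeVar φ id, fun M _ v => ?_⟩
  exact (Language.BoundedFormula.realize_restrictFreeVar' (φ := φ) (s := ↑φ.freeVarFinset)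
    (Set.Subset.refl _) (v := v)).symm

theorem DVar.inl {J : Type*} {N : J → Type w} [∀ j, L.Structure (N j)] {ι κ : Type*}
    {S : ι → EqSet L} {S' : κ → EqSet L} {Z : EqSet L}
    {t : ∀ j, (∀ i, (S i).Pts (N j)) → Z.Pts (N j)} (h : DVar N S t) :
    DVar N (Sum.elim S S') (fun j x => t j fun i => x (.inl i)) := by
  obtain ⟨σ, hσ⟩ := h
  exact ⟨fun k => ⟨.inl (σ k).1, (σ k).2⟩, fun j a x hx => hσ j (fun i => a (.inl i)) _
    fun i => hx (.inl i)⟩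

/-- The concatenation of two tuples of points. -/
def join {ι κ : Type*} {S : ι → EqSet L} {Z : κ → EqSet L} {M : Type w} [L.Structure M]
    (x : ∀ i, (S i).Pts M) (d : ∀ k, (Z k).Pts M) : ∀ i, (Sum.elim S Z i).Pts M
  | .inl i => x i
  | .inr k => d k

/-- A definable family of subsets of a power `C^K`, whose parameters are the tuples of points of the
definable sets `S i`. -/
structure CRel (T : L.Theory) (C : EqSet L) {ι : Type*} (S : ι → EqSet L) where
  K : Type
  fin : Finite K
  R : ∀ M : Model T, (∀ i, (S i).Pts M) → (K → C.Pts M) → Prop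
  defOn : DefOn (carriers T) (Sum.elim S (fun _ : K => C))
    (fun M x => R M (fun i => x (.inl i)) (fun k => x (.inr k)))

attribute [instance] CRel.fin

section CEq

variable {T : L.Theory} {C : EqSet L} {ι κ : Type*} {S : ι → EqSet L} {Z : κ → EqSet L}
  {M : Model T}

/-- The two tuples are parameters of the same set. -/
def CRel.Same (r : CRel T C S) {M : Model T} (v v' : ∀ i, (S i).Pts M) : Prop :=
  ∀ z, r.R M v z ↔ r.R M v' z

variable (C) in
/-- The two tuples have the same type over the set of all points of `C`. -/
def CEq (v v' : ∀ i, (S i).Pts M) : Prop := ∀ r : CRel T C S, r.Same v v'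

theorem CRel.Same.symm {r : CRel T C S} {v v' : ∀ i, (S i).Pts M} (h : r.Same v v') :
    r.Same v' v := fun z => (h z).symm

theorem CRel.Same.trans {r : CRel T C S} {v v' v'' : ∀ i, (S i).Pts M} (h : r.Same v v')
    (h' : r.Same v' v'') : r.Same v v'' := fun z => (h z).trans (h' z)

theorem CEq.symm {v v' : ∀ i, (S i).Pts M} (h : CEq C v v') : CEq C v' v := fun r => (h r).symm

theorem CEq.trans {v v' v'' : ∀ i, (S i).Pts M} (h : CEq C v v') (h' : CEq C v' v'') :
    CEq C v v'' := fun r => (h r).trans (h' r)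

/-- Parameters may be obtained from another tuple by a choice of entries. -/
def CRel.comap (r : CRel T C Z) (t : ∀ k, ∀ M : Model T, (∀ i, (S i).Pts M) → (Z k).Pts M)
    (ht : ∀ k, DVar (carriers T) S (t k)) : CRel T C S where
  K := r.K
  fin := r.fin
  R M v z := r.R M (fun k => t k M v) z
  defOn := r.defOn.subst (S := Sum.elim S (fun _ : r.K => C)) (t := fun k => match k with
      | .inl k => fun _ x => t k _ fun i => x (.inl i)
      | .inr k => fun _ x => x (.inr k)) fun k => by
    rcases k with k | k
    exacts [(ht k).inl, .var _]

theorem CEq.comap {v v' : ∀ i, (S i).Pts M} (h : CEq C v v')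
    (t : ∀ k, ∀ M : Model T, (∀ i, (S i).Pts M) → (Z k).Pts M)
    (ht : ∀ k, DVar (carriers T) S (t k)) : CEq C (fun k => t k M v) (fun k => t k M v') :=
  fun r => h (r.comap t ht)

/-- The type over `C` contains the relations between the tuple and finitely many points of `C`. -/
theorem CEq.iff_of_points {v v' : ∀ i, (S i).Pts M} (h : CEq C v v') {K : Type} [Finite K]
    {R : ∀ M : Model T, (∀ i, (S i).Pts M) → (K → C.Pts M) → Prop}
    (hR : DefOn (carriers T) (Sum.elim S (fun _ : K => C))
      (fun M x => R M (fun i => x (.inl i)) (fun k => x (.inr k)))) (z : K → C.Pts M) :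
    R M v z ↔ R M v' z := h ⟨K, inferInstance, R, hR⟩ z

/-- A definable relation, regarded as a family of subsets of the one-point set `C^0`. -/
def CRel.ofDef {R : ∀ M : Model T, (∀ i, (S i).Pts M) → Prop}
    (hR : DefOn (carriers T) S R) : CRel T C S where
  K := Empty
  fin := inferInstance
  R M v _ := R M v
  defOn := hR.subst (S := Sum.elim S (fun _ : Empty => C)) (t := fun k _ x => x (.inl k))
    fun _ => .var _

/-- Tuples of the same type over `C` satisfy the same definable relations. -/
theorem CEq.iff {v v' : ∀ i, (S i).Pts M} (h : CEq C v v')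
    {R : ∀ M : Model T, (∀ i, (S i).Pts M) → Prop} (hR : DefOn (carriers T) S R) :
    R M v ↔ R M v' := h (CRel.ofDef hR) Empty.elim

theorem CRel.defOn_same (r : CRel T C S) : DefOn (carriers T) (Sum.elim S S)
    (fun _ x => r.Same (fun i => x (.inl i)) (fun i => x (.inr i))) := by
  refine DefOn.allFam (DefOn.iff ?_ ?_)
  · exact r.defOn.subst (S := Sum.elim (Sum.elim S S) (fun _ : r.K => C)) (t := fun k => match k with
      | .inl k => fun _ x => x (.inl (.inl k))
      | .inr k => fun _ x => x (.inr k)) fun k => by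
        rcases k with k | k
        exacts [.var _, .var _]
  · exact r.defOn.subst (S := Sum.elim (Sum.elim S S) (fun _ : r.K => C)) (t := fun k => match k with
      | .inl k => fun _ x => x (.inl (.inr k))
      | .inr k => fun _ x => x (.inr k)) fun k => by
        rcases k with k | k
        exacts [.var _, .var _]

theorem CRel.same_map_iff (r : CRel T C S) {M' : Model T} (e : M ↪ₑ[L] M')
    (v v' : ∀ i, (S i).Pts M) :
    r.Same (fun i => (S i).map e (v i)) (fun i => (S i).map e (v' i)) ↔ r.Same v v' :=
  Iff.trans (iff_of_eq rfl) (r.defOn_same.map_iff (j := M) (j' := M') e (join v v'))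

theorem CEq.map {v v' : ∀ i, (S i).Pts M} (h : CEq C v v') {M' : Model T} (e : M ↪ₑ[L] M') :
    CEq C (fun i => (S i).map e (v i)) (fun i => (S i).map e (v' i)) :=
  fun r => (r.same_map_iff e v v').2 (h r)

/-- A definable family depends on finitely many of its parameters. -/
theorem CRel.exists_support (r : CRel T C S) :
    ∃ (F : Finset ι) (r' : CRel T C (fun i : F => S i)), ∀ (M : Model T) (v v' : ∀ i, (S i).Pts M),
      r'.Same (fun i => v i) (fun i => v' i) ↔ r.Same v v' := by
  classical
  obtain ⟨φ, hφ⟩ := r.defOn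
  obtain ⟨s, φ', hs⟩ := exists_finite_support.{u, v, max u v} φ
  let F : Finset ι := (s.image Sigma.fst).preimage Sum.inl Sum.inl_injective.injOn
  have hF : ∀ (i : ι) l, (⟨.inl i, l⟩ : Σ i, Fin (Sum.elim S (fun _ : r.K => C) i).arity) ∈ s →
      i ∈ F := fun i l h => Finset.mem_preimage.2 (Finset.mem_image_of_mem _ h)
  let σ : s → Σ i : F ⊕ r.K, Fin (Sum.elim (fun i : F => S i) (fun _ : r.K => C) i).arity := fun p =>
    match p with
    | ⟨⟨.inl i, l⟩, hp⟩ => ⟨.inl ⟨i, hF i l hp⟩, l⟩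
    | ⟨⟨.inr k, l⟩, _⟩ => ⟨.inr k, l⟩
  let R' : ∀ M : Model T, (∀ i : F, (S i).Pts M) → (r.K → C.Pts M) → Prop := fun M x z =>
    ∃ a : ∀ i : F ⊕ r.K, Fin (Sum.elim (fun i : F => S i) (fun _ : r.K => C) i).arity → M,
      (∀ i, EqSet.Rep _ (a i) (join (S := fun i : F => S i) (Z := fun _ : r.K => C) x z i)) ∧
      (φ'.relabel σ).Realize (fun p => a p.1 p.2)
  have hR' : DefOn (carriers T) (Sum.elim (fun i : F => S i) (fun _ : r.K => C))
      (fun M x => R' M (fun i => x (.inl i)) (fun k => x (.inr k))) := by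
    refine (DefOn.holds (φ'.relabel σ)).congr fun M x => ?_
    have : join (S := fun i : F => S i) (Z := fun _ : r.K => C) (fun i => x (.inl i))
        (fun k => x (.inr k)) = x := by
      funext i
      rcases i with i | i <;> rfl
    simp only [R', this]
  refine ⟨F, ⟨r.K, r.fin, R', hR'⟩, fun M v v' => ?_⟩
  have key : ∀ (v : ∀ i, (S i).Pts M) z, R' M (fun i => v i) z ↔ r.R M v z := by
    intro v z
    obtain ⟨b, hb⟩ := EqSet.exists_reps v
    have h1 : ∀ a : ∀ i : F ⊕ r.K, Fin (Sum.elim (fun i : F => S i) (fun _ : r.K => C) i).arity → M,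
        (∀ i, EqSet.Rep _ (a i) (join (S := fun i : F => S i) (Z := fun _ : r.K => C)
          (fun i => v i) z i)) → ((φ'.relabel σ).Realize (fun p => a p.1 p.2) ↔ r.R M v z) := by
      intro a ha
      let a₁ : ∀ i, Fin (S i).arity → M := fun i => if h : i ∈ F then a (.inl ⟨i, h⟩) else b i
      have ha₁ : ∀ i (h : i ∈ F), a₁ i = a (.inl ⟨i, h⟩) := fun i h => dif_pos h
      have hr₁ : ∀ i, (S i).Rep (a₁ i) (v i) := by
        intro i
        by_cases h : i ∈ F
        · exact (ha₁ i h).symm ▸ ha (.inl ⟨i, h⟩)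
        · rw [show a₁ i = b i from dif_neg h]
          exact hb i
      let a' : ∀ i : ι ⊕ r.K, Fin (Sum.elim S (fun _ : r.K => C) i).arity → M := fun i => match i with
        | .inl i => a₁ i
        | .inr k => a (.inr k)
      have ha' : ∀ i, EqSet.Rep _ (a' i) (join v z i) := by
        rintro (i | k)
        exacts [hr₁ i, ha (.inr k)]
      refine Language.Formula.realize_relabel.trans (Iff.trans ?_
        ((hs M fun p => a' p.1 p.2).symm.trans (hφ M a' (join v z) ha')))
      refine realize_congr _ fun p => ?_
      rcases p with ⟨⟨i | k, l⟩, hp⟩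
      · exact (congrFun (ha₁ i (hF i l hp)) l).symm
      · rfl
    constructor
    · rintro ⟨a, ha, h⟩
      exact (h1 a ha).1 h
    · intro h
      obtain ⟨a, ha⟩ := EqSet.exists_reps (S := Sum.elim (fun i : F => S i) (fun _ : r.K => C))
        (join (S := fun i : F => S i) (fun i => v i) z)
      exact ⟨a, ha, (h1 a ha).2 h⟩
  exact forall_congr' fun z => iff_congr (key v z) (key v' z)

/-- Having the same type over `C` is a property of finite character. -/
theorem ceq_of_finset {v v' : ∀ i, (S i).Pts M}
    (h : ∀ F : Finset ι, CEq C (fun i : F => v i) (fun i : F => v' i)) : CEq C v v' := by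
  intro r
  obtain ⟨F, r', hr'⟩ := r.exists_support
  exact (hr' M v v').1 (h F r')

/-- By stable embeddedness, the members of a definable family of subsets of `C^K` are members of
finitely many definable families with parameters in `C`. -/
theorem StablyEmbedded.exists_fibres (hC : StablyEmbedded T C) (r : CRel T C S) :
    ∃ (m : ℕ) (k : Fin m → ℕ) (ψ : ∀ j, ∀ M : Model T, (Fin (k j) → C.Pts M) → (r.K → C.Pts M) → Prop),
      (∀ j, DefOn (carriers T) (Sum.elim (fun _ : Fin (k j) => C) (fun _ : r.K => C))
        (fun M x => ψ j M (fun i => x (.inl i)) (fun i => x (.inr i)))) ∧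
      ∀ (M : Model T) v, ∃ (j : Fin m) (e : Fin (k j) → C.Pts M), ∀ z, r.R M v z ↔ ψ j M e z := by
  classical
  obtain ⟨φ, hφ⟩ := r.defOn
  obtain ⟨s, φ', hs⟩ := exists_finite_support.{u, v, max u v} φ
  obtain ⟨n, ⟨en⟩⟩ := Finite.exists_equiv_fin r.K
  let em := s.equivFin
  let φ'' : L.Formula (Fin s.card ⊕ (Fin n × Fin C.arity)) := φ'.relabel fun p =>
    match p with
    | ⟨⟨.inl i, l⟩, hp⟩ => .inl (em ⟨⟨.inl i, l⟩, hp⟩)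
    | ⟨⟨.inr k, l⟩, _⟩ => .inr (en k, l)
  obtain ⟨m, k, ψ, hψ⟩ := hC s.card n φ''
  let ψ' : ∀ j, L.Formula (Σ i, Fin (Sum.elim (fun _ : Fin (k j) => C) (fun _ : r.K => C) i).arity) :=
    fun j => (ψ j).relabel fun p => match p with
      | .inl (i, l) => ⟨.inl i, l⟩
      | .inr (i, l) => ⟨.inr (en.symm i), l⟩
  refine ⟨m, k, fun j M e z => ∃ a : ∀ i, Fin (Sum.elim (fun _ : Fin (k j) => C)
      (fun _ : r.K => C) i).arity → M, (∀ i, EqSet.Rep _ (a i) (join (S := fun _ : Fin (k j) => C)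
        (Z := fun _ : r.K => C) e z i)) ∧ (ψ' j).Realize (fun p => a p.1 p.2), fun j => ?_,
      fun M v => ?_⟩
  · refine (DefOn.holds (ψ' j)).congr fun M x => ?_
    have : join (S := fun _ : Fin (k j) => C) (Z := fun _ : r.K => C) (fun i => x (.inl i))
        (fun k => x (.inr k)) = x := by
      funext i
      rcases i with i | i <;> rfl
    simp only [this]
  · obtain ⟨a, ha⟩ := EqSet.exists_reps v
    obtain ⟨j, e, he⟩ := hψ M (fun q => match em.symm q with
      | ⟨⟨.inl i, l⟩, _⟩ => a i l
      | _ => Classical.arbitrary M)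
    refine ⟨j, e, fun z => ?_⟩
    have h1 : ∀ b : r.K → Fin C.arity → M, (∀ k, C.Rep (b k) (z k)) →
        (φ''.Realize (Sum.elim (fun q => match em.symm q with
          | ⟨⟨.inl i, l⟩, _⟩ => a i l
          | _ => Classical.arbitrary M) (fun p => b (en.symm p.1) p.2)) ↔ r.R M v z) := by
      intro b hb
      let a' : ∀ i : ι ⊕ r.K, Fin (Sum.elim S (fun _ : r.K => C) i).arity → M := fun i => match i with
        | .inl i => a i
        | .inr k => b k
      have ha' : ∀ i, EqSet.Rep _ (a' i) (join v z i) := by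
        rintro (i | k)
        exacts [ha i, hb k]
      refine Language.Formula.realize_relabel.trans (Iff.trans ?_
        ((hs M fun p => a' p.1 p.2).symm.trans (hφ M a' (join v z) ha')))
      refine realize_congr _ fun p => ?_
      rcases p with ⟨⟨i | k, l⟩, hp⟩
      · simp only [Function.comp, Sum.elim_inl, Equiv.symm_apply_apply]
        rfl
      · simp only [Function.comp, Sum.elim_inr, Equiv.symm_apply_apply]
        rfl
    have h2 := he (fun i => z (en.symm i))
    constructor
    · intro h
      obtain ⟨b, hb⟩ := EqSet.exists_reps (S := fun _ : r.K => C) z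
      obtain ⟨c, d, hc, hd, h3⟩ := h2.1 ⟨fun i => b (en.symm i), fun i => hb _, (h1 b hb).2 h⟩
      refine ⟨fun i => match i with
        | .inl i => c i
        | .inr k => d (en k), ?_, Language.Formula.realize_relabel.2
          ((realize_congr _ fun p => ?_).1 h3)⟩
      · rintro (i | i)
        · exact hc i
        · have := hd (en i)
          rw [Equiv.symm_apply_apply] at this
          exact this
      · rcases p with ⟨i, l⟩ | ⟨i, l⟩
        · rfl
        · exact congrFun (congrArg d (en.apply_symm_apply i)).symm l
    · rintro ⟨c, hc, h3⟩
      obtain ⟨b, hb, h4⟩ := h2.2 ⟨fun i => c (.inl i), fun i => c (.inr (en.symm i)),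
        fun i => hc (.inl i), fun i => hc (.inr (en.symm i)), by
          refine (realize_congr _ fun p => ?_).1 (Language.Formula.realize_relabel.1 h3)
          rcases p with ⟨i, l⟩ | ⟨i, l⟩ <;> rfl⟩
      refine (h1 (fun k => b (en k)) fun k => ?_).1 ?_
      · have := hb (en k)
        rwa [Equiv.symm_apply_apply] at this
      · refine (realize_congr _ fun p => ?_).1 h4
        rcases p with p | ⟨i, l⟩
        · rfl
        · exact congrFun (congrArg b (en.apply_symm_apply i)).symm l

/-- Finite parts of a type over `C` can be carried along tuples of the same type over `C`: by stable
embeddedness, they are expressed with finitely many parameters in `C`. -/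
theorem CEq.exists_same_of_finite (hC : StablyEmbedded T C) [Finite κ] {v v' : ∀ i, (S i).Pts M}
    (h : CEq C v v') (d : ∀ k, (Z k).Pts M) {n : ℕ} (r : Fin n → CRel T C (Sum.elim S Z)) :
    ∃ d' : ∀ k, (Z k).Pts M, ∀ i, (r i).Same (join v d) (join v' d') := by
  choose m k ψ hψ hfib using fun i => hC.exists_fibres (r i)
  choose j e he using fun i => hfib i M (join v d)
  -- the existence of a suitable `d`, as a condition on `v` with the parameters `e` in `C`
  let R : ∀ M : Model T, (∀ i, (S i).Pts M) → ((Σ i, Fin (k i (j i))) → C.Pts M) → Prop :=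
    fun M x c => ∃ d : ∀ k, (Z k).Pts M, ∀ i, ∀ z : (r i).K → C.Pts M,
      (r i).R M (join x d) z ↔ ψ i (j i) M (fun l => c ⟨i, l⟩) z
  have hR : DefOn (carriers T) (Sum.elim S (fun _ : Σ i, Fin (k i (j i)) => C))
      (fun M x => R M (fun i => x (.inl i)) (fun k => x (.inr k))) := by
    refine DefOn.exFam (DefOn.finiteAll fun i => DefOn.allFam (DefOn.iff ?_ ?_))
    · refine ((r i).defOn.subst (S := Sum.elim (Sum.elim (Sum.elim S
        (fun _ : Σ i, Fin (k i (j i)) => C)) Z) (fun _ : (r i).K => C)) (t := fun k => match k with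
        | .inl (.inl k) => fun _ x => x (.inl (.inl (.inl k)))
        | .inl (.inr k) => fun _ x => x (.inl (.inr k))
        | .inr k => fun _ x => x (.inr k)) fun k => by
          rcases k with (k | k) | k
          exacts [.var _, .var _, .var _]).congr fun M x => iff_of_eq ?_
      congr 1
      funext k
      rcases k with k | k <;> rfl
    · exact (hψ i (j i)).subst (S := Sum.elim (Sum.elim (Sum.elim S
        (fun _ : Σ i, Fin (k i (j i)) => C)) Z) (fun _ : (r i).K => C)) (t := fun k => match k with
        | .inl k => fun _ x => x (.inl (.inl (.inr ⟨i, k⟩)))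
        | .inr k => fun _ x => x (.inr k)) fun k => by
          rcases k with k | k
          exacts [.var _, .var _]
  obtain ⟨d', hd'⟩ := (h.iff_of_points hR (fun p => e p.1 p.2)).1 ⟨d, he⟩
  exact ⟨d', fun i z => (he i z).trans (hd' i z).symm⟩

/-- The additional tuple may be infinite, since finitely many families involve only finitely many of its
entries. -/
theorem CEq.exists_same (hC : StablyEmbedded T C) {v v' : ∀ i, (S i).Pts M}
    (h : CEq C v v') (d : ∀ k, (Z k).Pts M) {n : ℕ} (r : Fin n → CRel T C (Sum.elim S Z)) :
    ∃ d' : ∀ k, (Z k).Pts M, ∀ i, (r i).Same (join v d) (join v' d') := by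
  classical
  choose F r' hr' using fun i => (r i).exists_support
  let A : Finset κ := Finset.univ.biUnion fun i => (F i).preimage Sum.inr Sum.inr_injective.injOn
  have hA : ∀ i k, .inr k ∈ F i → k ∈ A := fun i k hk =>
    Finset.mem_biUnion.2 ⟨i, Finset.mem_univ i, Finset.mem_preimage.2 hk⟩
  let t : ∀ i, ∀ p : F i, ∀ M : Model T, (∀ i, (Sum.elim S (fun k : A => Z k) i).Pts M) →
      (Sum.elim S Z p).Pts M := fun i p => match p with
    | ⟨.inl k, _⟩ => fun _ x => x (.inl k)
    | ⟨.inr k, hk⟩ => fun _ x => x (.inr ⟨k, hA i k hk⟩)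
  have ht : ∀ i p, DVar (carriers T) (Sum.elim S (fun k : A => Z k)) (t i p) := by
    rintro i ⟨k | k, hk⟩
    exacts [.var _, .var _]
  obtain ⟨d', hd'⟩ := h.exists_same_of_finite hC (Z := fun k : A => Z k) (fun k => d k)
    fun i => (r' i).comap (t i) (ht i)
  let d₁ : ∀ k, (Z k).Pts M := fun k => if hk : k ∈ A then d' ⟨k, hk⟩ else d k
  have hd₁ : ∀ k (hk : k ∈ A), d₁ k = d' ⟨k, hk⟩ := fun k hk => dif_pos hk
  refine ⟨d₁, fun i => (hr' i M _ _).1 fun z => ?_⟩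
  have key : ∀ (v : ∀ i, (S i).Pts M) (c : ∀ k, (Z k).Pts M) (c' : ∀ k : A, (Z k).Pts M),
      (∀ k (hk : k ∈ A), c k = c' ⟨k, hk⟩) →
      (fun p : F i => join v c p) = fun p => t i p M (join v c') := by
    intro v c c' hc
    funext p
    rcases p with ⟨k | k, hk⟩
    exacts [rfl, hc k _]
  rw [key v d (fun k => d k) fun _ _ => rfl, key v' d₁ d' hd₁]
  exact hd' i z

end CEq

/-! ### Separating families -/

section Sep

variable {T : L.Theory} {Q C W : EqSet L}

/-- Finitely many definable families of subsets of powers of `C`, whose parameters are a point of `Q`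
and `n` points of `W`. -/
structure SepData (T : L.Theory) (Q C W : EqSet L) where
  n : ℕ
  m : ℕ
  r : Fin m → CRel T C (Sum.elim (fun _ : Unit => Q) (fun _ : Fin n => W))

/-- With the parameters `b`, the families separate the points of `Q`. -/
def SepData.Sep (D : SepData T Q C W) {M : Model T} (b : Fin D.n → W.Pts M) : Prop :=
  ∀ q q' : Q.Pts M, (∀ i, (D.r i).Same (join (S := fun _ : Unit => Q) (fun _ => q) b)
    (join (S := fun _ : Unit => Q) (fun _ => q') b)) → q = q'

variable (T Q C W) in
/-- The points of `Q(M)` are separated by finitely many definable families of subsets of powers of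
`C`, with finitely many parameters in `W`. -/
def Separated (M : Model T) : Prop := ∃ (D : SepData T Q C W) (b : Fin D.n → W.Pts M), D.Sep b

/-- If `Q` cannot be separated, then there are distinct points of `Q` that are indistinguishable for
given finitely many families. -/
theorem exists_ne_same {M : Model T} (h : ¬ Separated T Q C W M) {ι : Type*} (v : ι → W.Pts M)
    {m : ℕ} (r : Fin m → CRel T C (Sum.elim (fun _ : Unit => Q) (fun _ : ι => W))) :
    ∃ q q' : Q.Pts M, q ≠ q' ∧ ∀ i, (r i).Same (join (S := fun _ : Unit => Q) (fun _ => q) v)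
      (join (S := fun _ : Unit => Q) (fun _ => q') v) := by
  classical
  choose F r' hr' using fun i => (r i).exists_support
  let A : Finset ι := Finset.univ.biUnion fun i => (F i).preimage Sum.inr Sum.inr_injective.injOn
  have hA : ∀ i k, .inr k ∈ F i → k ∈ A := fun i k hk =>
    Finset.mem_biUnion.2 ⟨i, Finset.mem_univ i, Finset.mem_preimage.2 hk⟩
  let e := A.equivFin
  let t : ∀ i, ∀ p : F i, ∀ M : Model T,
      (∀ i, (Sum.elim (fun _ : Unit => Q) (fun _ : Fin A.card => W) i).Pts M) →
      (Sum.elim (fun _ : Unit => Q) (fun _ : ι => W) p).Pts M := fun i p => match p with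
    | ⟨.inl k, _⟩ => fun _ x => x (.inl k)
    | ⟨.inr k, hk⟩ => fun _ x => x (.inr (e ⟨k, hA i k hk⟩))
  have ht : ∀ i p, DVar (carriers T) (Sum.elim (fun _ : Unit => Q) (fun _ : Fin A.card => W))
      (t i p) := by
    rintro i ⟨k | k, hk⟩
    exacts [.var _, .var _]
  by_contra! hcon
  refine h ⟨⟨A.card, m, fun i => (r' i).comap (t i) (ht i)⟩, fun k => v (e.symm k),
    fun q q' hqq' => ?_⟩
  by_contra hne
  obtain ⟨i, hi⟩ := hcon q q' hne
  refine hi ((hr' i M _ _).1 fun z => ?_)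
  have key : ∀ q : Q.Pts M, (fun p : F i => join (S := fun _ : Unit => Q) (fun _ => q) v p) =
      fun p => t i p M (join (S := fun _ : Unit => Q) (fun _ => q) fun k => v (e.symm k)) := by
    intro q
    funext p
    rcases p with ⟨k | k, hk⟩
    · rfl
    · simp only [t, join, Equiv.symm_apply_apply]
      rfl
  rw [key, key]
  exact hqq' i z

theorem SepData.defOn_sep (D : SepData T Q C W) :
    DefOn (carriers T) (fun _ : Fin D.n => W) (fun _ b => D.Sep b) := by
  refine DefOn.all (DefOn.all (DefOn.imp (DefOn.finiteAll fun i => ?_) (DefOn.eq (.var _) (.var _))))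
  refine ((D.r i).defOn_same.subst (S := Sum.elim (Sum.elim (fun _ : Fin D.n => W)
    (fun _ : Unit => Q)) (fun _ : Unit => Q)) (t := fun k => match k with
    | .inl (.inl _) => fun _ x => x (.inl (.inr ()))
    | .inl (.inr k) => fun _ x => x (.inl (.inl k))
    | .inr (.inl _) => fun _ x => x (.inr ())
    | .inr (.inr k) => fun _ x => x (.inl (.inl k))) fun k => ?_).congr fun M x => iff_of_eq ?_
  · rcases k with (k | k) | (k | k)
    exacts [.var _, .var _, .var _, .var _]
  · congr 1 <;> funext k <;> rcases k with k | k <;> rfl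

/-! ### Internality from separating families -/

/-- A set covered by finitely many definable families of at most one point with parameters in `C` is
in `C^eq`. -/
theorem InEq.of_finite {Y : EqSet L} {J : Type} [Finite J] (K : J → Type) [∀ j, Finite (K j)]
    (R : ∀ j, ∀ M : Model T, (K j → C.Pts M) → Y.Pts M → Prop)
    (hR : ∀ j, DefOn (carriers T) (Sum.elim (fun _ : K j => C) (fun _ : Unit => Y))
      (fun M x => R j M (fun i => x (.inl i)) (x (.inr ()))))
    (h₁ : ∀ (j) (M : Model T) (c : K j → C.Pts M) y y', R j M c y → R j M c y' → y = y')
    (h₂ : ∀ (M : Model T) (y : Y.Pts M), ∃ j c, R j M c y) : InEq T C Y := by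
  obtain ⟨n, ⟨e⟩⟩ := Finite.exists_equiv_fin J
  choose k hk using fun j => Finite.exists_equiv_fin (K j)
  let ek : ∀ j, K j ≃ Fin (k j) := fun j => (hk j).some
  choose ρ hρ using fun j => DefOn.exists_relPow (N := carriers T) (C := C) (Y := Y) (k := k j)
    (R := fun M x y => R j M (fun i => x (ek j i)) y)
    ((hR j).subst (S := Sum.elim (fun _ : Fin (k j) => C) (fun _ : Unit => Y)) (t := fun i => match i with
      | .inl i => fun _ x => x (.inl (ek j i))
      | .inr _ => fun _ x => x (.inr ())) fun i => by
        rcases i with i | i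
        exacts [.var _, .var _])
  refine ⟨n, fun j => k (e.symm j), fun j => ρ (e.symm j), fun M => ⟨fun j c y y' h h' => ?_,
    fun y => ?_⟩⟩
  · exact h₁ _ _ _ _ _ ((hρ _ M _ _).1 h) ((hρ _ M _ _).1 h')
  · obtain ⟨j, c, h⟩ := h₂ M y
    obtain ⟨j, rfl⟩ := e.symm.surjective j
    refine ⟨j, fun i => c ((ek _).symm i), (hρ _ M _ _).2 ?_⟩
    simpa using h

/-- The universe of a model, as a definable set: an element, viewed as a parameter, defines its own
singleton. -/
noncomputable def home (L : FirstOrder.Language.{u, v}) : EqSet L where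
  arity := 1
  dom := ⊤
  aux := 1
  fam := Language.Term.equal (Language.Term.var (Sum.inl 0)) (Language.Term.var (Sum.inr 0))

section Home

variable {M : Type w} [L.Structure M]

theorem home_rep_iff {a b : Fin 1 → M} {x : (home L).Pts M} (h : (home L).Rep a x) :
    (home L).Rep b x ↔ b = a := by
  constructor
  · intro h'
    have h1 := (h.eq_iff h').1 rfl a
    simp only [home, Language.Formula.realize_equal, Language.Term.realize_var,
      Sum.elim_inl, Sum.elim_inr, true_iff] at h1
    funext i
    rw [Subsingleton.elim i 0]
    exact h1
  · rintro rfl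
    exact h

theorem exists_home_rep (m : M) : ∃ x : (home L).Pts M, (home L).Rep (fun _ => m) x :=
  EqSet.exists_rep_of_dom (by simp [home])

/-- The points of `home` are the elements of the model. -/
noncomputable def homeEquiv : M ≃ (home L).Pts M :=
  Equiv.ofBijective (fun m => (exists_home_rep m).choose) (by
    have hc : ∀ m : M, (home L).Rep (fun _ => m) (exists_home_rep (L := L) m).choose := fun m =>
      (exists_home_rep m).choose_spec
    refine ⟨fun m n h => ?_, fun x => ?_⟩
    · have h1 := hc m
      simp only at h
      rw [h] at h1
      exact congrFun ((home_rep_iff (hc n)).1 h1) (0 : Fin 1)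
    · obtain ⟨a, ha⟩ := EqSet.exists_rep x
      refine ⟨a (0 : Fin 1), (hc _).unique ?_⟩
      convert ha using 1
      funext i
      exact congrArg a (Subsingleton.elim (α := Fin 1) _ _))

theorem rep_homeEquiv (m : M) : (home L).Rep (fun _ => m) (homeEquiv (L := L) m) :=
  (exists_home_rep m).choose_spec

theorem homeEquiv_symm_of_rep {a : Fin 1 → M} {x : (home L).Pts M} (h : (home L).Rep a x) :
    (homeEquiv (L := L)).symm x = a 0 := by
  obtain ⟨m, rfl⟩ := (homeEquiv (L := L)).surjective x
  rw [Equiv.symm_apply_apply, (home_rep_iff (rep_homeEquiv m)).1 h]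

end Home

/-- Being a representative of a point is a definable relation between the entries of the tuple, as points
of `home`, and the point. -/
theorem DefOn.rep {J : Type*} {N : J → Type w} [∀ j, L.Structure (N j)] {ι : Type*}
    {S : ι → EqSet L} {t : Fin W.arity → ∀ j, (∀ i, (S i).Pts (N j)) → (home L).Pts (N j)}
    {s : ∀ j, (∀ i, (S i).Pts (N j)) → W.Pts (N j)} (ht : ∀ l, DVar N S (t l)) (hs : DVar N S s) :
    DefOn N S (fun j x => W.Rep (fun l => homeEquiv.symm (t l j x)) (s j x)) := by
  have h1 : DefOn N (Sum.elim (fun _ : Fin W.arity => home L) (fun _ : Unit => W))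
      (fun j x => W.Rep (fun l => homeEquiv.symm (x (.inl l))) (x (.inr ()))) := by
    have hraw : RawDef (L := L) N (fun j (v : (Σ i, Fin (Sum.elim (fun _ : Fin W.arity => home L)
        (fun _ : Unit => W) i).arity) → N j) => W.dom.Realize (fun l => v ⟨.inl l, (0 : Fin 1)⟩) ∧
        W.eqForm.Realize (Sum.elim (fun l => v ⟨.inl l, (0 : Fin 1)⟩) (fun l => v ⟨.inr (), l⟩))) := by
      refine RawDef.and ((RawDef.formula W.dom).comap fun l => (⟨.inl l, (0 : Fin 1)⟩ :
          Σ i, Fin (Sum.elim (fun _ : Fin W.arity => home L) (fun _ : Unit => W) i).arity))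
        (((RawDef.formula W.eqForm).comap fun p => show
            Σ i, Fin (Sum.elim (fun _ : Fin W.arity => home L) (fun _ : Unit => W) i).arity from
          match p with
          | .inl l => ⟨.inl l, (0 : Fin 1)⟩
          | .inr l => ⟨.inr (), l⟩).congr fun j v => realize_congr _ fun p => ?_)
      rcases p with l | l <;> rfl
    refine DefOn.of_rawDef hraw fun j a x hx => ?_
    have ha : (fun l => homeEquiv.symm (x (.inl l))) = fun l => a (.inl l) (0 : Fin 1) :=
      funext fun l => homeEquiv_symm_of_rep (hx (.inl l))
    rw [ha]
    constructor
    · rintro ⟨hd, he⟩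
      obtain ⟨y, hy⟩ := EqSet.exists_rep_of_dom hd
      rwa [← (hy.realize_eqForm (hx (.inr ()))).1 he]
    · intro h
      exact ⟨h.dom, (h.realize_eqForm (hx (.inr ()))).2 rfl⟩
  exact h1.subst (t := fun k => match k with
    | .inl l => t l
    | .inr _ => s) fun k => by
      rcases k with k | k
      exacts [ht k, hs]

/-- If finitely many definable families separate the points of `Q`, then `Q` is internal to `C`: a
point of `Q` is mapped to the members of the families that it defines together with the additional
parameters, and stable embeddedness puts these sets into `C^eq`. -/
theorem SepData.exists_isInternal (hC : StablyEmbedded T C) (D : SepData T Q C W)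
    (hD : ∀ M : Model T, Nonempty (Q.Pts M) → ∃ b : Fin D.n → W.Pts M, D.Sep b) :
    ∃ (X Y : EqSet L) (f : Rel₃ Q X Y), IsInternal T Q C X Y f ∧
      ∀ (M : Model T) (p : Equiv.Perm (Q.Pts M)) (P : Equiv.Perm (W.Pts M)),
        (∀ i (q : Q.Pts M) (b : Fin D.n → W.Pts M) z,
          (D.r i).R M (join (S := fun _ : Unit => Q) (fun _ => p q) fun k => P (b k)) z ↔
          (D.r i).R M (join (S := fun _ : Unit => Q) (fun _ => q) b) z) →
        ∃ τ, (p, τ) ∈ intGroup f M := by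
  let S : Unit ⊕ Fin D.n → EqSet L := Sum.elim (fun _ => Q) (fun _ => W)
  let pt : ∀ M : Model T, Q.Pts M → (Fin D.n → W.Pts M) → ∀ i, (S i).Pts M := fun M q b =>
    join (S := fun _ : Unit => Q) (fun _ => q) b
  -- a point of `Y` is the sequence of subsets of powers of `C` defined by a point of `Q` and parameters
  let E : ∀ M : Model T, (∀ i, (S i).Pts M) → (∀ i, (S i).Pts M) → Prop := fun M y y' =>
    ∀ i, (D.r i).Same y y'
  obtain ⟨Y, mkY, hmkY, hmkY', hmkYdef⟩ := exists_quotient (N := carriers T) (S := S)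
    (D := fun _ _ => True) DefOn.true (E := E) (DefOn.finiteAll fun i => (D.r i).defOn_same)
    fun M => ⟨fun _ _ _ => Iff.rfl, fun h i => (h i).symm, fun h h' i => (h i).trans (h' i)⟩
  let my : ∀ M : Model T, Q.Pts M → (Fin D.n → W.Pts M) → Y.Pts M := fun M q b =>
    mkY M ⟨pt M q b, trivial⟩
  have hmy : ∀ (M : Model T) q b q' b', my M q b = my M q' b' ↔
      ∀ i, (D.r i).Same (pt M q b) (pt M q' b') := fun M q b q' b' => hmkY' M _ _
  -- tuples of elements representing parameters that separate the points of `Q`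
  let SX : Fin D.n × Fin W.arity → EqSet L := fun _ => home L
  let Rp : ∀ M : Model T, (∀ i, (SX i).Pts M) → (Fin D.n → W.Pts M) → Prop := fun M a b =>
    ∀ k, W.Rep (fun l => homeEquiv.symm (a (k, l))) (b k)
  have hRp : ∀ (M : Model T) b, ∃ a, Rp M a b := by
    intro M b
    obtain ⟨a, ha⟩ := EqSet.exists_reps b
    refine ⟨fun p => homeEquiv (a p.1 p.2), fun k => ?_⟩
    simpa using ha k
  have hRpu : ∀ (M : Model T) a b b', Rp M a b → Rp M a b' → b = b' := fun M a b b' h h' =>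
    funext fun k => (h k).unique (h' k)
  -- as `X(M)` must not be empty, all tuples are admitted if `Q(M)` is empty
  let DX : ∀ M : Model T, (∀ i, (SX i).Pts M) → Prop := fun M a =>
    (∀ q : Q.Pts M, ¬ q = q) ∨ ∃ b : Fin D.n → W.Pts M, Rp M a b ∧ D.Sep b
  -- `∃ _ : True` matches the form in which `exists_quotient` states the definability of quotient maps
  let EX : ∀ M : Model T, (∀ i, (SX i).Pts M) → (∀ i, (SX i).Pts M) → Prop := fun M a a' =>
    ∀ (q : Q.Pts M) (b b' : Fin D.n → W.Pts M), Rp M a b → Rp M a' b' →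
      ∃ _ : True, my M q b = my M q b'
  have hmydef : ∀ {ι : Type} {S' : ι → EqSet L}
      {t t' : ∀ M : Model T, (∀ i, (S' i).Pts M) → Q.Pts M}
      {s s' : Fin D.n → ∀ M : Model T, (∀ i, (S' i).Pts M) → W.Pts M},
      DVar (carriers T) S' t → DVar (carriers T) S' t' →
      (∀ k, DVar (carriers T) S' (s k)) → (∀ k, DVar (carriers T) S' (s' k)) →
      DefOn (carriers T) S' (fun M x => ∃ _ : True,
        my M (t M x) (fun k => s k M x) = my M (t' M x) (fun k => s' k M x)) := by
    intro ι S' t t' s s' ht ht' hs hs'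
    have h1 := DefOn.finiteAll fun i => (D.r i).defOn_same
    refine (h1.subst (S := S') (t := fun k => match k with
      | .inl (.inl _) => t
      | .inl (.inr k) => s k
      | .inr (.inl _) => t'
      | .inr (.inr k) => s' k) fun k => ?_).congr fun M x => ?_
    · rcases k with (k | k) | (k | k)
      exacts [ht, hs k, ht', hs' k]
    · refine Iff.trans ?_ ((hmy M _ _ _ _).symm.trans ⟨fun h => ⟨trivial, h⟩, fun ⟨_, h⟩ => h⟩)
      refine forall_congr' fun i => iff_of_eq ?_
      congr 1 <;> funext k <;> rcases k with k | k <;> rfl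
  have hDX : DefOn (carriers T) SX DX := by
    refine DefOn.or (DefOn.all (DefOn.not (DefOn.eq (.var _) (.var _)))) (DefOn.exFam
      (DefOn.and (DefOn.finiteAll fun k => DefOn.rep (fun l => .var _) (.var _)) ?_))
    exact D.defOn_sep.subst (S := Sum.elim SX (fun _ : Fin D.n => W)) (t := fun k _ x => x (.inr k))
      fun k => .var _
  have hEX : DefOn (carriers T) (Sum.elim SX SX)
      (fun M x => EX M (fun i => x (.inl i)) (fun i => x (.inr i))) := by
    refine DefOn.all (DefOn.allFam (DefOn.allFam (DefOn.imp
      (DefOn.finiteAll fun k => DefOn.rep (fun l => .var _) (.var _)) (DefOn.imp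
      (DefOn.finiteAll fun k => DefOn.rep (fun l => .var _) (.var _)) ?_))))
    exact hmydef (.var _) (.var _) (fun _ => .var _) (fun _ => .var _)
  obtain ⟨X, mkX, hmkX, hmkX', hmkXdef⟩ := exists_quotient (N := carriers T) hDX hEX fun M => by
    refine ⟨fun a q b b' h h' => ⟨trivial, by rw [hRpu M _ _ _ h h']⟩, fun h q b b' hb hb' =>
      ⟨trivial, (h q b' b hb' hb).2.symm⟩, fun {a a' a''} h h' q b b'' hb hb'' => ?_⟩
    obtain h0 | ⟨b', hb', -⟩ := a'.2
    · exact (h0 q rfl).elim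
    · exact ⟨trivial, (h q b b' hb hb').2.trans (h' q b' b'' hb' hb'').2⟩
  have hX : ∀ (M : Model T) (x : X.Pts M) (_ : Q.Pts M), ∃ a b, ∃ h : DX M a, mkX M ⟨a, h⟩ = x ∧
      Rp M a b ∧ D.Sep b := by
    intro M x q
    obtain ⟨⟨a, h⟩, rfl⟩ := hmkX M x
    obtain h0 | ⟨b, hb, hb'⟩ := id h
    · exact (h0 q rfl).elim
    · exact ⟨a, b, h, rfl, hb, hb'⟩
  let F : ∀ M : Model T, Q.Pts M → X.Pts M → Y.Pts M → Prop := fun M q x y =>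
    ∃ a : ∀ i, (SX i).Pts M, (∃ h : DX M a, mkX M ⟨a, h⟩ = x) ∧ ∃ b : Fin D.n → W.Pts M,
      Rp M a b ∧ ∃ _ : True, my M q b = y
  obtain ⟨f, hf⟩ := DefOn.exists_rel₃ (N := carriers T) (X := Q) (Y := X) (Z := Y) (R := F) (by
    refine DefOn.exFam (DefOn.and ?_ (DefOn.exFam (DefOn.and
      (DefOn.finiteAll fun k => DefOn.rep (fun l => .var _) (.var _)) ?_)))
    · exact DefOn.graph (S' := Sum.elim (triple Q X Y) SX) hmkXdef (t := fun i _ x => x (Sum.inr i))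
        (r := fun _ x => x (Sum.inl (Sum.inr (Sum.inl ())))) (fun _ => .var _) (.var _)
    · refine (DefOn.graph (N := carriers T) (S := S) (D := fun _ _ => True) (mk := mkY)
        (S' := Sum.elim (Sum.elim (triple Q X Y) SX) (fun _ : Fin D.n => W)) hmkYdef
        (t := fun i => match i with
          | .inl _ => fun _ x => x (.inl (.inl (.inl ())))
          | .inr k => fun _ x => x (.inr k))
        (r := fun _ x => x (.inl (.inl (.inr (.inr ()))))) (fun i => by
          rcases i with i | i
          exacts [.var _, .var _]) (.var _)).congr fun M x => iff_of_eq ?_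
      have : ∀ (y y' : ∀ i, (S i).Pts M) z, y = y' → (∃ h : True, mkY M ⟨y, h⟩ = z) =
          ∃ h : True, mkY M ⟨y', h⟩ = z := by
        rintro y _ z rfl
        rfl
      refine this _ _ _ ?_
      funext i
      rcases i with i | i <;> rfl)
  have hF : ∀ {M : Model T} {a b} (h : DX M a), Rp M a b → ∀ q y,
      (f.Holds q (mkX M ⟨a, h⟩) y ↔ my M q b = y) := by
    intro M a b h hb q y
    refine (hf M _ _ _).trans ⟨?_, fun e => ⟨a, ⟨h, rfl⟩, b, hb, trivial, e⟩⟩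
    rintro ⟨a', ⟨h', e⟩, b', hb', -, rfl⟩
    exact ((hmkX' M _ _).1 e q b' b hb' hb).2.symm
  have hint : IsInternal T Q C X Y f := by
    refine ⟨?_, fun M => ?_, fun M q x => ?_, fun M x q q' y h h' => ?_, fun M x x' h => ?_⟩
    · choose m k ψ hψ hfib using fun i => hC.exists_fibres (D.r i)
      refine InEq.of_finite (J := ∀ i, Fin (m i)) (fun j => Σ i, Fin (k i (j i)))
        (fun j M c y => ∃ w : ∀ i, (S i).Pts M, (∃ h : True, mkY M ⟨w, h⟩ = y) ∧
          ∀ i, ∀ z : (D.r i).K → C.Pts M, (D.r i).R M w z ↔ ψ i (j i) M (fun l => c ⟨i, l⟩) z)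
        (fun j => ?_) (fun j M c y y' => ?_) fun M y => ?_
      · refine DefOn.exFam (DefOn.and ?_ (DefOn.finiteAll fun i => DefOn.allFam (DefOn.iff ?_ ?_)))
        · exact DefOn.graph (N := carriers T) (S := S) (D := fun _ _ => True) (mk := mkY)
            (S' := Sum.elim (Sum.elim (fun _ : Σ i, Fin (k i (j i)) => C)
            (fun _ : Unit => Y)) S) hmkYdef (t := fun i _ x => x (Sum.inr i))
            (r := fun _ x => x (Sum.inl (Sum.inr ()))) (fun _ => .var _) (.var _)
        · exact (D.r i).defOn.subst (S := Sum.elim (Sum.elim (Sum.elim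
            (fun _ : Σ i, Fin (k i (j i)) => C) (fun _ : Unit => Y)) S) (fun _ : (D.r i).K => C))
            (t := fun k => match k with
              | .inl k => fun _ x => x (.inl (.inr k))
              | .inr k => fun _ x => x (.inr k)) fun k => by
              rcases k with k | k
              exacts [.var _, .var _]
        · exact (hψ i (j i)).subst (S := Sum.elim (Sum.elim (Sum.elim
            (fun _ : Σ i, Fin (k i (j i)) => C) (fun _ : Unit => Y)) S) (fun _ : (D.r i).K => C))
            (t := fun k => match k with
              | .inl k => fun _ x => x (.inl (.inl (.inl ⟨i, k⟩)))
              | .inr k => fun _ x => x (.inr k)) fun k => by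
              rcases k with k | k
              exacts [.var _, .var _]
      · rintro ⟨w, ⟨_, rfl⟩, h⟩ ⟨w', ⟨_, rfl⟩, h'⟩
        exact (hmkY' M _ _).2 fun i z => (h i z).trans (h' i z).symm
      · obtain ⟨⟨w, hw⟩, rfl⟩ := hmkY M y
        choose j e he using fun i => hfib i M w
        exact ⟨j, fun p => e p.1 p.2, w, ⟨hw, rfl⟩, he⟩
    · by_cases hQ : Nonempty (Q.Pts M)
      · obtain ⟨b, hb⟩ := hD M hQ
        obtain ⟨a, ha⟩ := hRp M b
        exact ⟨mkX M ⟨a, Or.inr ⟨b, ha, hb⟩⟩⟩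
      · exact ⟨mkX M ⟨fun _ => homeEquiv (Classical.arbitrary M), Or.inl fun q => (hQ ⟨q⟩).elim⟩⟩
    · obtain ⟨a, b, h, rfl, hb, -⟩ := hX M x q
      simp only [hF h hb]
      exact ⟨_, rfl, fun y hy => hy.symm⟩
    · obtain ⟨a, b, hx, rfl, hb, hs⟩ := hX M x q
      rw [hF hx hb] at h h'
      exact hs q q' ((hmy M _ _ _ _).1 (h.trans h'.symm))
    · obtain ⟨⟨a, ha⟩, rfl⟩ := hmkX M x
      obtain ⟨⟨a', ha'⟩, rfl⟩ := hmkX M x'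
      refine (hmkX' M _ _).2 fun q b b' hb hb' => ⟨trivial, ?_⟩
      exact ((hF ha' hb' q _).1 ((h q _).1 ((hF ha hb q _).2 rfl))).symm
  refine ⟨X, Y, f, hint, fun M p P hp => ?_⟩
  have key : ∀ (p : Equiv.Perm (Q.Pts M)) (P : Equiv.Perm (W.Pts M)),
      (∀ i (q : Q.Pts M) (b : Fin D.n → W.Pts M) z,
        (D.r i).R M (pt M (p q) fun k => P (b k)) z ↔ (D.r i).R M (pt M q b) z) →
      ∀ x : X.Pts M, ∃ x' : X.Pts M, ∀ q, hint.val (p q) x' = hint.val q x := by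
    intro p P hp x
    by_cases hQ : Nonempty (Q.Pts M)
    · obtain ⟨q₀⟩ := hQ
      obtain ⟨a, b, hx, rfl, hb, hs⟩ := hX M x q₀
      have hs' : D.Sep fun k => P (b k) := by
        intro q q' h
        obtain ⟨q, rfl⟩ := p.surjective q
        obtain ⟨q', rfl⟩ := p.surjective q'
        exact congrArg p (hs q q' fun i z => (hp i q b z).symm.trans ((h i z).trans (hp i q' b z)))
      obtain ⟨a', ha'⟩ := hRp M fun k => P (b k)
      have hx' : DX M a' := Or.inr ⟨_, ha', hs'⟩
      refine ⟨mkX M ⟨a', hx'⟩, fun q => ?_⟩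
      refine ((hF hx' ha' _ _).1 (hint.holds_iff.2 rfl)).symm.trans (Eq.trans ?_
        ((hF hx hb _ _).1 (hint.holds_iff.2 rfl)))
      exact (hmy M _ _ _ _).2 fun i z => hp i q b z
    · exact ⟨x, fun q => (hQ ⟨q⟩).elim⟩
  refine hint.exists_mem_intGroup p (key p P hp) fun x' => ?_
  obtain ⟨x, hx⟩ := key p⁻¹ P⁻¹ (fun i q b z => by
    have := hp i (p⁻¹ q) (fun k => P⁻¹ (b k)) z
    have hP : ∀ w, P (P⁻¹ w) = w := P.apply_symm_apply
    have hq : p (p⁻¹ q) = q := p.apply_symm_apply q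
    simp only [hP, hq] at this
    exact this.symm) x'
  exact ⟨x, fun q => by simpa using (hx (p q)).symm⟩

end Sep

/-! ### Saturation -/

section Saturation

open Cardinal FirstOrder.Language

/-- A family of subsets of a finite set, any finitely many of which have a common element, has a
common element. -/
theorem exists_forall_of_finite {A R : Type*} [Finite A] (P : R → A → Prop)
    (h : ∀ F : Finset R, ∃ x, ∀ r ∈ F, P r x) : ∃ x, ∀ r, P r x := by
  classical
  have := Fintype.ofFinite A
  by_contra! hcon
  choose r hr using hcon
  obtain ⟨x, hx⟩ := h (Finset.univ.image r)
  exact hr x (hx _ (Finset.mem_image_of_mem _ (Finset.mem_univ x)))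

/-- Saturation, with the parameters given as values of the variables of formulas. -/
theorem IsSaturated.exists_realize_one {M : Type w} [L.Structure M] (hM : IsSaturated L M)
    {α R : Type*} (a : α → M) (ha : #(Set.range a) < #M) (φ : R → L.Formula (α ⊕ Unit))
    (h : ∀ F : Finset R, ∃ x : M, ∀ r ∈ F, (φ r).Realize (Sum.elim a fun _ => x)) :
    ∃ x : M, ∀ r, (φ r).Realize (Sum.elim a fun _ => x) := by
  classical
  let tr : R → L[[Set.range a]].Formula Unit := fun r => BoundedFormula.constantsVarsEquiv.symm
    ((φ r).relabel (Sum.map (Set.rangeFactorization a) id))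
  have htr : ∀ r (x : M), (tr r).Realize (fun _ => x) ↔ (φ r).Realize (Sum.elim a fun _ => x) := by
    intro r x
    refine BoundedFormula.realize_constantsVarsEquiv.symm.trans ?_
    rw [Equiv.apply_symm_apply]
    refine Formula.realize_relabel.trans (realize_congr _ fun i => ?_)
    rcases i with i | i <;> rfl
  obtain ⟨x, hx⟩ := hM _ ha (Set.range tr) fun p₀ hp₀ hfin => by
    choose g hg using hp₀
    have := hfin.to_subtype
    obtain ⟨x, hx⟩ := h (Set.finite_range fun p : p₀ => g p.2).toFinset
    refine ⟨x, fun ψ hψ => ?_⟩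
    rw [← hg hψ, htr]
    exact hx _ ((Set.Finite.mem_toFinset _).2 ⟨⟨ψ, hψ⟩, rfl⟩)
  exact ⟨x, fun r => (htr r x).1 (hx _ ⟨r, rfl⟩)⟩

/-- Saturation for types of `n`-tuples: the coordinates are found one after another. -/
theorem IsSaturated.exists_realize_fin {M : Type w} [L.Structure M] (hM : IsSaturated L M)
    [Infinite M] (n : ℕ) {α : Type*} {R : Type*} (a : α → M) (ha : #(Set.range a) < #M)
    (φ : R → L.Formula (α ⊕ Fin n))
    (h : ∀ F : Finset R, ∃ x : Fin n → M, ∀ r ∈ F, (φ r).Realize (Sum.elim a x)) :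
    ∃ x : Fin n → M, ∀ r, (φ r).Realize (Sum.elim a x) := by
  classical
  induction n generalizing α R with
  | zero =>
    refine ⟨Fin.elim0, fun r => ?_⟩
    obtain ⟨x, hx⟩ := h {r}
    have := hx r (Finset.mem_singleton_self r)
    rwa [Subsingleton.elim x Fin.elim0] at this
  | succ n ih =>
    let s : α ⊕ Fin (n + 1) → (α ⊕ Unit) ⊕ Fin n := fun i => match i with
      | .inl i => .inl (.inl i)
      | .inr i => Fin.cases (.inl (.inr ())) (fun i => .inr i) i
    have hs : ∀ (r : R) (x : M) (y : Fin n → M), ((φ r).relabel s).Realize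
        (Sum.elim (Sum.elim a fun _ => x) y) ↔ (φ r).Realize (Sum.elim a (Fin.cons x y)) := by
      intro r x y
      refine Formula.realize_relabel.trans (realize_congr _ fun i => ?_)
      rcases i with i | i
      · rfl
      · refine Fin.cases ?_ (fun i => ?_) i <;> rfl
    let χ : Finset R → L.Formula (α ⊕ Unit) := fun F =>
      Formula.iExs (Fin n) (Formula.iInf fun r : F => (φ r).relabel s)
    have hχ : ∀ F x, (χ F).Realize (Sum.elim a fun _ => x) ↔
        ∃ y : Fin n → M, ∀ r ∈ F, (φ r).Realize (Sum.elim a (Fin.cons x y)) := by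
      intro F x
      simp only [χ, Formula.realize_iExs, Formula.realize_iInf, hs, Subtype.forall]
    obtain ⟨x, hx⟩ := hM.exists_realize_one a ha χ fun F => by
      obtain ⟨y, hy⟩ := h (F.biUnion id)
      refine ⟨y 0, fun F' hF' => (hχ F' _).2 ⟨Fin.tail y, fun r hr => ?_⟩⟩
      rw [Fin.cons_self_tail]
      exact hy r (Finset.mem_biUnion.2 ⟨F', hF', hr⟩)
    have ha' : #(Set.range (Sum.elim a fun _ : Unit => x)) < #M := by
      have h1 : Set.range (Sum.elim a fun _ : Unit => x) ⊆ Set.range a ∪ {x} := by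
        rw [Set.Sum.elim_range]
        exact Set.union_subset_union_right _ (by simp)
      refine (mk_le_mk_of_subset h1).trans_lt ((mk_union_le _ _).trans_lt ?_)
      exact add_lt_of_lt (aleph0_le_mk M) ha ((mk_singleton x).trans_lt
        (one_lt_aleph0.trans_le (aleph0_le_mk M)))
    obtain ⟨y, hy⟩ := ih (Sum.elim a fun _ : Unit => x) ha' (fun r => (φ r).relabel s) fun F => by
      obtain ⟨y, hy⟩ := (hχ F x).1 (hx F)
      exact ⟨y, fun r hr => (hs r x y).2 (hy r hr)⟩
    exact ⟨Fin.cons x y, fun r => (hs r x y).1 (hy r)⟩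

theorem mk_sigma_fin_lt {c : Cardinal.{w}} (hc : ℵ₀ ≤ c) {ι : Type w} (hι : #ι < c) (n : ι → ℕ) :
    #(Σ i, Fin (n i)) < c := by
  have h1 : #(Σ i, Fin (n i)) ≤ #ι * ℵ₀ := by
    have h2 : #(ι × ℕ) = #ι * ℵ₀ := by simp
    rw [← h2]
    exact mk_le_of_injective (f := fun p : Σ i, Fin (n i) => (p.1, (p.2 : ℕ))) (by
      rintro ⟨i, k⟩ ⟨j, l⟩ h
      simp only [Prod.mk.injEq] at h
      obtain ⟨rfl, h⟩ := h
      rw [Fin.ext h])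
  by_cases hf : Finite ι
  · exact (mk_lt_aleph0 (α := Σ i, Fin (n i))).trans_le hc
  · have : Infinite ι := not_finite_iff_infinite.1 hf
    rw [mul_eq_left (aleph0_le_mk ι) (aleph0_le_mk ι) aleph0_ne_zero] at h1
    exact h1.trans_lt hι

instance EqSet.finite_pts {M : Type w} [L.Structure M] [Finite M] (X : EqSet L) : Finite (X.Pts M) :=
  inferInstanceAs (Finite (Quotient (X.setoid M)))

variable {T : L.Theory} {C : EqSet L} {M : Model T}

/-- In a saturated model, a finite tuple of points can be chosen subject to definable conditions with
few parameters, provided that this is possible for any finitely many of the conditions. -/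
theorem IsSaturated.exists_points (hM : IsSaturated L M) {ι : Type (max u v)} {κ : Type} [Finite κ]
    {S : ι → EqSet L} {Z : κ → EqSet L} (p : ∀ i, (S i).Pts M) (hι : Infinite M → #ι < #M)
    {R : Type*} {P : R → ∀ M : Model T, (∀ i, (Sum.elim S Z i).Pts M) → Prop}
    (hP : ∀ r, DefOn (carriers T) (Sum.elim S Z) (P r))
    (h : ∀ F : Finset R, ∃ d : ∀ k, (Z k).Pts M, ∀ r ∈ F, P r M (join p d)) :
    ∃ d : ∀ k, (Z k).Pts M, ∀ r, P r M (join p d) := by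
  classical
  by_cases hfin : Finite M
  · exact exists_forall_of_finite (fun r d => P r M (join p d)) h
  have hinf : Infinite M := not_finite_iff_infinite.1 hfin
  obtain ⟨n, ⟨e⟩⟩ := Finite.exists_equiv_fin (Σ k, Fin (Z k).arity)
  obtain ⟨a, ha⟩ := EqSet.exists_reps p
  choose φ hφ using hP
  let φ' : R ⊕ κ → L.Formula ((Σ i, Fin (S i).arity) ⊕ Fin n) := fun r => match r with
    | .inl r => (φ r).relabel fun q => match q with
      | ⟨.inl i, l⟩ => .inl ⟨i, l⟩
      | ⟨.inr k, l⟩ => .inr (e ⟨k, l⟩)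
    | .inr k => (Z k).dom.relabel fun l => .inr (e ⟨k, l⟩)
  have hφ' : ∀ (x : Fin n → M) (d : ∀ k, (Z k).Pts M), (∀ k, (Z k).Rep (fun l => x (e ⟨k, l⟩)) (d k)) →
      ∀ r, (φ' (.inl r)).Realize (Sum.elim (fun q => a q.1 q.2) x) ↔ P r M (join p d) := by
    intro x d hd r
    refine Formula.realize_relabel.trans ((realize_congr _ fun q => ?_).trans
      (hφ r M (fun i => match i with
        | .inl i => a i
        | .inr k => fun l => x (e ⟨k, l⟩)) (join p d) (by
          rintro (i | k)
          exacts [ha i, hd k])))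
    rcases q with ⟨i | k, l⟩ <;> rfl
  obtain ⟨x, hx⟩ := hM.exists_realize_fin n (fun q : Σ i, Fin (S i).arity => a q.1 q.2)
    (mk_range_le.trans_lt (mk_sigma_fin_lt (aleph0_le_mk M) (hι hinf) _)) φ' fun F => by
      obtain ⟨d, hd⟩ := h F.toLeft
      obtain ⟨b, hb⟩ := EqSet.exists_reps d
      have hb' : ∀ k, (Z k).Rep (fun l => b (e.symm (e ⟨k, l⟩)).1 (e.symm (e ⟨k, l⟩)).2) (d k) := by
        intro k
        convert hb k using 1
        funext l
        rw [Equiv.symm_apply_apply]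
      refine ⟨fun i => b (e.symm i).1 (e.symm i).2, fun r hr => ?_⟩
      rcases r with r | k
      · exact (hφ' _ d hb' r).2 (hd r (Finset.mem_toLeft.2 hr))
      · exact Formula.realize_relabel.2 (hb' k).dom
  choose d hd using fun k => EqSet.exists_rep_of_dom (X := Z k) (Formula.realize_relabel.1 (hx (.inr k)))
  exact ⟨d, fun r => (hφ' x d hd r).1 (hx (.inl r))⟩

/-- In a saturated model, tuples of the same type over `C` have extensions of the same type. -/
theorem CEq.exists_extension (hM : IsSaturated L M) (hC : StablyEmbedded T C) {ι : Type (max u v)}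
    {κ : Type} [Finite κ] {S : ι → EqSet L} {Z : κ → EqSet L} {p p' : ∀ i, (S i).Pts M}
    (h : CEq C p p') (hι : Infinite M → #ι < #M) (d : ∀ k, (Z k).Pts M) :
    ∃ d' : ∀ k, (Z k).Pts M, CEq C (join p d) (join p' d') := by
  have hι' : Infinite M → #((ι ⊕ ULift.{max u v} κ) ⊕ ι) < #M := by
    intro hinf
    have h0 := aleph0_le_mk M
    simp only [mk_sum, lift_id]
    exact add_lt_of_lt h0 (add_lt_of_lt h0 (hι hinf) (mk_lt_aleph0.trans_le h0)) (hι hinf)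
  let S' : (ι ⊕ ULift.{max u v} κ) ⊕ ι → EqSet L := Sum.elim (Sum.elim S fun k => Z k.down) S
  let q : ∀ i, (S' i).Pts M := fun i => match i with
    | .inl (.inl i) => p i
    | .inl (.inr k) => d k.down
    | .inr i => p' i
  obtain ⟨d', hd'⟩ := hM.exists_points (S := S') (Z := Z) q hι' (R := CRel T C (Sum.elim S Z))
    (P := fun r M x => r.Same (join (fun i => x (.inl (.inl (.inl i))))
      fun k => x (.inl (.inl (.inr ⟨k⟩)))) (join (fun i => x (.inl (.inr i))) fun k => x (.inr k)))
    (fun r => (r.defOn_same.subst (S := Sum.elim S' Z) (t := fun k => match k with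
      | .inl (.inl i) => fun _ x => x (.inl (.inl (.inl i)))
      | .inl (.inr k) => fun _ x => x (.inl (.inl (.inr ⟨k⟩)))
      | .inr (.inl i) => fun _ x => x (.inl (.inr i))
      | .inr (.inr k) => fun _ x => x (.inr k)) fun k => by
        rcases k with (k | k) | (k | k)
        exacts [.var _, .var _, .var _, .var _]).congr fun M x => iff_of_eq (by
          congr 1 <;> funext k <;> rcases k with k | k <;> rfl)) fun F => by
    obtain ⟨d', hd'⟩ := h.exists_same hC d (n := F.card) fun i => (F.equivFin.symm i).1
    refine ⟨d', fun r hr => ?_⟩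
    have := hd' (F.equivFin ⟨r, hr⟩)
    rwa [Equiv.symm_apply_apply] at this
  exact ⟨d', hd'⟩

/-- In a saturated model in which `Q` cannot be separated, there are distinct points of `Q` that have
the same type over `C` and few points of `W`. -/
theorem exists_ne_ceq {Q W : EqSet L} (hM : IsSaturated L M) (hbad : ¬ Separated T Q C W M)
    {ι : Type (max u v)} (p : ι → W.Pts M) (hι : Infinite M → #ι < #M) :
    ∃ q q' : Q.Pts M, q ≠ q' ∧ CEq C (join (S := fun _ : Unit => Q) (Z := fun _ : ι => W) (fun _ => q) p)
      (join (S := fun _ : Unit => Q) (Z := fun _ : ι => W) (fun _ => q') p) := by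
  obtain ⟨d, hd⟩ := hM.exists_points (S := fun _ : ι => W) (Z := fun _ : Bool => Q) p hι
    (R := Option (CRel T C (Sum.elim (fun _ : Unit => Q) (fun _ : ι => W))))
    (P := fun r M x => match r with
      | none => ¬ (x (.inr true) : Q.Pts M) = x (.inr false)
      | some r => r.Same (join (S := fun _ : Unit => Q) (Z := fun _ : ι => W) (fun _ => x (.inr true))
          fun i => x (.inl i)) (join (S := fun _ : Unit => Q) (Z := fun _ : ι => W)
            (fun _ => x (.inr false)) fun i => x (.inl i)))
    (fun r => match r with
      | none => DefOn.not (DefOn.eq (.var _) (.var _))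
      | some r => (r.defOn_same.subst (S := Sum.elim (fun _ : ι => W) (fun _ : Bool => Q))
        (t := fun k => match k with
          | .inl (.inl _) => fun _ x => x (.inr true)
          | .inl (.inr k) => fun _ x => x (.inl k)
          | .inr (.inl _) => fun _ x => x (.inr false)
          | .inr (.inr k) => fun _ x => x (.inl k)) fun k => by
          rcases k with (k | k) | (k | k)
          exacts [.var _, .var _, .var _, .var _]).congr fun M x => iff_of_eq (by
            congr 1 <;> funext k <;> rcases k with k | k <;> rfl)) fun F => by
    obtain ⟨q, q', hne, hq⟩ := exists_ne_same hbad p (m := F.eraseNone.card)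
      fun i => (F.eraseNone.equivFin.symm i).1
    refine ⟨fun b => cond b q q', fun r hr => ?_⟩
    rcases r with _ | r
    · exact hne
    · have := hq (F.eraseNone.equivFin ⟨r, Finset.mem_eraseNone.2 hr⟩)
      rwa [Equiv.symm_apply_apply] at this
  exact ⟨d true, d false, hd none, fun r => hd (some r)⟩

end Saturation

/-! ### Transfinite constructions -/

section Tasks

open Cardinal

/-- A set of finite character that carries out given tasks can be built by transfinite recursion, if
each task can be carried out by adding finitely many elements to a set of smaller size. -/
theorem exists_set_of_tasks {A Task : Type w} {c : Cardinal.{w}} (Good : Set A → Prop)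
    (hmono : ∀ s t, s ⊆ t → Good t → Good s) (hfin : ∀ t, (∀ s ⊆ t, s.Finite → Good s) → Good t)
    (P : Task → Set A → Prop) (hTask : ℵ₀ ≤ c → #Task ≤ c)
    (hstep : ∀ g, Good g → (ℵ₀ ≤ c → #g < c) → ∀ t, ∃ s : Set A, s.Finite ∧ P t s ∧ Good (g ∪ s))
    {g₀ : Set A} (hg₀ : g₀.Finite) (hg₀' : Good g₀) :
    ∃ g, g₀ ⊆ g ∧ Good g ∧ ∀ t, ∃ s ⊆ g, P t s := by
  classical
  let I := (#Task).ord.ToType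
  obtain ⟨e⟩ : Nonempty (I ≃ Task) := Cardinal.eq.1 (mk_ord_toType _)
  let pick : Set A → Task → Set A := fun g t =>
    if h : ∃ s : Set A, s.Finite ∧ P t s ∧ Good (g ∪ s) then h.choose else ∅
  have hpick : ∀ g t, (pick g t).Finite := by
    intro g t
    by_cases h : ∃ s : Set A, s.Finite ∧ P t s ∧ Good (g ∪ s)
    · simp only [pick, dif_pos h]
      exact h.choose_spec.1
    · simp only [pick, dif_neg h, Set.finite_empty]
  let s : I → Set A := WellFoundedLT.fix fun i ih => pick (g₀ ∪ ⋃ j : {j // j < i}, ih j.1 j.2) (e i)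
  let G : Set I → Set A := fun D => g₀ ∪ ⋃ j : D, s j
  have hs : ∀ i, s i = pick (G (Set.Iio i)) (e i) := fun i => WellFoundedLT.fix_eq _ i
  -- unions of initial parts are small, and have the property if the smaller ones have it
  have hsmall : ∀ i, ℵ₀ ≤ c → #(G (Set.Iio i)) < c := by
    intro i hc
    refine (mk_union_le _ _).trans_lt (add_lt_of_lt hc (hg₀.lt_aleph0.trans_le hc) ?_)
    have h1 : #(Set.Iio i) < c := (mk_Iio_lt i (by
      rw [mk_ord_toType, Ordinal.type_toType])).trans_le ((mk_ord_toType _).trans_le (hTask hc))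
    by_cases hf : Finite (Set.Iio i)
    · refine lt_of_lt_of_le (Set.Finite.lt_aleph0 (Set.finite_iUnion fun j => ?_)) hc
      rw [hs]
      exact hpick _ _
    · have : Infinite (Set.Iio i) := not_finite_iff_infinite.1 hf
      refine (mk_iUnion_le_sum_mk.trans ((sum_le_sum _ (fun _ => ℵ₀) fun j => ?_).trans ?_)).trans_lt h1
      · refine le_of_lt (Set.Finite.lt_aleph0 ?_)
        rw [hs]
        exact hpick _ _
      · rw [sum_const', mul_eq_left (aleph0_le_mk _) (aleph0_le_mk _) aleph0_ne_zero]
  have hunion : ∀ D : Set I, (∀ j ∈ D, Good (G (Set.Iio j) ∪ s j)) → Good (G D) := by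
    intro D hD
    refine hfin _ fun t ht htf => ?_
    have h1 : t ⊆ g₀ ∨ ∃ j ∈ D, t ⊆ G (Set.Iio j) ∪ s j := by
      induction t, htf using Set.Finite.induction_on with
      | empty => exact Or.inl (Set.empty_subset _)
      | @insert x t _ _ ih =>
        have hmem : ∀ {j k : I} {y : A}, j ≤ k → y ∈ G (Set.Iio j) ∪ s j →
            y ∈ G (Set.Iio k) ∪ s k := by
          intro j k y hjk hy
          rcases hjk.eq_or_lt with rfl | hjk
          · exact hy
          · rcases hy with (hy | hy) | hy
            · exact Or.inl (Or.inl hy)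
            · obtain ⟨l, hl⟩ := Set.mem_iUnion.1 hy
              exact Or.inl (Or.inr (Set.mem_iUnion.2 ⟨⟨l.1, lt_trans l.2 hjk⟩, hl⟩))
            · exact Or.inl (Or.inr (Set.mem_iUnion.2 ⟨⟨j, hjk⟩, hy⟩))
        rcases ht (Set.mem_insert x t) with hx | hx <;>
          rcases ih ((Set.subset_insert x t).trans ht) with h2 | ⟨j, hj, h2⟩
        · exact Or.inl (Set.insert_subset hx h2)
        · exact Or.inr ⟨j, hj, Set.insert_subset (Or.inl (Or.inl hx)) h2⟩
        · obtain ⟨k, hk⟩ := Set.mem_iUnion.1 hx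
          exact Or.inr ⟨k.1, k.2, Set.insert_subset (Or.inr hk) fun y hy => Or.inl (Or.inl (h2 hy))⟩
        · obtain ⟨k, hk⟩ := Set.mem_iUnion.1 hx
          rcases le_total j k.1 with hjk | hjk
          · exact Or.inr ⟨k.1, k.2, Set.insert_subset (Or.inr hk) fun y hy => hmem hjk (h2 hy)⟩
          · exact Or.inr ⟨j, hj, Set.insert_subset (hmem hjk (Or.inr hk)) h2⟩
    rcases h1 with h1 | ⟨j, hj, h1⟩
    · exact hmono _ _ h1 hg₀'
    · exact hmono _ _ h1 (hD j hj)
  have hG : ∀ i, Good (G (Set.Iio i)) ∧ P (e i) (s i) ∧ Good (G (Set.Iio i) ∪ s i) := by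
    intro i
    induction i using WellFoundedLT.induction with
    | _ i ih =>
      have h1 : Good (G (Set.Iio i)) := hunion _ fun j hj => (ih j hj).2.2
      have h2 := hstep _ h1 (hsmall i) (e i)
      have h3 : s i = h2.choose := (hs i).trans (dif_pos h2)
      rw [h3]
      exact ⟨h1, h2.choose_spec.2⟩
  refine ⟨G Set.univ, Set.subset_union_left, hunion _ fun j _ => (hG j).2.2, fun t => ?_⟩
  refine ⟨s (e.symm t), fun x hx => Or.inr (Set.mem_iUnion.2 ⟨⟨e.symm t, trivial⟩, hx⟩), ?_⟩
  have := (hG (e.symm t)).2.1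
  rwa [Equiv.apply_symm_apply] at this

end Tasks

/-! ### Permutations preserving types over `C` -/

section Perm

open Cardinal

variable {T : L.Theory} {Q C W : EqSet L} {M : Model T}

variable (C) in
/-- A set of pairs of points that preserves types over `C`. -/
def PElem (g : Set (W.Pts M × W.Pts M)) : Prop :=
  CEq C (S := fun _ : g => W) (fun p => p.1.1) (fun p => p.1.2)

theorem PElem.mono {g g' : Set (W.Pts M × W.Pts M)} (hg : g ⊆ g') (h : PElem C g') : PElem C g :=
  CEq.comap (S := fun _ : g' => W) (Z := fun _ : g => W) h (fun p _ x => x ⟨p.1, hg p.2⟩)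
    fun _ => .var _

/-- Preserving types over `C` is a property of finite character. -/
theorem pElem_of_finite {g : Set (W.Pts M × W.Pts M)} (h : ∀ s ⊆ g, s.Finite → PElem C s) :
    PElem C g := by
  refine ceq_of_finset fun F => ?_
  have h1 := h (Subtype.val '' (F : Set g)) (by simp) (F.finite_toSet.image _)
  exact CEq.comap (S := fun _ : (Subtype.val '' (F : Set g) : Set (W.Pts M × W.Pts M)) => W)
    (Z := fun _ : F => W) h1 (fun p _ x => x ⟨p.1.1, p.1, p.2, rfl⟩) fun _ => .var _

theorem PElem.symm {g : Set (W.Pts M × W.Pts M)} (h : PElem C g) : PElem C (Prod.swap '' g) := by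
  have h1 := CEq.comap (S := fun _ : g => W) (Z := fun _ : (Prod.swap '' g : Set _) => W) (CEq.symm h)
    (fun p _ x => x ⟨p.1.swap, by
      obtain ⟨p', hp', h⟩ := p.2
      rw [← h]
      exact hp'⟩) fun _ => .var _
  exact h1

theorem PElem.union {g : Set (W.Pts M × W.Pts M)} {κ : Type*} {d d' : κ → W.Pts M}
    (h : CEq C (join (S := fun _ : g => W) (Z := fun _ : κ => W) (fun p => p.1.1) d)
      (join (S := fun _ : g => W) (Z := fun _ : κ => W) (fun p => p.1.2) d')) :
    PElem C (g ∪ Set.range fun k => (d k, d' k)) := by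
  have hex : ∀ p : (g ∪ Set.range fun k => (d k, d' k) : Set (W.Pts M × W.Pts M)),
      ∃ i : g ⊕ κ, p.1.1 = Sum.elim (fun p : g => p.1.1) d i ∧
        p.1.2 = Sum.elim (fun p : g => p.1.2) d' i := by
    rintro ⟨p, hp | ⟨k, rfl⟩⟩
    exacts [⟨.inl ⟨p, hp⟩, rfl, rfl⟩, ⟨.inr k, rfl, rfl⟩]
  choose i hi hi' using hex
  have h0 : CEq C (S := fun _ : g ⊕ κ => W) (fun i => Sum.elim (fun p : g => p.1.1) d i)
      (fun i => Sum.elim (fun p : g => p.1.2) d' i) := by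
    have := CEq.comap (Z := fun _ : g ⊕ κ => W) h (fun i _ x => match i with
      | .inl i => x (.inl i)
      | .inr k => x (.inr k)) (fun i => by
        rcases i with i | i
        exacts [.var _, .var _])
    convert this using 1 <;> funext i <;> rcases i with i | i <;> rfl
  have h1 := CEq.comap (Z := fun _ : (g ∪ Set.range fun k => (d k, d' k) : Set _) => W) h0
    (fun p _ x => x (i p)) fun p => .var _
  have e1 : (fun p : (g ∪ Set.range fun k => (d k, d' k) : Set (W.Pts M × W.Pts M)) => p.1.1) = _ :=
    funext hi
  have e2 : (fun p : (g ∪ Set.range fun k => (d k, d' k) : Set (W.Pts M × W.Pts M)) => p.1.2) = _ :=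
    funext hi'
  rw [PElem, e1, e2]
  exact h1

theorem PElem.eq_iff {g : Set (W.Pts M × W.Pts M)} (h : PElem C g) {p q : W.Pts M × W.Pts M}
    (hp : p ∈ g) (hq : q ∈ g) : p.1 = q.1 ↔ p.2 = q.2 :=
  CEq.iff (S := fun _ : g => W) h (R := fun _ x => x ⟨p, hp⟩ = x ⟨q, hq⟩) (DefOn.eq (.var _) (.var _))

/-- A set of pairs preserving types over `C`, with full domain and range, is the graph of a
permutation. -/
theorem PElem.exists_perm {g : Set (W.Pts M × W.Pts M)} (h : PElem C g)
    (h₁ : ∀ w, ∃ w', (w, w') ∈ g) (h₂ : ∀ w', ∃ w, (w, w') ∈ g) :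
    ∃ P : Equiv.Perm (W.Pts M), CEq C (S := fun _ : W.Pts M => W) (fun w => w) (fun w => P w) ∧
      ∀ p ∈ g, P p.1 = p.2 := by
  choose a ha using h₁
  choose b hb using h₂
  have hap : ∀ p ∈ g, a p.1 = p.2 := fun p hp => (h.eq_iff (ha p.1) hp).1 rfl
  refine ⟨⟨a, b, fun w => ?_, fun w => hap _ (hb w)⟩, ?_, hap⟩
  · exact (h.eq_iff (hb (a w)) (ha w)).2 rfl
  · exact CEq.comap (S := fun _ : g => W) (Z := fun _ : W.Pts M => W) h
      (fun w _ x => x ⟨_, ha w⟩) fun _ => .var _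

theorem mk_pts_le {N : Type w} [L.Structure N] (X : EqSet L) (h : ℵ₀ ≤ #N) : #(X.Pts N) ≤ #N := by
  have : Infinite N := infinite_iff.2 h
  refine mk_quotient_le.trans ((mk_subtype_le _).trans ?_)
  rw [mk_pi, prod_const, lift_id', mk_fin, lift_natCast, power_natCast]
  exact power_nat_le h

/-- Construction of permutations preserving types over `C`, carrying out given tasks. -/
theorem exists_perm_of_tasks (hM : IsSaturated L M) (hC : StablyEmbedded T C)
    {Task : Type (max u v)} (hTask : ℵ₀ ≤ #M → #Task ≤ #M) (A : Task → Set (W.Pts M × W.Pts M) → Prop)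
    (hA : ∀ g : Set (W.Pts M × W.Pts M), PElem C g → (Infinite M → #g < #M) → ∀ t,
      ∃ s : Set (W.Pts M × W.Pts M), s.Finite ∧ A t s ∧ PElem C (g ∪ s))
    {g₀ : Set (W.Pts M × W.Pts M)} (hg₀ : g₀.Finite) (hg₀' : PElem C g₀) :
    ∃ P : Equiv.Perm (W.Pts M), CEq C (S := fun _ : W.Pts M => W) (fun w => w) (fun w => P w) ∧
      (∀ p ∈ g₀, P p.1 = p.2) ∧ ∀ t, ∃ s, A t s ∧ ∀ p ∈ s, P p.1 = p.2 := by
  have forth : ∀ g : Set (W.Pts M × W.Pts M), PElem C g → (Infinite M → #g < #M) → ∀ w,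
      ∃ w', PElem C (g ∪ {(w, w')}) := by
    intro g hg hs w
    obtain ⟨d', hd'⟩ := CEq.exists_extension hM hC (S := fun _ : g => W) (Z := fun _ : Unit => W) hg hs
      (fun _ => w)
    refine ⟨d' (), ?_⟩
    have h1 := PElem.union hd'
    rwa [Set.range_unique] at h1
  have back : ∀ g : Set (W.Pts M × W.Pts M), PElem C g → (Infinite M → #g < #M) → ∀ w',
      ∃ w, PElem C (g ∪ {(w, w')}) := by
    intro g hg hs w'
    obtain ⟨w, hw⟩ := forth _ hg.symm (fun h => mk_image_le.trans_lt (hs h)) w'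
    refine ⟨w, ?_⟩
    have h1 := hw.symm
    rwa [Set.image_union, Set.image_singleton, Set.image_image, Prod.swap_prod_mk,
      show (fun x : W.Pts M × W.Pts M => x.swap.swap) = id from rfl, Set.image_id] at h1
  obtain ⟨g, hg, hgP, hgt⟩ := exists_set_of_tasks (c := #M) (PElem C) (fun s t h => PElem.mono h)
    (fun t => pElem_of_finite) (Task := (W.Pts M ⊕ W.Pts M) ⊕ Task)
    (fun t s => match t with
      | .inl (.inl w) => ∃ w', (w, w') ∈ s
      | .inl (.inr w') => ∃ w, (w, w') ∈ s
      | .inr t => A t s) (fun h => by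
      simp only [mk_sum, lift_id]
      exact add_le_of_le h (add_le_of_le h (mk_pts_le W h) (mk_pts_le W h)) (hTask h))
    (fun g hg hs t => by
      have hs' : Infinite M → #g < #M := fun h => hs (infinite_iff.1 h)
      rcases t with (w | w') | t
      · obtain ⟨w', h⟩ := forth g hg hs' w
        exact ⟨_, Set.finite_singleton _, ⟨w', rfl⟩, h⟩
      · obtain ⟨w, h⟩ := back g hg hs' w'
        exact ⟨_, Set.finite_singleton _, ⟨w, rfl⟩, h⟩
      · exact hA g hg hs' t) hg₀ hg₀'
  obtain ⟨P, hP, hPg⟩ := hgP.exists_perm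
    (fun w => by
      obtain ⟨s, hs, w', hw⟩ := hgt (.inl (.inl w))
      exact ⟨w', hs hw⟩)
    (fun w' => by
      obtain ⟨s, hs, w, hw⟩ := hgt (.inl (.inr w'))
      exact ⟨w, hs hw⟩)
  refine ⟨P, hP, fun p hp => hPg p (hg hp), fun t => ?_⟩
  obtain ⟨s, hs, ht⟩ := hgt (.inr t)
  exact ⟨s, ht, fun p hp => hPg p (hs hp)⟩

/-- Homogeneity over `C` of saturated models. -/
theorem exists_perm_of_ceq (hM : IsSaturated L M) (hC : StablyEmbedded T C) {κ : Type} [Finite κ]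
    {d d' : κ → W.Pts M} (h : CEq C (S := fun _ : κ => W) d d') :
    ∃ P : Equiv.Perm (W.Pts M), CEq C (S := fun _ : W.Pts M => W) (fun w => w) (fun w => P w) ∧
      ∀ k, P (d k) = d' k := by
  have h0 : PElem C (∅ ∪ Set.range fun k => (d k, d' k)) := by
    refine PElem.union (g := ∅) ?_
    have := CEq.comap (Z := Sum.elim (fun _ : (∅ : Set (W.Pts M × W.Pts M)) => W) (fun _ : κ => W)) h
      (fun i => match i with
        | .inl i => i.2.elim
        | .inr k => fun _ x => x k) (fun i => by
        rcases i with i | i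
        exacts [i.2.elim, .var _])
    convert this using 1 <;> funext i <;> rcases i with i | i
    exacts [i.2.elim, rfl, i.2.elim, rfl]
  obtain ⟨P, hP, hP', -⟩ := exists_perm_of_tasks hM hC (Task := PEmpty) (fun h => by simp)
    (fun t => t.elim) (fun _ _ _ t => t.elim) ((Set.finite_empty).union (Set.finite_range _)) h0
  exact ⟨P, hP, fun k => hP' (d k, d' k) (Or.inr ⟨k, rfl⟩)⟩

/-- If `Q` cannot be separated, then for any set `H` of at most `|M|` permutations of `Q` there is a
permutation of `W` preserving types over `C` that does not induce an element of `H` on `Q`.  Here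
`cov` covers `Q` by a power of `W`. -/
theorem exists_perm_avoiding (hM : IsSaturated L M) (hC : StablyEmbedded T C)
    (hbad : ¬ Separated T Q C W M) {m : ℕ} {cov : ∀ N : Model T, (Fin m → W.Pts N) → Q.Pts N → Prop}
    (hcov : DefOn (carriers T) (Sum.elim (fun _ : Fin m => W) (fun _ : Unit => Q))
      (fun N x => cov N (fun i => x (.inl i)) (x (.inr ()))))
    (hsurj : ∀ q : Q.Pts M, ∃ w, cov M w q) (H : Set (Equiv.Perm (Q.Pts M))) (hH : #H ≤ #M) :
    ∃ P : Equiv.Perm (W.Pts M), CEq C (S := fun _ : W.Pts M => W) (fun w => w) (fun w => P w) ∧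
      ∀ h ∈ H, ∃ w q q', cov M w q ∧ cov M (fun l => P (w l)) q' ∧ h q ≠ q' := by
  obtain ⟨P, hP, -, hPH⟩ := exists_perm_of_tasks (W := W) hM hC (Task := H) (fun _ => hH)
    (fun h s => ∃ w w' q q', (∀ l, (w l, w' l) ∈ s) ∧ cov M w q ∧ cov M w' q' ∧ h.1 q ≠ q')
    (fun g hg hs h => by
      obtain ⟨q₁, q₂, hne, hq⟩ := exists_ne_ceq hM hbad (fun p : g => p.1.1) hs
      have hq' : CEq C (join (S := fun _ : g => W) (Z := fun _ : Unit => Q) (fun p => p.1.1)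
          (fun _ => q₁)) (join (S := fun _ : g => W) (Z := fun _ : Unit => Q) (fun p => p.1.1)
          (fun _ => q₂)) := by
        have := CEq.comap (Z := Sum.elim (fun _ : g => W) (fun _ : Unit => Q)) hq
          (fun i => match i with
            | .inl i => fun _ x => x (.inr i)
            | .inr _ => fun _ x => x (.inl ())) (fun i => by
            rcases i with i | i
            exacts [.var _, .var _])
        convert this using 1 <;> funext i <;> rcases i with i | i <;> rfl
      obtain ⟨r, hr⟩ := CEq.exists_extension hM hC (S := fun _ : g => W) (Z := fun _ : Unit => Q) hg hs
        (fun _ => q₁)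
      -- `q₁` and `q₂` can both be mapped to `r`, but `h` maps at most one of them to `r`
      obtain ⟨q, hqr, hqh⟩ : ∃ q, CEq C (join (S := fun _ : g => W) (Z := fun _ : Unit => Q)
          (fun p => p.1.1) (fun _ => q)) (join (S := fun _ : g => W) (Z := fun _ : Unit => Q)
          (fun p => p.1.2) r) ∧ h.1 q ≠ r () := by
        by_cases h1 : h.1 q₁ = r ()
        · exact ⟨q₂, hq'.symm.trans hr, fun h2 => hne (h.1.injective (h1.trans h2.symm))⟩
        · exact ⟨q₁, hr, h1⟩
      obtain ⟨w, hw⟩ := hsurj q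
      have hs' : Infinite M → #(g ⊕ Unit) < #M := fun hinf => by
        have h0 := aleph0_le_mk M
        rw [mk_sum, lift_uzero]
        exact add_lt_of_lt h0 (by simpa using hs hinf) (by simpa using one_lt_aleph0.trans_le h0)
      obtain ⟨w', hw'⟩ := CEq.exists_extension hM hC (Z := fun _ : Fin m => W) hqr hs' w
      refine ⟨Set.range fun l => (w l, w' l), Set.finite_range _,
        ⟨w, w', q, r (), fun l => ⟨l, rfl⟩, hw, ?_, hqh⟩, PElem.union ?_⟩
      · exact (hw'.iff (R := fun N x => cov N (fun i => x (.inr i)) (x (.inl (.inr ()))))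
          (hcov.subst (S := Sum.elim (Sum.elim (fun _ : g => W) (fun _ : Unit => Q))
            (fun _ : Fin m => W)) (t := fun k => match k with
            | .inl k => fun _ x => x (.inr k)
            | .inr _ => fun _ x => x (.inl (.inr ()))) fun k => by
              rcases k with k | k
              exacts [.var _, .var _])).1 hw
      · have := CEq.comap (Z := Sum.elim (fun _ : g => W) (fun _ : Fin m => W)) hw'
          (fun i => match i with
            | .inl i => fun _ x => x (.inl (.inl i))
            | .inr i => fun _ x => x (.inr i)) (fun i => by
            rcases i with i | i
            exacts [.var _, .var _])
        convert this using 1 <;> funext i <;> rcases i with i | i <;> rfl)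
    Set.finite_empty (by
      have h1 : CEq C (M := M) (S := fun _ : (∅ : Set (W.Pts M × W.Pts M)) => W) (fun p => p.1.1)
          (fun p => p.1.2) := by
        intro r z
        have : (fun p : (∅ : Set (W.Pts M × W.Pts M)) => p.1.1) = fun p => p.1.2 :=
          funext fun p => p.2.elim
        rw [this]
      exact h1)
  refine ⟨P, hP, fun h hh => ?_⟩
  obtain ⟨s, ⟨w, w', q, q', hs, hw, hw', hne⟩, hsP⟩ := hPH ⟨h, hh⟩
  have : (fun l => P (w l)) = w' := funext fun l => hsP _ (hs l)
  exact ⟨w, q, q', hw, this ▸ hw', hne⟩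

/-- Permutations of the model preserving types over `C` are automorphisms fixing `C` pointwise. -/
theorem exists_aut_of_perm {P : Equiv.Perm ((home L).Pts M)}
    (h : CEq C (S := fun _ : (home L).Pts M => home L) (fun w => w) (fun w => P w)) :
    ∃ σ : M ≃[L] M, (∀ w, (home L).perm σ w = P w) ∧ ∀ c, C.perm σ c = c := by
  let s : Equiv.Perm M := homeEquiv.trans (P.trans homeEquiv.symm)
  have hs : ∀ m, homeEquiv (s m) = P (homeEquiv m) := fun m => homeEquiv.apply_symm_apply _
  have hφ : ∀ φ : L.Formula M, φ.Realize (fun m => m) ↔ φ.Realize (fun m => s m) := by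
    intro φ
    have hR : DefOn (carriers T) (fun _ : (home L).Pts M => home L)
        (fun N x => φ.Realize (fun m => homeEquiv.symm (x (homeEquiv m)) : M → N)) := by
      refine DefOn.of_rawDef ((RawDef.formula φ).comap fun m => (⟨homeEquiv m, (0 : Fin 1)⟩ :
        Σ _ : (home L).Pts M, Fin (home L).arity)) fun N a x hx => realize_congr φ fun m => ?_
      exact (homeEquiv_symm_of_rep (hx (homeEquiv m))).symm
    have := h.iff hR
    simp only [Equiv.symm_apply_apply] at this
    exact this
  let σ : M ≃[L] M :=
    { s with
      map_fun' := fun {n} f x => by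
        have h1 := (hφ (Language.Term.equal (Language.Term.func f fun i => Language.Term.var (x i))
          (Language.Term.var (Language.Structure.funMap f x)))).1 (by simp)
        simp only [Language.Formula.realize_equal, Language.Term.realize_func,
          Language.Term.realize_var] at h1
        exact h1.symm
      map_rel' := fun {n} r x => by
        have h1 := hφ (Language.Relations.formula r fun i => Language.Term.var (x i))
        simp only [Language.Formula.realize_rel, Language.Term.realize_var] at h1
        exact h1.symm }
  have hσ : ∀ m, σ m = s m := fun _ => rfl
  refine ⟨σ, fun w => ?_, fun c => ?_⟩
  · obtain ⟨m, rfl⟩ := (homeEquiv (L := L)).surjective w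
    rw [← hs]
    exact ((rep_homeEquiv m).perm σ).unique (rep_homeEquiv (s m))
  · obtain ⟨a, ha⟩ := EqSet.exists_rep c
    refine (ha.perm σ).unique ?_
    have h1 := h.iff_of_points (K := Unit) (R := fun N x z => C.Rep
      (fun l => homeEquiv.symm (x (homeEquiv (a l)))) (z ()))
      (DefOn.rep (fun l => .var _) (.var _)) (fun _ => c)
    simp only [Equiv.symm_apply_apply] at h1
    exact h1.1 ha

end Perm

/-! ### Saturated models -/

section Transfer

theorem DVar.cast {J : Type*} {N : J → Type w} [∀ j, L.Structure (N j)] {ι : Type*} {S : ι → EqSet L}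
    {Z Z' : EqSet L} (h : Z = Z') {t : ∀ j, (∀ i, (S i).Pts (N j)) → Z.Pts (N j)} (ht : DVar N S t) :
    DVar N S (fun j x => cast (congrArg (fun Z : EqSet L => Z.Pts (N j)) h) (t j x)) := by
  subst h
  exact ht

/-- Automorphisms of a collection preserve the definable relations between its members, as soon as
all relations between the sorts concerned belong to the collection. -/
theorem autColl_iff {T : L.Theory} {M : Model T} {κ : Type*} {S : κ → EqSet L} {Δ : Set (DefRel S)}
    {τ : ∀ i, Equiv.Perm ((S i).Pts M)} (hτ : τ ∈ autColl Δ M) {A : Type*} [Finite A] {s : A → κ}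
    (hΔ : ∀ R : DefRel S, (∀ i, R.slot i ∈ Set.range s) → R ∈ Δ)
    {R : ∀ M : Model T, (∀ a, (S (s a)).Pts M) → Prop}
    (hR : DefOn (carriers T) (fun a => S (s a)) R) (x : ∀ a, (S (s a)).Pts M) :
    R M (fun a => τ (s a) (x a)) ↔ R M x := by
  obtain ⟨n, ⟨e⟩⟩ := Finite.exists_equiv_fin A
  obtain ⟨φ, hφ⟩ := DefOn.exists_defRel (N := carriers T) (S := S) (fun i : Fin n => s (e.symm i))
    (hR.subst (S := fun i : Fin n => S (s (e.symm i))) fun a =>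
      DVar.cast (congrArg (fun a => S (s a)) (e.symm_apply_apply a)) (.var (e a)))
  have hc : ∀ y : ∀ a, (S (s a)).Pts M, (fun a => cast (congrArg (fun Z : EqSet L => Z.Pts M)
      (congrArg (fun a => S (s a)) (e.symm_apply_apply a))) (y (e.symm (e a)))) = y := by
    intro y
    have : ∀ a a' (h : a' = a), cast (congrArg (fun Z : EqSet L => Z.Pts M)
        (congrArg (fun a => S (s a)) h)) (y a') = y a := by
      rintro a _ rfl
      rfl
    exact funext fun a => this a (e.symm (e a)) (e.symm_apply_apply a)
  have h1 := hτ (DefRel.mk n (fun i => s (e.symm i)) φ) (hΔ _ fun i => ⟨e.symm i, rfl⟩) fun i => x (e.symm i)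
  have h2 := (hφ M fun i => x (e.symm i)).trans (iff_of_eq (congrArg (R M) (hc x)))
  have h3 := (hφ M fun i => τ (s (e.symm i)) (x (e.symm i))).trans
    (iff_of_eq (congrArg (R M) (hc fun a => τ (s a) (x a))))
  exact h3.symm.trans (h1.trans h2)

theorem DefOn.iff_of_elementarilyEquivalent {T : L.Theory} {S : Empty → EqSet L}
    {R : ∀ M : Model T, (∀ i, (S i).Pts M) → Prop} (h : DefOn (carriers T) S R) {M N : Model T}
    (hMN : M ≅[L] N) (x : ∀ i, (S i).Pts M) (y : ∀ i, (S i).Pts N) : R M x ↔ R N y := by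
  obtain ⟨φ, hφ⟩ := h
  have key : ∀ (N : Model T) (y : ∀ i, (S i).Pts N),
      R N y ↔ N ⊨ (φ.relabel (fun p => p.1) : L.Sentence) := by
    intro N y
    refine (hφ N (fun i => i.elim) y fun i => i.elim).symm.trans (Iff.trans ?_
      Language.Formula.realize_relabel.symm)
    exact realize_congr _ fun p => p.1.elim
  rw [key, key]
  exact hMN.realize_sentence _

end Transfer

section SaturatedModel

open Cardinal

variable {T : L.Theory} {Q C X Y : EqSet L} {f : Rel₃ Q X Y} {M : Model T}

/-- Permutations of `Q` preserving types over `C` preserve all relations between `Q` and `C`. -/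
theorem mem_autOver_of_ceq {P : Equiv.Perm (Q.Pts M)}
    (h : CEq C (S := fun _ : Q.Pts M => Q) (fun q => q) (fun q => P q))
    (Δ : Set (DefRel (QC.set Q C))) : P ∈ autOver Δ M := by
  intro R _ x
  let K := {i // R.slot i = QC.c}
  let z : K → C.Pts M := fun k => cast (congrArg (fun s : QC => (s.set Q C).Pts M) k.2) (x k.1)
  have pick : ∀ (s : QC) (k : s = QC.c → K) (y : (s.set Q C).Pts M),
      ∃ t : ∀ N : Model T, (∀ i, (Sum.elim (fun _ : Q.Pts M => Q) (fun _ : K => C) i).Pts N) →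
        (s.set Q C).Pts N, DVar (carriers T) _ t ∧ ∀ P : Equiv.Perm (Q.Pts M),
          (∀ h : s = QC.c, z (k h) = cast (congrArg (fun s : QC => (s.set Q C).Pts M) h) y) →
          t M (join (S := fun _ : Q.Pts M => Q) (fun q => P q) z) = QC.act Q C M P s y := by
    rintro (_ | _) k y
    · exact ⟨fun _ v => v (.inl y), .var _, fun P _ => rfl⟩
    · exact ⟨fun _ v => v (.inr (k rfl)), .var _, fun P h => h rfl⟩
  choose t ht htP using fun i => pick (R.slot i) (fun h => ⟨i, h⟩) (x i)
  have h1 := (h.iff_of_points (K := K) (R := fun N v z => R.Holds N fun i => t i N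
    (join (S := fun _ : Q.Pts M => Q) v z)) ((DefOn.defRel R ht).congr fun N v => by
      have : v = join (S := fun _ : Q.Pts M => Q) (Z := fun _ : K => C) (fun i => v (.inl i))
          (fun i => v (.inr i)) := by
        funext i
        rcases i with i | i <;> rfl
      rw [← this]) z).symm
  have e1 : (fun i => t i M (join (S := fun _ : Q.Pts M => Q) (fun q => P q) z)) =
      fun i => QC.act Q C M P (R.slot i) (x i) := funext fun i => htP i P fun _ => rfl
  have e2 : (fun i => t i M (join (S := fun _ : Q.Pts M => Q) (fun q => q) z)) = x := by
    have := funext fun i => htP i 1 fun _ => rfl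
    rw [map_one] at this
    exact this
  rw [e1, e2] at h1
  exact h1

/-- If there are at most `|M|` permutations of `Q` over `C`, then the points of `Q` are separated by
the types over `C` and finitely many points of `Q`. -/
theorem separated_of_mk_autOver_le (hM : IsSaturated L M) (hC : StablyEmbedded T C)
    (hH : #(autOver (Set.univ : Set (DefRel (QC.set Q C))) M : Set (Equiv.Perm (Q.Pts M))) ≤ #M) :
    Separated T Q C Q M := by
  by_contra hbad
  obtain ⟨P, hP, hPH⟩ := exists_perm_avoiding hM hC hbad (m := 1) (cov := fun N w q => w 0 = q)
    (DefOn.eq (.var _) (.var _)) (fun q => ⟨fun _ => q, rfl⟩) _ hH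
  obtain ⟨w, q, q', h, h', hne⟩ := hPH P (mem_autOver_of_ceq hP _)
  exact hne ((congrArg P h.symm).trans h')

theorem home_perm (σ : M ≃[L] M) (m : M) :
    (home L).perm σ (homeEquiv m) = homeEquiv (σ m) :=
  ((rep_homeEquiv m).perm σ).unique (rep_homeEquiv (σ m))

theorem mem_restrictedAut {p : Equiv.Perm (Q.Pts M)} :
    p ∈ restrictedAut Q C M ↔ ∃ σ : M ≃[L] M, (∀ c, C.perm σ c = c) ∧ Q.perm σ = p := by
  constructor
  · rintro ⟨σ, h, h'⟩
    refine ⟨σ, fun c => ?_, Equiv.ext fun q => ?_⟩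
    · obtain ⟨a, ha⟩ := EqSet.exists_rep c
      exact (ha.perm σ).unique (h a c ha)
    · obtain ⟨a, ha⟩ := EqSet.exists_rep q
      exact (ha.perm σ).unique (h' a q ha)
  · rintro ⟨σ, h, rfl⟩
    refine ⟨σ, fun a c ha => ?_, fun a q ha => ha.perm σ⟩
    have := ha.perm σ
    rwa [h c] at this

/-- If the automorphisms fixing `C` induce at most `|M|` permutations of `Q`, then the points of `Q`
are separated by the types over `C` and finitely many elements. -/
theorem separated_of_mk_restrictedAut_le (hM : IsSaturated L M) (hC : StablyEmbedded T C)
    (hH : #(restrictedAut Q C M) ≤ #M) : Separated T Q C (home L) M := by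
  by_contra hbad
  obtain ⟨P, hP, hPH⟩ := exists_perm_avoiding hM hC hbad (m := Q.arity)
    (cov := fun N w q => Q.Rep (fun l => homeEquiv.symm (w l)) q)
    (DefOn.rep (fun l => .var _) (.var _)) (fun q => by
      obtain ⟨a, ha⟩ := EqSet.exists_rep q
      exact ⟨fun l => homeEquiv (a l), by simpa using ha⟩) _ hH
  obtain ⟨σ, hσ, hσC⟩ := exists_aut_of_perm hP
  obtain ⟨w, q, q', h, h', hne⟩ := hPH (Q.perm σ) (mem_restrictedAut.2 ⟨σ, hσC, rfl⟩)
  refine hne ((h.perm σ).unique ?_)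
  convert h' using 1
  funext l
  obtain ⟨m, hm⟩ := (homeEquiv (L := L)).surjective (w l)
  change _ = homeEquiv.symm (P (w l))
  rw [Function.comp_apply, ← hσ, ← hm, home_perm, Equiv.symm_apply_apply, Equiv.symm_apply_apply]

/-- In complete theories, separation in one model is separation in all of them. -/
theorem Separated.exists_sepData {W : EqSet L} (h : Separated T Q C W M) (hT : ∀ N : Model T, M ≅[L] N) :
    ∃ D : SepData T Q C W, ∀ N : Model T, ∃ b : Fin D.n → W.Pts N, D.Sep b := by
  obtain ⟨D, b, hD⟩ := h
  refine ⟨D, fun N => ?_⟩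
  have h1 : DefOn (carriers T) (fun i : Empty => W) (fun N _ => ∃ b : Fin D.n → W.Pts N, D.Sep b) :=
    DefOn.exFam (D.defOn_sep.subst (S := Sum.elim (fun i : Empty => W) (fun _ : Fin D.n => W))
      (t := fun k _ x => x (.inr k)) fun k => .var _)
  exact (h1.iff_of_elementarilyEquivalent (hT N) (fun i => i.elim) (fun i => i.elim)).1 ⟨b, hD⟩

/-- In a complete theory with a saturated model `M`, the set `Q` is internal to `C` if it has at most
`|M|` automorphisms over `C`. -/
theorem exists_internality_autOver (hM : IsSaturated L M) (hC : StablyEmbedded T C)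
    (hT : ∀ N : Model T, M ≅[L] N)
    (hH : #(autOver (Set.univ : Set (DefRel (QC.set Q C))) M : Set (Equiv.Perm (Q.Pts M))) ≤ #M) :
    ∃ (X Y : EqSet L) (f : Rel₃ Q X Y), IsInternal T Q C X Y f ∧
      (∀ p ∈ autOver (Set.univ : Set (DefRel (QC.set Q C))) M,
        ∃ τ : Equiv.Perm (X.Pts M), (p, τ) ∈ intGroup f M) ∧
      ∃ (G : OmegaGroup T) (α : Rel₃ G.carrier Q Q), G.IsAction (fun _ g => G.Mem g) Q α ∧
        ActsAsOn (M := M) G.Mem α (autOver (Set.univ : Set (DefRel (QC.set Q C))) M) := by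
  obtain ⟨D, hD⟩ := (separated_of_mk_autOver_le hM hC hH).exists_sepData hT
  obtain ⟨X, Y, f, h, hext⟩ := D.exists_isInternal hC fun N _ => hD N
  have hext' : ∀ p ∈ autOver (Set.univ : Set (DefRel (QC.set Q C))) M,
      ∃ τ : Equiv.Perm (X.Pts M), (p, τ) ∈ intGroup f M := by
    intro p hp
    refine hext M p p fun i q b z => ?_
    let s : (Unit ⊕ Fin D.n) ⊕ (D.r i).K → QC := Sum.elim (fun _ => .q) (fun _ => .c)
    have h1 := autColl_iff hp (s := s) (fun R _ => Set.mem_univ R) ((D.r i).defOn.subst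
      (S := fun a => (s a).set Q C) (t := fun k => match k with
        | .inl (.inl k) => fun _ x => x (.inl (.inl k))
        | .inl (.inr k) => fun _ x => x (.inl (.inr k))
        | .inr k => fun _ x => x (.inr k)) fun k => by
          rcases k with (k | k) | k
          exacts [DVar.var (S := fun a => (s a).set Q C) (Sum.inl (Sum.inl k)),
            DVar.var (S := fun a => (s a).set Q C) (Sum.inl (Sum.inr k)),
            DVar.var (S := fun a => (s a).set Q C) (Sum.inr k)])
      (fun a => match a with
        | .inl (.inl _) => q
        | .inl (.inr k) => b k
        | .inr k => z k)
    refine Iff.trans (iff_of_eq ?_) (h1.trans (iff_of_eq ?_)) <;>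
    · congr 1
      funext k
      rcases k with k | k <;> rfl
  obtain ⟨G, α, ev, hμ, hα, hG⟩ := h.exists_omegaGroup_autOver Set.univ
  exact ⟨X, Y, f, h, hext', G, α, isAction_of_induces hμ
    (fun M => (MonoidHom.fst _ _).comp (Subgroup.subtype _)) fun M g _ => hα M g,
    actsAsOn_of_mem h (hα M) (hG M) hext'⟩

/-- Automorphisms fixing `C` pointwise preserve internality structures and the relations between `Q`,
`X` and `C`. -/
theorem perm_mem_autGroup (h : IsInternal T Q C X Y f) (σ : M ≃[L] M) (hσ : ∀ c, C.perm σ c = c)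
    {Δ : Set (DefRel (Slot.set Q X))} (hΔ : ∀ R ∈ Δ, ∀ i, R.slot i = .q ∨ R.slot i = .x ∨
      R.slot i = .other C) : (Q.perm σ, X.perm σ) ∈ autGroup f Δ M := by
  refine ⟨fun q x y => h.holds_perm_iff σ hσ q x y, fun R hR x => ?_⟩
  have h1 := DefOn.map_iff (N := carriers T) (j := M) (j' := M)
    (DefOn.defRel (S := fun i => (R.slot i).set Q X) R fun i => .var i) σ.toElementaryEmbedding x
  refine Iff.trans (iff_of_eq (congrArg _ (funext fun i => ?_))) h1
  have key : ∀ (s : Slot L) (y : (s.set Q X).Pts M), s = .q ∨ s = .x ∨ s = .other C →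
      Slot.act Q X M (Q.perm σ, X.perm σ) s y = (s.set Q X).map σ.toElementaryEmbedding y := by
    rintro s y (rfl | rfl | rfl)
    exacts [rfl, rfl, (hσ y).symm]
  exact key _ _ (hΔ R hR i)

/-- In a saturated model, the elements of the group of an internality structure that preserve all
relations between `Q`, `X` and `C` are given by automorphisms fixing `C` pointwise. -/
theorem exists_aut_of_mem_autGroup (hM : IsSaturated L M) (hC : StablyEmbedded T C)
    (h : IsInternal T Q C X Y f) {Δ : Set (DefRel (Slot.set Q X))}
    (hΔ : ∀ R : DefRel (Slot.set Q X), (∀ i, R.slot i = .x ∨ R.slot i = .other C) → R ∈ Δ)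
    {τ : Equiv.Perm (Q.Pts M) × Equiv.Perm (X.Pts M)} (hτ : τ ∈ autGroup f Δ M) :
    ∃ σ : M ≃[L] M, (∀ c, C.perm σ c = c) ∧ Q.perm σ = τ.1 := by
  -- a representative of `x₀` is mapped to one of `τ x₀` by an automorphism over `C`, which agrees with
  -- `τ` on `Q` because of this
  obtain ⟨x₀⟩ := h.nonempty M
  have h0 : CEq C (S := fun _ : PUnit.{max u v + 1} => X) (fun _ => x₀) (fun _ => τ.2 x₀) := by
    intro r z
    let s : PUnit.{max u v + 1} ⊕ r.K → Slot L := Sum.elim (fun _ => .x) (fun _ => .other C)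
    have h1 := autColl_iff hτ.2 (s := s) (fun R hR => hΔ R fun i => by
        obtain ⟨k | k, hk⟩ := hR i
        exacts [Or.inl hk.symm, Or.inr hk.symm]) (r.defOn.subst
      (S := fun a => (s a).set Q X) (t := fun k => match k with
        | .inl k => fun _ x => x (.inl k)
        | .inr k => fun _ x => x (.inr k)) fun k => by
          rcases k with k | k
          exacts [DVar.var (S := fun a => (s a).set Q X) (Sum.inl k),
            DVar.var (S := fun a => (s a).set Q X) (Sum.inr k)])
      (fun a => match a with
        | .inl _ => x₀
        | .inr k => z k)
    exact h1.symm
  obtain ⟨a, ha⟩ := EqSet.exists_rep x₀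
  have ha' : X.Rep (fun l => homeEquiv.symm (homeEquiv (L := L) (a l))) x₀ := by simpa using ha
  obtain ⟨d', hd'⟩ := h0.exists_extension hM hC (Z := fun _ : Fin X.arity => home L)
    (fun hinf => by simpa using one_lt_aleph0.trans_le (aleph0_le_mk M)) (fun l => homeEquiv (a l))
  obtain ⟨P, hP, hPd⟩ := exists_perm_of_ceq (W := home L) hM hC (κ := Fin X.arity)
    (hd'.comap (Z := fun _ : Fin X.arity => home L) (fun l _ x => x (.inr l)) fun l => .var _)
  obtain ⟨σ, hσ, hσC⟩ := exists_aut_of_perm hP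
  have hx : X.perm σ x₀ = τ.2 x₀ := by
    have h1 := (hd'.iff (R := fun N x => X.Rep (fun l => homeEquiv.symm (x (.inr l)))
      (x (.inl PUnit.unit))) (DefOn.rep (fun l => .var _) (.var _))).1 ha'
    refine (ha.perm σ).unique ?_
    change X.Rep (fun l => homeEquiv.symm (d' l)) (τ.2 x₀) at h1
    convert h1 using 2 with l
    have h2 : d' l = homeEquiv (σ (a l)) := by
      rw [← home_perm, hσ]
      exact (hPd l).symm
    exact ((congrArg homeEquiv.symm h2).trans (Equiv.symm_apply_apply _ _)).symm
  refine ⟨σ, hσC, Equiv.ext fun q => ?_⟩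
  have h1 : (Q.perm σ, X.perm σ) ∈ intGroup f M := fun q x y => h.holds_perm_iff σ hσC q x y
  exact (h.fst_eq_iff h1 hx).2 ((h.fst_eq_iff hτ.1 rfl).1 rfl)

/-- In a complete theory with a saturated model `M`, the set `Q` is internal to `C` if the automorphisms
of `M` over `C` induce at most `|M|` permutations of it. -/
theorem exists_internality_restrictedAut (hM : IsSaturated L M) (hC : StablyEmbedded T C)
    (hT : ∀ N : Model T, M ≅[L] N) (hH : #(restrictedAut Q C M) ≤ #M) :
    ∃ (X Y : EqSet L) (f : Rel₃ Q X Y), IsInternal T Q C X Y f ∧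
      (∀ p ∈ restrictedAut Q C M, ∃ τ : Equiv.Perm (X.Pts M), (p, τ) ∈ intGroup f M) ∧
      ∃ (G : OmegaGroup T) (α : Rel₃ G.carrier Q Q), G.IsAction (fun _ g => G.Mem g) Q α ∧
        ActsAsOn (M := M) G.Mem α (restrictedAut Q C M) := by
  obtain ⟨D, hD⟩ := (separated_of_mk_restrictedAut_le hM hC hH).exists_sepData hT
  obtain ⟨X, Y, f, h, -⟩ := D.exists_isInternal hC fun N _ => hD N
  let Δ : Set (DefRel (Slot.set Q X)) :=
    {R | ∀ i, R.slot i = .q ∨ R.slot i = .x ∨ R.slot i = .other C}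
  have hΔ : ∀ p ∈ restrictedAut Q C M, ∃ τ : Equiv.Perm (X.Pts M), (p, τ) ∈ autGroup f Δ M := by
    intro p hp
    obtain ⟨σ, hσ, rfl⟩ := mem_restrictedAut.1 hp
    exact ⟨X.perm σ, perm_mem_autGroup h σ hσ fun R hR => hR⟩
  obtain ⟨G, α, β, γ, hα, -, hact, -⟩ := h.exists_omegaGroup_autGroup Δ
  refine ⟨X, Y, f, h, fun p hp => ?_, G, α, fun N => ?_, fun g hg => ?_, fun p hp => ?_⟩
  · obtain ⟨τ, hτ⟩ := hΔ p hp
    exact ⟨τ, hτ.1⟩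
  · obtain ⟨h1, h2, h3⟩ := hα N
    exact ⟨fun g _ => h1 g trivial, fun e _ => h2 e trivial,
      fun g g' k _ _ _ => h3 g g' k trivial trivial trivial⟩
  · obtain ⟨τ, hτ, h1, -⟩ := (hact M).1 g hg
    exact ⟨τ.1, mem_restrictedAut.2 (exists_aut_of_mem_autGroup (Δ := Δ) hM hC h
      (fun R hR i => Or.inr (hR i)) hτ), h1⟩
  · obtain ⟨τ, hτ⟩ := hΔ p hp
    obtain ⟨g, ⟨hg, h1, -⟩, hu⟩ := (hact M).2 _ hτ
    refine ⟨g, ⟨hg, h1⟩, fun g' ⟨hg', h1'⟩ => ?_⟩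
    obtain ⟨τ', hτ', h2, h3⟩ := (hact M).1 g' hg'
    have e : τ' = (p, τ) := h.intGroup_ext hτ'.1 hτ.1
      (Equiv.ext fun q => (h2 q _).1 ((h1' q _).2 rfl))
    subst e
    exact hu g' ⟨hg', h2, h3⟩

end SaturatedModel

theorem elementarilyEquivalent_of_completeTheory {M : Type w} [L.Structure M] {N : Type*}
    [L.Structure N] (h : N ⊨ L.completeTheory M) : M ≅[L] N := by
  rw [Language.elementarilyEquivalent_iff]
  intro φ
  refine ⟨fun h' => h.realize_of_mem φ h', fun h' => ?_⟩
  by_contra h1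
  exact (Language.Sentence.realize_not N).1
    (h.realize_of_mem φ.not ((Language.Sentence.realize_not M).2 h1)) h'

/-- Small automorphism groups over a stably embedded `C` in a saturated model come from internality. -/
theorem exists_internality_of_isSaturated {T : L.Theory} {Q C : EqSet L} (M : Model T)
    (hM : IsSaturated L M) (hC : StablyEmbedded (L.completeTheory M) C)
    (H : Set (Equiv.Perm (Q.Pts M))) (hH : H = restrictedAut Q C M ∨
      H = (autOver (Set.univ : Set (DefRel (QC.set Q C))) M : Set (Equiv.Perm (Q.Pts M))))
    (hcard : Cardinal.mk H ≤ Cardinal.mk M) :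
    ∃ (X Y : EqSet L) (f : Rel₃ Q X Y), IsInternal (L.completeTheory M) Q C X Y f ∧
      (∀ p ∈ H, ∃ τ : Equiv.Perm (X.Pts M), (p, τ) ∈ intGroup f M) ∧
      ∃ (G : OmegaGroup (L.completeTheory M)) (α : Rel₃ G.carrier Q Q),
        G.IsAction (fun _ g => G.Mem g) Q α ∧ ActsAsOn (M := M) G.Mem α H := by
  let M' : Model (L.completeTheory M) := Language.Theory.ModelType.of _ M
  have hT : ∀ N : Model (L.completeTheory M), M' ≅[L] N := fun N =>
    elementarilyEquivalent_of_completeTheory (M := M) N.is_model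
  rcases hH with rfl | rfl
  · exact exists_internality_restrictedAut (M := M') hM hC hT hcard
  · exact exists_internality_autOver (M := M') hM hC hT hcard

/-! ### Definability in `M_Δ` -/

section Translation

variable {J : Type*} {N : J → Type w} [∀ j, L.Structure (N j)] {Q C : EqSet L}

/-- A family of maps taking tuples of points to points of `Q` or `C`, given by a coordinate. -/
structure DTerm (N : J → Type w) [∀ j, L.Structure (N j)] (Q C : EqSet L) {ι : Type*}
    (S : ι → EqSet L) where
  sort : QC
  val : ∀ j, (∀ i, (S i).Pts (N j)) → (sort.set Q C).Pts (N j)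
  dvar : DVar N S val

/-- The value in `M_Δ`. -/
def DTerm.eval {ι : Type*} {S : ι → EqSet L} (t : DTerm N Q C S) (Δ : Set (DefRel (QC.set Q C)))
    (j : J) (x : ∀ i, (S i).Pts (N j)) : DeltaModel Δ (N j) :=
  DeltaModel.incl Δ (N j) t.sort (t.val j x)

/-- A term as a term in a larger context. -/
def DTerm.weaken {ι κ : Type*} {S : ι → EqSet L} (Z : κ → EqSet L) (t : DTerm N Q C S) :
    DTerm N Q C (Sum.elim S Z) :=
  ⟨t.sort, fun j x => t.val j fun i => x (.inl i), t.dvar.inl⟩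

variable {Δ : Set (DefRel (QC.set Q C))}

theorem DefOn.incl_eq {ι : Type*} {S : ι → EqSet L} {s s' : QC}
    {t : ∀ j, (∀ i, (S i).Pts (N j)) → (s.set Q C).Pts (N j)}
    {t' : ∀ j, (∀ i, (S i).Pts (N j)) → (s'.set Q C).Pts (N j)} (ht : DVar N S t)
    (ht' : DVar N S t') :
    DefOn N S (fun j x => DeltaModel.incl Δ (N j) s (t j x) = DeltaModel.incl Δ (N j) s' (t' j x)) := by
  -- points of different sorts are different elements of `M_Δ`
  rcases s with _ | _ <;> rcases s' with _ | _
  · exact (DefOn.eq ht ht').congr fun j x => Sum.inl_injective.eq_iff.symm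
  · exact DefOn.true.not.congr fun j x => by simp [DeltaModel.incl]
  · exact DefOn.true.not.congr fun j x => by simp [DeltaModel.incl]
  · exact (DefOn.eq ht ht').congr fun j x => Sum.inr_injective.eq_iff.symm

/-- The language `L_Δ` has no function symbols. -/
theorem exists_eq_var {β : Type*} (t : (deltaLang Δ).Term β) : ∃ b, t = Language.Term.var b := by
  rcases t with b | ⟨f, _⟩
  exacts [⟨b, rfl⟩, f.elim]

/-- Formulas of `L_Δ` define relations between points of `Q` and `C` that are definable in `T`. -/
theorem DefOn.realize_bounded {α : Type*} {n : ℕ} (φ : (deltaLang Δ).BoundedFormula α n) :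
    ∀ {ι : Type*} {S : ι → EqSet L} (t : α → DTerm N Q C S) (t' : Fin n → DTerm N Q C S),
      DefOn N S (fun j x => φ.Realize (M := DeltaModel Δ (N j)) (fun a => (t a).eval Δ j x)
        (fun i => (t' i).eval Δ j x)) := by
  have helim : ∀ {m : ℕ} {ι : Type _} {S : ι → EqSet L} (t : α → DTerm N Q C S)
      (t' : Fin m → DTerm N Q C S) j x, (Sum.elim (fun a => (t a).eval Δ j x)
        (fun i => (t' i).eval Δ j x) : α ⊕ Fin m → DeltaModel Δ (N j)) =
        fun b => (Sum.elim t t' b).eval Δ j x := by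
    intro m ι S t t' j x
    funext b
    rcases b with b | b <;> rfl
  induction φ with
  | falsum => exact fun t t' => DefOn.true.not.congr fun j x => not_true
  | equal t₁ t₂ =>
    intro ι S t t'
    obtain ⟨b, rfl⟩ := exists_eq_var t₁
    obtain ⟨b', rfl⟩ := exists_eq_var t₂
    refine (DefOn.incl_eq (Δ := Δ) (Sum.elim t t' b).dvar (Sum.elim t t' b').dvar).congr fun j x => ?_
    change _ ↔ (Sum.elim _ _ b : DeltaModel Δ (N j)) = Sum.elim _ _ b'
    rw [helim]
    rfl
  | rel R ts =>
    intro ι S t t'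
    choose b hb using fun i => exists_eq_var (ts i)
    obtain rfl : ts = fun i => Language.Term.var (b i) := funext hb
    rcases R with s | ⟨R, h⟩
    · refine (DefOn.ex (Z := s.set Q C) (P := fun j x z => DeltaModel.incl Δ (N j) _
        ((Sum.elim t t' (b 0)).val j x) = DeltaModel.incl Δ (N j) s z)
        (DefOn.incl_eq (Sum.elim t t' (b 0)).dvar.inl (.var _))).congr fun j x => ?_
      change _ ↔ ∃ z, (Sum.elim _ _ (b 0) : DeltaModel Δ (N j)) = _
      rw [helim]
      rfl
    · refine (DefOn.exFam (Z := fun i => (R.slot i).set Q C) (P := fun j x z => (∀ i,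
        DeltaModel.incl Δ (N j) _ ((Sum.elim t t' (b i)).val j x) =
          DeltaModel.incl Δ (N j) (R.slot i) (z i)) ∧ R.Holds (N j) z)
        (DefOn.and (DefOn.finiteAll fun i => DefOn.incl_eq (Sum.elim t t' (b i)).dvar.inl (.var _))
          (DefOn.defRel R fun i => .var _))).congr fun j x => ?_
      change _ ↔ ∃ z : ∀ i, ((R.slot i).set Q C).Pts (N j),
        (∀ i, (Sum.elim _ _ (b i) : DeltaModel Δ (N j)) = _) ∧ _
      rw [helim]
      rfl
  | imp _ _ ih₁ ih₂ => exact fun t t' => (ih₁ t t').imp (ih₂ t t')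
  | @all m φ ih =>
    intro ι S t t'
    have key : ∀ s : QC, DefOn N S (fun j x => ∀ z : (s.set Q C).Pts (N j),
        φ.Realize (M := DeltaModel Δ (N j)) (fun a => (t a).eval Δ j x)
          (Fin.snoc (fun i => (t' i).eval Δ j x) (DeltaModel.incl Δ (N j) s z))) := by
      intro s
      refine DefOn.all ?_
      let Z : Unit → EqSet L := fun _ => s.set Q C
      let y : DTerm N Q C (Sum.elim S Z) := ⟨s, fun j x => x (.inr ()), .var (Sum.inr ())⟩
      refine (ih (fun a => (t a).weaken Z) (Fin.snoc (fun i => (t' i).weaken Z) y)).congr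
        fun j x => iff_of_eq ?_
      congr 1
      exact Fin.comp_snoc (fun t : DTerm N Q C (Sum.elim S Z) => t.eval Δ j x) _ _
    refine ((key .q).and (key .c)).congr fun j x => ?_
    constructor
    · rintro ⟨h₁, h₂⟩ (z | z)
      exacts [h₁ z, h₂ z]
    · exact fun h => ⟨fun z => h _, fun z => h _⟩

theorem DefOn.realize_delta {α ι : Type*} (φ : (deltaLang Δ).Formula α) {S : ι → EqSet L}
    (t : α → DTerm N Q C S) :
    DefOn N S (fun j x => φ.Realize (M := DeltaModel Δ (N j)) (fun a => (t a).eval Δ j x)) :=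
  (DefOn.realize_bounded φ t (fun i : Fin 0 => i.elim0)).congr fun _ _ => iff_of_eq
    (congrArg _ (Subsingleton.elim _ _))

end Translation

section DeltaMap

variable {Q C : EqSet L} {Δ : Set (DefRel (QC.set Q C))}

theorem DeltaModel.exists_incl {M : Type w} [L.Structure M] (y : DeltaModel Δ M) :
    ∃ (s : QC) (x : (s.set Q C).Pts M), y = DeltaModel.incl Δ M s x := by
  rcases y with x | x
  exacts [⟨.q, x, rfl⟩, ⟨.c, x, rfl⟩]

/-- Elementary maps between models of `T` induce elementary maps between the models `M_Δ`. -/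
noncomputable def deltaMap (Δ : Set (DefRel (QC.set Q C))) {M M' : Type w} [L.Structure M]
    [L.Structure M'] (e : M ↪ₑ[L] M') : DeltaModel Δ M ↪ₑ[deltaLang Δ] DeltaModel Δ M' where
  toFun := Sum.map (Q.map e) (C.map e)
  map_formula' n φ y := by
    choose s x hx using fun i => DeltaModel.exists_incl (y i)
    obtain rfl : y = fun i => DeltaModel.incl Δ M (s i) (x i) := funext hx
    let N : Bool → Type w := fun b => cond b M' M
    let _ : ∀ b, L.Structure (N b) := fun b => match b with
      | true => (inferInstance : L.Structure M')
      | false => (inferInstance : L.Structure M)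
    have h1 := (DefOn.realize_delta (N := N) φ (S := fun i => (s i).set Q C)
      fun i => ⟨s i, fun j x => x i, DVar.var (S := fun i => (s i).set Q C) i⟩).map_iff
        (j := false) (j' := true) e x
    refine Iff.trans (iff_of_eq (congrArg _ (funext fun i => ?_))) h1
    have : ∀ (s : QC) (x : (s.set Q C).Pts M), (Sum.map (Q.map e) (C.map e)
        (DeltaModel.incl Δ M s x) : DeltaModel Δ M') =
        DeltaModel.incl Δ M' s ((s.set Q C).map e x) := by
      rintro (_ | _) x <;> rfl
    exact this _ _

theorem deltaMap_incl {M M' : Type w} [L.Structure M] [L.Structure M'] (e : M ↪ₑ[L] M') (s : QC)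
    (x : (s.set Q C).Pts M) : deltaMap Δ e (DeltaModel.incl Δ M s x) =
      DeltaModel.incl Δ M' s ((s.set Q C).map e x) := by
  rcases s with _ | _ <;> rfl

theorem map_deltaPt {M M' : Type w} [L.Structure M] [L.Structure M'] (e : M ↪ₑ[L] M') (s : QC)
    (x : (s.set Q C).Pts M) : (deltaSort Δ s).map (deltaMap Δ e) (deltaPt Δ M s x) =
      deltaPt Δ M' s ((s.set Q C).map e x) := by
  refine (((rep_deltaPt (Δ := Δ)).2 rfl : (deltaSort Δ s).Rep _ (deltaPt Δ M s x)).map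
    (deltaMap Δ e)).unique (rep_deltaPt.2 (funext fun i => ?_))
  exact deltaMap_incl e s x

end DeltaMap

/-! ### Models in which `Q` is non-empty -/

/-- The models of `T` in which `Q` is non-empty. -/
abbrev QModel (T : L.Theory) (Q : EqSet L) := {M : Model T // Nonempty (Q.Pts M)}

/-- The universe of a model. -/
abbrev qcarriers (T : L.Theory) (Q : EqSet L) (j : QModel T Q) : Type (max u v) := j.1

section QModels

variable {T : L.Theory} {Q C : EqSet L} {Δ : Set (DefRel (QC.set Q C))}

/-- The model `M_Δ` of `T_Δ`. -/
def QModel.delta (Δ : Set (DefRel (QC.set Q C))) (j : QModel T Q) : Model (deltaTheory T Δ) :=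
  have : Nonempty (DeltaModel Δ j.1) := j.2.map Sum.inl
  deltaModel Δ j.1

/-- Elementary maps between models of `T` induce elementary maps between the models `M_Δ`. -/
noncomputable def QModel.map (Δ : Set (DefRel (QC.set Q C))) {j j' : QModel T Q}
    (e : j.1 ↪ₑ[L] j'.1) : j.delta Δ ↪ₑ[deltaLang Δ] j'.delta Δ :=
  deltaMap Δ e

/-- The point of a sort of `M_Δ` that corresponds to a point of `Q(M)` or `C(M)`. -/
noncomputable def QModel.pt (Δ : Set (DefRel (QC.set Q C))) (j : QModel T Q) (s : QC) :
    (s.set Q C).Pts j.1 ≃ (deltaSort Δ s).Pts (j.delta Δ) :=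
  Equiv.ofBijective _ (deltaPt_bijective (Δ := Δ) (M := j.1) s)

theorem QModel.map_pt {j j' : QModel T Q} (e : j.1 ↪ₑ[L] j'.1) (s : QC) (x : (s.set Q C).Pts j.1) :
    (deltaSort Δ s).map (QModel.map Δ e) (j.pt Δ s x) = j'.pt Δ s ((s.set Q C).map e x) :=
  map_deltaPt e s x

/-- Relations between the sorts that are definable in `T_Δ` are definable in `T`. -/
theorem DefOn.of_delta {ι : Type*} {s : ι → QC}
    {R : ∀ N : Model (deltaTheory T Δ), (∀ i, (deltaSort Δ (s i)).Pts N) → Prop}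
    (h : DefOn (carriers (deltaTheory T Δ)) (fun i => deltaSort Δ (s i)) R) :
    DefOn (qcarriers T Q) (fun i => (s i).set Q C)
      (fun j x => R (j.delta Δ) (fun i => j.pt Δ (s i) (x i))) := by
  obtain ⟨φ, hφ⟩ := h
  refine (DefOn.realize_delta (N := qcarriers T Q) φ (S := fun i => (s i).set Q C)
    fun p => ⟨s p.1, fun j x => x p.1, DVar.var (S := fun i => (s i).set Q C) p.1⟩).congr fun j x => ?_
  exact hφ (j.delta Δ) (fun i _ => DeltaModel.incl Δ j.1 (s i) (x i)) _ fun i => rep_deltaPt.2 rfl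

/-- Uniform definability in the models in which `Q` is non-empty extends to all models, as the condition
on `Q` is first-order. -/
theorem DefOn.of_qcarriers {ι : Type*} {S : ι → EqSet L}
    {R : ∀ j : QModel T Q, (∀ i, (S i).Pts j.1) → Prop} (h : DefOn (qcarriers T Q) S R) :
    DefOn (carriers T) S (fun M x => ∃ h : Nonempty (Q.Pts M), R ⟨M, h⟩ x) := by
  obtain ⟨φ, hφ⟩ := h
  obtain ⟨ψ, hψ⟩ := DefOn.ex (N := carriers T) (S := S) (Z := Q) (P := fun _ _ q => q = q)
    (DefOn.eq (.var _) (.var _))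
  refine ⟨ψ ⊓ φ, fun M a x ha => ?_⟩
  rw [Language.Formula.realize_inf, hψ M a x ha]
  constructor
  · rintro ⟨⟨q, -⟩, h⟩
    exact ⟨⟨q⟩, (hφ ⟨M, ⟨q⟩⟩ a x ha).1 h⟩
  · rintro ⟨⟨q⟩, h⟩
    exact ⟨⟨q, rfl⟩, (hφ ⟨M, ⟨q⟩⟩ a x ha).2 h⟩

/-- Sentences of `L_Δ` that hold in all models `M_Δ` hold in all models of `T_Δ`. -/
theorem DefOn.forall_deltaTheory {S : Empty → EqSet (deltaLang Δ)}
    {R : ∀ N : Model (deltaTheory T Δ), (∀ i, (S i).Pts N) → Prop}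
    (h : DefOn (carriers (deltaTheory T Δ)) S R)
    (hR : ∀ (M : Model T) (_ : Nonempty (DeltaModel Δ M)) x, R (deltaModel Δ M) x)
    (N : Model (deltaTheory T Δ)) (x : ∀ i, (S i).Pts N) : R N x := by
  obtain ⟨φ, hφ⟩ := h
  let σ : (deltaLang Δ).Sentence := Language.Formula.imp
    (Language.Formula.iExs Unit (⊤ : (deltaLang Δ).Formula (Empty ⊕ Unit)))
    (φ.relabel fun p => p.1)
  have hσ : ∀ (N : Type (max u v)) [(deltaLang Δ).Structure N], N ⊨ σ ↔
      (Nonempty N → φ.Realize (fun p => p.1.elim : _ → N)) := by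
    intro N _
    refine (Language.Formula.realize_imp (v := (default : Empty → N))).trans (imp_congr ?_ ?_)
    · rw [Language.Formula.realize_iExs]
      exact ⟨fun ⟨i, _⟩ => ⟨i ()⟩, fun ⟨n⟩ => ⟨fun _ => n, Language.Formula.realize_top.2 trivial⟩⟩
    · exact Language.Formula.realize_relabel.trans (realize_congr _ fun p => p.1.elim)
  have h1 : N ⊨ σ := by
    refine N.is_model.realize_of_mem _ fun M => (hσ _).2 fun hM => ?_
    exact (realize_congr _ fun p => p.1.elim).1
      ((hφ (deltaModel Δ M) (fun i => i.elim) (fun i => i.elim) fun i => i.elim).2 (hR M hM _))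
  exact (hφ N (fun i => i.elim) x fun i => i.elim).1 ((realize_congr _ fun p => p.1.elim).1
    ((hσ N).1 h1 inferInstance))

end QModels

/-! ### Unions of elementary chains -/

section Chain

variable {M : ℕ → Type w} [∀ n, L.Structure (M n)] (e : ∀ n, M n ↪ₑ[L] M (n + 1))

theorem exists_elementaryEmbedding_of_le {N : Type*} {i : ∀ n, M n → N} (hi : ∀ n x, i (n + 1) (e n x) = i n x)
    {m n : ℕ} (h : m ≤ n) : ∃ e' : M m ↪ₑ[L] M n, ∀ x, i n (e' x) = i m x := by
  induction h with
  | refl => exact ⟨Language.ElementaryEmbedding.refl L (M m), fun _ => rfl⟩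
  | @step n _ ih =>
    obtain ⟨e', he'⟩ := ih
    exact ⟨(e n).comp e', fun x => (hi n (e' x)).trans (he' x)⟩

variable {N : Type w} [L.Structure N]

/-- The union of an elementary chain is an elementary extension of its members. -/
theorem realize_of_chain (i : ∀ n, M n ↪[L] N) (hi : ∀ n x, i (n + 1) (e n x) = i n x)
    (hN : ∀ x : N, ∃ n y, i n y = x) {α : Type*} {k : ℕ} (φ : L.BoundedFormula α k) :
    ∀ (n : ℕ) (a : α → M n) (x : Fin k → M n), φ.Realize (i n ∘ a) (i n ∘ x) ↔ φ.Realize a x := by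
  induction φ with
  | falsum => exact fun _ _ _ => Iff.rfl
  | equal t₁ t₂ =>
    intro n a x
    simp only [Language.BoundedFormula.Realize]
    rw [← Sum.comp_elim, Language.HomClass.realize_term, Language.HomClass.realize_term]
    exact (i n).injective.eq_iff
  | rel R ts =>
    intro n a x
    simp only [Language.BoundedFormula.Realize]
    rw [← Sum.comp_elim]
    refine Iff.trans (iff_of_eq (congrArg _ (funext fun l => ?_))) ((i n).map_rel R _)
    exact Language.HomClass.realize_term (i n)
  | imp _ _ ih₁ ih₂ => exact fun n a x => imp_congr (ih₁ n a x) (ih₂ n a x)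
  | @all m φ ih =>
    intro n a x
    constructor
    · intro h y
      have h1 := h (i n y)
      rw [← Fin.comp_snoc] at h1
      exact (ih n a _).1 h1
    · intro h z
      obtain ⟨l, y, rfl⟩ := hN z
      -- move to a member of the chain containing the values of all variables
      obtain ⟨e₁, he₁⟩ := exists_elementaryEmbedding_of_le e (i := fun n => i n) hi (le_max_left n l)
      obtain ⟨e₂, he₂⟩ := exists_elementaryEmbedding_of_le e (i := fun n => i n) hi (le_max_right n l)
      have h1 : (Language.BoundedFormula.all φ).Realize (e₁ ∘ a) (e₁ ∘ x) :=
        (e₁.map_boundedFormula _ a x).2 h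
      have h2 := (ih _ _ _).2 (h1 (e₂ y))
      have ha : i (max n l) ∘ (e₁ ∘ a) = i n ∘ a := funext fun j => he₁ (a j)
      have hx : i (max n l) ∘ (e₁ ∘ x) = i n ∘ x := funext fun j => he₁ (x j)
      rwa [Fin.comp_snoc, he₂, ha, hx] at h2

/-- Every elementary chain of models has a union. -/
theorem exists_union {T : L.Theory} (M : ℕ → Model T) (e : ∀ n, M n ↪ₑ[L] M (n + 1)) :
    ∃ (N : Model T) (i : ∀ n, M n ↪ₑ[L] N), (∀ n x, i (n + 1) (e n x) = i n x) ∧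
      ∀ x : N, ∃ n y, i n y = x := by
  let f := Language.DirectedSystem.natLERec (G' := fun n => M n) fun n => (e n).toEmbedding
  let i := Language.DirectLimit.of L ℕ (fun n => M n) f
  have hi : ∀ n x, i (n + 1) (e n x) = i n x := by
    intro n x
    have h1 : f n (n + 1) n.le_succ x = e n x := by
      change Language.DirectedSystem.natLERec (G' := fun n => M n) (fun n => (e n).toEmbedding) _ _ _ x = _
      rw [Language.DirectedSystem.coe_natLERec]
      exact Nat.leRecOn_succ' (C := fun n => (M n : Type _)) (next := fun {k} => e k) x
    rw [← h1]
    exact Language.DirectLimit.of_f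
  have hN : ∀ x, ∃ n y, i n y = x := Language.DirectLimit.exists_of
  have helem : ∀ n, ∀ (k : ℕ) (φ : L.Formula (Fin k)) (x : Fin k → M n),
      φ.Realize (i n ∘ x) ↔ φ.Realize x := by
    intro n k φ x
    have h1 := realize_of_chain e i hi hN φ n x default
    rwa [Subsingleton.elim (i n ∘ default) default] at h1
  let i' : ∀ n, M n ↪ₑ[L] Language.DirectLimit (fun n => M n) f := fun n => ⟨i n, helem n⟩
  have : Language.DirectLimit (fun n => M n) f ⊨ T :=
    ((i' 0).elementarilyEquivalent.theory_model_iff).1 (M 0).is_model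
  have : Nonempty (Language.DirectLimit (fun n => M n) f) := ⟨i 0 (Classical.arbitrary (M 0))⟩
  exact ⟨Language.Theory.ModelType.of T (Language.DirectLimit (fun n => M n) f), i', hi, hN⟩

theorem EqSet.map_comp {M M' M'' : Type w} [L.Structure M] [L.Structure M'] [L.Structure M'']
    (X : EqSet L) (e : M ↪ₑ[L] M') (e' : M' ↪ₑ[L] M'') (x : X.Pts M) :
    X.map (e'.comp e) x = X.map e' (X.map e x) := by
  obtain ⟨a, ha⟩ := EqSet.exists_rep x
  exact (ha.map (e'.comp e)).unique ((ha.map e).map e')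

/-- Points of the union of a chain come from its members. -/
theorem exists_map_eq {M : ℕ → Type w} [∀ n, L.Structure (M n)] {e : ∀ n, M n ↪ₑ[L] M (n + 1)}
    {i : ∀ n, M n ↪ₑ[L] N} (hi : ∀ n x, i (n + 1) (e n x) = i n x)
    (hN : ∀ x : N, ∃ n y, i n y = x) {X : EqSet L} (x : X.Pts N) : ∃ n y, X.map (i n) y = x := by
  obtain ⟨a, ha⟩ := EqSet.exists_rep x
  choose n b hb using fun l => hN (a l)
  obtain ⟨m, hm⟩ := (Set.finite_range n).bddAbove
  choose e' he' using fun l => exists_elementaryEmbedding_of_le e (i := fun n => i n) hi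
    (hm ⟨l, rfl⟩)
  have hc : i m ∘ (fun l => e' l (b l)) = a := funext fun l => (he' l (b l)).trans (hb l)
  obtain ⟨y, hy⟩ := EqSet.exists_rep_of_dom (X := X) (((i m).map_formula X.dom _).1 (by
    rw [hc]
    exact ha.dom))
  refine ⟨m, y, (hy.map (i m)).unique ?_⟩
  rw [hc]
  exact ha

end Chain

/-! ### Separation in the models `M_Δ` -/

/-- Separation is inherited by elementary submodels. -/
theorem Separated.of_map {T : L.Theory} {Q C W : EqSet L} {M M' : Model T} (e : M ↪ₑ[L] M')
    (h : Separated T Q C W M') : Separated T Q C W M := by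
  obtain ⟨D, hD⟩ := h
  have h1 : DefOn (carriers T) (fun i : Empty => W) (fun N _ => ∃ b : Fin D.n → W.Pts N, D.Sep b) :=
    DefOn.exFam (D.defOn_sep.subst (S := Sum.elim (fun i : Empty => W) (fun _ : Fin D.n => W))
      (t := fun k _ x => x (.inr k)) fun k => .var _)
  exact ⟨D, (h1.map_iff (j := M) (j' := M') e fun i => i.elim).1 hD⟩

theorem IsInternal.val_map_eq_iff {T : L.Theory} {Q C X Y : EqSet L} {f : Rel₃ Q X Y}
    (h : IsInternal T Q C X Y f) {M M' : Model T} (e : M ↪ₑ[L] M') {q q' : Q.Pts M} {x x' : X.Pts M} :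
    h.val (Q.map e q) (X.map e x) = h.val (Q.map e q') (X.map e x') ↔ h.val q x = h.val q' x' :=
  (h.defOn_val_eq (S := Sum.elim (fun _ : Bool => Q) (fun _ : Bool => X))
    (DVar.var (S := Sum.elim (fun _ : Bool => Q) (fun _ : Bool => X)) (Sum.inl false))
    (DVar.var (S := Sum.elim (fun _ : Bool => Q) (fun _ : Bool => X)) (Sum.inr false))
    (DVar.var (S := Sum.elim (fun _ : Bool => Q) (fun _ : Bool => X)) (Sum.inl true))
    (DVar.var (S := Sum.elim (fun _ : Bool => Q) (fun _ : Bool => X)) (Sum.inr true))).map_iff (j := M) (j' := M') e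
    (join (S := fun _ : Bool => Q) (fun b => cond b q' q) fun b => cond b x' x)

section Ext

variable {T : L.Theory} {Q C : EqSet L}

/-- Definable conditions on points, with parameters in a model, that are finitely satisfiable are
satisfied in an elementary extension. -/
theorem QModel.exists_points (j : QModel T Q) {ι : Type*} {κ : Type (max u v)} {S : ι → EqSet L}
    {Z : κ → EqSet L} (x : ∀ i, (S i).Pts j.1) {K : Type*}
    {P : K → ∀ j : QModel T Q, (∀ i, (Sum.elim S Z i).Pts j.1) → Prop}
    (hP : ∀ k, DefOn (qcarriers T Q) (Sum.elim S Z) (P k))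
    (hfin : ∀ F : Finset K, ∃ d : ∀ k, (Z k).Pts j.1, ∀ k ∈ F, P k j (join x d)) :
    ∃ (j' : QModel T Q) (e : j.1 ↪ₑ[L] j'.1) (d : ∀ k, (Z k).Pts j'.1),
      ∀ k, P k j' (join (fun i => (S i).map e (x i)) d) := by
  classical
  choose φ hφ using hP
  obtain ⟨a, ha⟩ := EqSet.exists_reps x
  let σ : (Σ i, Fin (Sum.elim S Z i).arity) → j.1 ⊕ Σ k, Fin (Z k).arity := fun p => match p with
    | ⟨.inl i, l⟩ => .inl (a i l)
    | ⟨.inr k, l⟩ => .inr ⟨k, l⟩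
  have key : ∀ (j' : QModel T Q) (e : j.1 → j'.1) (y : ∀ i, (S i).Pts j'.1) (d : ∀ k, (Z k).Pts j'.1)
      (b : ∀ k, Fin (Z k).arity → j'.1), (∀ i, (S i).Rep (e ∘ a i) (y i)) →
      (∀ k, (Z k).Rep (b k) (d k)) → ∀ k, ((φ k).relabel σ).Realize
        (Sum.elim e fun p : Σ k, Fin (Z k).arity => b p.1 p.2) ↔ P k j' (join y d) := by
    intro j' e y d b hy hb k
    let c : ∀ i, Fin (Sum.elim S Z i).arity → j'.1 := fun i => match i with
      | .inl i => e ∘ a i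
      | .inr k => b k
    have hc : ∀ i, EqSet.Rep _ (c i) (join y d i) := by
      rintro (i | k)
      exacts [hy i, hb k]
    refine Language.Formula.realize_relabel.trans (Iff.trans (realize_congr _ fun p => ?_)
      (hφ k j' c _ hc))
    rcases p with ⟨i | i, l⟩ <;> rfl
  let Γ : K ⊕ κ → L.Formula (j.1 ⊕ Σ k, Fin (Z k).arity) := Sum.elim (fun k => (φ k).relabel σ)
    fun k => (Z k).dom.relabel fun l => .inr ⟨k, l⟩
  obtain ⟨M', e, b, hb⟩ := exists_elementaryExtension j.1 (Set.range Γ) fun Γ₀ hΓ₀ hΓ₀' => by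
    obtain ⟨F, rfl⟩ : ∃ F : Finset (K ⊕ κ), Γ '' F = Γ₀ := by
      choose k hk using fun φ : Γ₀ => hΓ₀ φ.2
      have := hΓ₀'.to_subtype
      refine ⟨(Set.finite_range k).toFinset, Set.ext fun φ => ⟨?_, fun h => ⟨k ⟨φ, h⟩, ?_, hk ⟨φ, h⟩⟩⟩⟩
      · rintro ⟨i, hi, rfl⟩
        obtain ⟨φ, rfl⟩ := (Set.finite_range k).mem_toFinset.1 hi
        exact (hk φ).symm ▸ φ.2
      · exact (Set.finite_range k).mem_toFinset.2 ⟨_, rfl⟩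
    obtain ⟨d, hd⟩ := hfin (F.preimage Sum.inl Sum.inl_injective.injOn)
    obtain ⟨b, hb⟩ := EqSet.exists_reps d
    refine ⟨fun p => b p.1 p.2, ?_⟩
    rintro _ ⟨k | k, hk, rfl⟩
    · exact (key j id x d b ha hb k).2 (hd k (Finset.mem_preimage.2 hk))
    · exact Language.Formula.realize_relabel.2 (hb k).dom
  choose d hd using fun k => EqSet.exists_rep_of_dom (X := Z k)
    (Language.Formula.realize_relabel.1 (hb _ ⟨.inr k, rfl⟩))
  exact ⟨⟨M', j.2.map (Q.map e)⟩, e, d, fun k => (key ⟨M', j.2.map (Q.map e)⟩ e _ d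
    (fun k l => b ⟨k, l⟩) (fun i => (ha i).map e) hd k).1 (hb _ ⟨.inl k, rfl⟩)⟩

end Ext

section Unjoin

variable {T : L.Theory} {C W : EqSet L} {ι κ : Type*}

/-- A family with parameters in powers of one set, regarded as having two tuples of parameters. -/
def CRel.unjoin (r : CRel T C (fun _ : ι ⊕ κ => W)) :
    CRel T C (Sum.elim (fun _ : ι => W) (fun _ : κ => W)) :=
  r.comap (fun k => match k with
    | .inl i => fun _ x => x (.inl i)
    | .inr i => fun _ x => x (.inr i)) fun k => by
      rcases k with k | k
      exacts [.var _, .var _]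

theorem CRel.unjoin_same_iff (r : CRel T C (fun _ : ι ⊕ κ => W)) {M : Model T} {v v' : ι → W.Pts M}
    {d d' : κ → W.Pts M} :
    r.unjoin.Same (join (S := fun _ : ι => W) (Z := fun _ : κ => W) v d)
      (join (S := fun _ : ι => W) (Z := fun _ : κ => W) v' d') ↔
    r.Same (Sum.elim v d) (Sum.elim v' d') := by
  have key : ∀ (v : ι → W.Pts M) (d : κ → W.Pts M) z, r.unjoin.R M
      (join (S := fun _ : ι => W) (Z := fun _ : κ => W) v d) z ↔ r.R M (Sum.elim v d) z := by
    intro v d z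
    refine iff_of_eq (congrArg (fun x => r.R M x z) (funext fun k => ?_))
    rcases k with k | k <;> rfl
  exact forall_congr' fun z => iff_congr (key v d z) (key v' d' z)

end Unjoin

section TEq

variable {T : L.Theory} {Q C : EqSet L} {Δ : Set (DefRel (QC.set Q C))}

variable (Δ) in
/-- Two tuples of points of `Q(M)` have in `M_Δ` the same type over `C(M)`. -/
def TEq (j : QModel T Q) {ι : Type*} (v v' : ι → Q.Pts j.1) : Prop :=
  CEq (deltaSort Δ .c) (M := j.delta Δ) (S := fun _ : ι => deltaSort Δ .q)
    (fun i => j.pt Δ .q (v i)) (fun i => j.pt Δ .q (v' i))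

variable {j j' : QModel T Q} {ι κ : Type*} {v v' v'' : ι → Q.Pts j.1}

theorem TEq.symm (h : TEq Δ j v v') : TEq Δ j v' v := CEq.symm h

theorem TEq.trans (h : TEq Δ j v v') (h' : TEq Δ j v' v'') : TEq Δ j v v'' := CEq.trans h h'

theorem TEq.comap (h : TEq Δ j v v') (σ : κ → ι) : TEq Δ j (fun k => v (σ k)) (fun k => v' (σ k)) :=
  CEq.comap (Z := fun _ : κ => deltaSort Δ .q) h (fun k _ x => x (σ k)) fun _ => .var _

theorem TEq.map (h : TEq Δ j v v') (e : j.1 ↪ₑ[L] j'.1) :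
    TEq Δ j' (fun i => Q.map e (v i)) (fun i => Q.map e (v' i)) := by
  have h1 := CEq.map h (M' := j'.delta Δ) (QModel.map Δ e)
  have h2 : ∀ v : ι → Q.Pts j.1, (fun i => (deltaSort Δ .q).map (QModel.map Δ e) (j.pt Δ .q (v i))) =
      fun i => j'.pt Δ .q (Q.map e (v i)) := fun v => funext fun i => QModel.map_pt e .q (v i)
  rw [h2, h2] at h1
  exact h1

theorem TEq.eq_iff (h : TEq Δ j v v') (i i' : ι) : v i = v i' ↔ v' i = v' i' := by
  have h1 := CEq.iff h (R := fun _ x => x i = x i') (DefOn.eq (.var _) (.var _))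
  exact (j.pt Δ .q).injective.eq_iff.symm.trans (h1.trans (j.pt Δ .q).injective.eq_iff)

/-- Definable conditions in `M_Δ` that are finitely satisfiable are satisfied in an elementary
extension. -/
theorem QModel.exists_extension (j : QModel T Q) {ι : Type*} {κ : Type (max u v)} (v : ι → Q.Pts j.1)
    {K : Type*} {P : K → ∀ N : Model (deltaTheory T Δ), (ι ⊕ κ → (deltaSort Δ .q).Pts N) → Prop}
    (hP : ∀ k, DefOn (carriers (deltaTheory T Δ)) (fun _ : ι ⊕ κ => deltaSort Δ .q) (P k))
    (hfin : ∀ F : Finset K, ∃ d : κ → Q.Pts j.1, ∀ k ∈ F,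
      P k (j.delta Δ) (fun i => j.pt Δ .q (Sum.elim v d i))) :
    ∃ (j' : QModel T Q) (e : j.1 ↪ₑ[L] j'.1) (d : κ → Q.Pts j'.1), ∀ k,
      P k (j'.delta Δ) (fun i => j'.pt Δ .q (Sum.elim (fun i => Q.map e (v i)) d i)) := by
  let y : ∀ j : QModel T Q, (∀ i, (Sum.elim (fun _ : ι => Q) (fun _ : κ => Q) i).Pts j.1) →
      ι ⊕ κ → Q.Pts j.1 := fun j x => Sum.elim (fun i => x (.inl i)) (fun k => x (.inr k))
  exact j.exists_points (S := fun _ : ι => Q) (Z := fun _ : κ => Q) v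
    (P := fun k j x => P k (j.delta Δ) (fun i => j.pt Δ .q (y j x i)))
    (fun k => (DefOn.of_delta (s := fun _ : ι ⊕ κ => QC.q) (hP k)).subst
      (S := Sum.elim (fun _ : ι => Q) (fun _ : κ => Q)) (t := fun i j x => y j x i) fun i => by
        rcases i with i | i
        exacts [DVar.var (S := Sum.elim (fun _ : ι => Q) (fun _ : κ => Q)) (Sum.inl i),
          DVar.var (S := Sum.elim (fun _ : ι => Q) (fun _ : κ => Q)) (Sum.inr i)]) hfin

/-- Over tuples of the same type over `C`, all points can be given images in an elementary
extension. -/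
theorem TEq.exists_forth (hC : StablyEmbedded (deltaTheory T Δ) (deltaSort Δ .c)) {ι : Type*}
    {v v' : ι → Q.Pts j.1} (h : TEq Δ j v v') :
    ∃ (j' : QModel T Q) (e : j.1 ↪ₑ[L] j'.1) (d : Q.Pts j.1 → Q.Pts j'.1),
      TEq Δ j' (Sum.elim (fun i => Q.map e (v i)) (Q.map e)) (Sum.elim (fun i => Q.map e (v' i)) d) := by
  obtain ⟨j', e, d, hd⟩ := j.exists_extension (Δ := Δ) (ι := (ι ⊕ Q.Pts j.1) ⊕ ι) (κ := Q.Pts j.1)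
    (Sum.elim (Sum.elim v id) v')
    (K := CRel (deltaTheory T Δ) (deltaSort Δ .c) (fun _ : ι ⊕ Q.Pts j.1 => deltaSort Δ .q))
    (P := fun r N x => r.Same (fun i => x (.inl (.inl i)))
      (fun i => x (Sum.elim (fun i => .inl (.inr i)) .inr i)))
    (fun r => r.defOn_same.subst (S := fun _ : ((ι ⊕ Q.Pts j.1) ⊕ ι) ⊕ Q.Pts j.1 => deltaSort Δ .q)
      (t := fun k => match k with
        | .inl i => fun _ x => x (.inl (.inl i))
        | .inr i => fun _ x => x (Sum.elim (fun i => .inl (.inr i)) .inr i)) fun k => by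
          rcases k with k | k
          exacts [.var _, .var _]) fun F => by
    obtain ⟨d, hd⟩ := CEq.exists_same hC h (Z := fun _ : Q.Pts j.1 => deltaSort Δ .q)
      (fun q => j.pt Δ .q q) (n := F.card) fun i => (F.equivFin.symm i).1.unjoin
    refine ⟨fun q => (j.pt Δ .q).symm (d q), fun r hr => ?_⟩
    have h1 := hd (F.equivFin ⟨r, hr⟩)
    rw [Equiv.symm_apply_apply, CRel.unjoin_same_iff] at h1
    convert h1 using 1
    · funext i
      rcases i with i | i <;> rfl
    · funext i
      rcases i with i | i
      · rfl
      · exact Equiv.apply_symm_apply _ _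
  refine ⟨j', e, d, fun r => ?_⟩
  have h1 := hd r
  convert h1 using 1
  · funext i
    rcases i with i | i <;> rfl
  · funext i
    rcases i with i | i <;> rfl

/-- If the points of `Q` are not separated in `M_Δ`, then in an elementary extension there are distinct
points of `Q` that have the same type over `C` and a given tuple of points. -/
theorem QModel.exists_ne_teq (j : QModel T Q) {ι : Type*} (hj : ¬ Separated (deltaTheory T Δ)
      (deltaSort Δ .q) (deltaSort Δ .c) (deltaSort Δ .q) (j.delta Δ)) (v : ι → Q.Pts j.1) :
    ∃ (j' : QModel T Q) (e : j.1 ↪ₑ[L] j'.1) (q q' : Q.Pts j'.1), q ≠ q' ∧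
      TEq Δ j' (Sum.elim (fun _ : Unit => q) (fun i => Q.map e (v i)))
        (Sum.elim (fun _ : Unit => q') (fun i => Q.map e (v i))) := by
  let t : ∀ {N : Model (deltaTheory T Δ)} (_ : ι ⊕ ULift.{max u v} Bool → (deltaSort Δ .q).Pts N),
      Bool → Unit ⊕ ι → (deltaSort Δ .q).Pts N := fun x b i =>
    x (Sum.elim (fun _ => .inr ⟨b⟩) .inl i)
  obtain ⟨j', e, d, hd⟩ := j.exists_extension (Δ := Δ) (κ := ULift.{max u v} Bool) v
    (K := Option (CRel (deltaTheory T Δ) (deltaSort Δ .c) (fun _ : Unit ⊕ ι => deltaSort Δ .q)))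
    (P := fun r N x => match r with
      | none => ¬ x (.inr ⟨true⟩) = x (.inr ⟨false⟩)
      | some r => r.Same (t x true) (t x false))
    (fun r => match r with
      | none => DefOn.not (DefOn.eq (.var _) (.var _))
      | some r => r.defOn_same.subst (S := fun _ : ι ⊕ ULift.{max u v} Bool => deltaSort Δ .q)
        (t := fun k => match k with
          | .inl i => fun _ x => t x true i
          | .inr i => fun _ x => t x false i) fun k => by
          rcases k with k | k
          exacts [.var _, .var _]) fun F => by
    obtain ⟨q, q', hne, hq⟩ := exists_ne_same hj (fun i => j.pt Δ .q (v i)) (m := F.eraseNone.card)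
      fun i => (F.eraseNone.equivFin.symm i).1.unjoin
    refine ⟨fun b => (j.pt Δ .q).symm (cond b.down q q'), fun r hr => ?_⟩
    rcases r with _ | r
    · exact fun h => hne ((j.pt Δ .q).symm.injective ((j.pt Δ .q).injective h))
    · have h1 := hq (F.eraseNone.equivFin ⟨r, Finset.mem_eraseNone.2 hr⟩)
      rw [Equiv.symm_apply_apply, CRel.unjoin_same_iff] at h1
      convert h1 using 1 <;>
      · funext i
        rcases i with i | i
        · exact Equiv.apply_symm_apply _ _
        · rfl
  refine ⟨j', e, d ⟨true⟩, d ⟨false⟩, fun h => hd none (congrArg _ h), fun r => ?_⟩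
  have h1 := hd (some r)
  convert h1 using 1 <;>
  · funext i
    rcases i with i | i <;> rfl

end TEq

/-! ### Automorphisms in unions of elementary chains -/

section Step

variable {T : L.Theory} {Q C : EqSet L} {Δ : Set (DefRel (QC.set Q C))} {j : QModel T Q}

variable (Δ) in
/-- A set of pairs of points of `Q(M)` that preserves, in `M_Δ`, types over `C(M)`. -/
def QElem (j : QModel T Q) (g : Set (Q.Pts j.1 × Q.Pts j.1)) : Prop :=
  TEq Δ j (fun p : g => p.1.1) (fun p : g => p.1.2)

theorem TEq.qElem_range {ι : Type*} {v v' : ι → Q.Pts j.1} (h : TEq Δ j v v') :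
    QElem Δ j (Set.range fun i => (v i, v' i)) := by
  choose i hi using fun p : Set.range fun i => (v i, v' i) => p.2
  have h1 := h.comap i
  have e : ∀ p, (v (i p), v' (i p)) = p.1 := hi
  have e1 : (fun p => v (i p)) = fun p => p.1.1 := funext fun p => congrArg Prod.fst (e p)
  have e2 : (fun p => v' (i p)) = fun p => p.1.2 := funext fun p => congrArg Prod.snd (e p)
  rw [e1, e2] at h1
  exact h1

theorem QElem.swap {g : Set (Q.Pts j.1 × Q.Pts j.1)} (h : QElem Δ j g) :
    QElem Δ j (Prod.swap ⁻¹' g) :=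
  TEq.comap (TEq.symm h) (fun p : (Prod.swap ⁻¹' g : Set (Q.Pts j.1 × Q.Pts j.1)) =>
    (⟨p.1.swap, p.2⟩ : g))

/-- A set of pairs preserving types over `C` in `M_Δ`, with full domain and range, is the graph of a
permutation. -/
theorem QElem.exists_perm {g : Set (Q.Pts j.1 × Q.Pts j.1)} (h : QElem Δ j g)
    (h₁ : ∀ q, ∃ q', (q, q') ∈ g) (h₂ : ∀ q', ∃ q, (q, q') ∈ g) :
    ∃ P : Equiv.Perm (Q.Pts j.1), TEq Δ j (fun q => q) (fun q => P q) ∧ ∀ p ∈ g, P p.1 = p.2 := by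
  choose a ha using h₁
  choose b hb using h₂
  have hap : ∀ p ∈ g, a p.1 = p.2 := fun p hp => (h.eq_iff ⟨_, ha p.1⟩ ⟨p, hp⟩).1 rfl
  refine ⟨⟨a, b, fun q => ?_, fun q => hap _ (hb q)⟩, ?_, hap⟩
  · exact (h.eq_iff ⟨_, hb (a q)⟩ ⟨_, ha q⟩).2 rfl
  · exact TEq.comap h fun q => (⟨_, ha q⟩ : g)

/-- The set `g'` extends the image of `g` under an elementary map. -/
def Extends {j j' : QModel T Q} (e : j.1 ↪ₑ[L] j'.1) (g : Set (Q.Pts j.1 × Q.Pts j.1))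
    (g' : Set (Q.Pts j'.1 × Q.Pts j'.1)) : Prop := ∀ p ∈ g, (Q.map e p.1, Q.map e p.2) ∈ g'

theorem Extends.comp {j j' j'' : QModel T Q} {e : j.1 ↪ₑ[L] j'.1} {e' : j'.1 ↪ₑ[L] j''.1}
    {g : Set (Q.Pts j.1 × Q.Pts j.1)} {g' : Set (Q.Pts j'.1 × Q.Pts j'.1)}
    {g'' : Set (Q.Pts j''.1 × Q.Pts j''.1)} (h : Extends e g g') (h' : Extends e' g' g'') :
    Extends (e'.comp e) g g'' := by
  intro p hp
  rw [EqSet.map_comp, EqSet.map_comp]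
  exact h' _ (h p hp)

theorem QElem.exists_forth (hC : StablyEmbedded (deltaTheory T Δ) (deltaSort Δ .c))
    {g : Set (Q.Pts j.1 × Q.Pts j.1)} (h : QElem Δ j g) :
    ∃ (j' : QModel T Q) (e : j.1 ↪ₑ[L] j'.1) (g' : Set (Q.Pts j'.1 × Q.Pts j'.1)),
      QElem Δ j' g' ∧ Extends e g g' ∧ ∀ q, ∃ q', (Q.map e q, q') ∈ g' := by
  obtain ⟨j', e, d, hd⟩ := TEq.exists_forth hC h
  exact ⟨j', e, _, hd.qElem_range, fun p hp => ⟨.inl ⟨p, hp⟩, rfl⟩, fun q => ⟨d q, .inr q, rfl⟩⟩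

theorem QElem.exists_back (hC : StablyEmbedded (deltaTheory T Δ) (deltaSort Δ .c))
    {g : Set (Q.Pts j.1 × Q.Pts j.1)} (h : QElem Δ j g) :
    ∃ (j' : QModel T Q) (e : j.1 ↪ₑ[L] j'.1) (g' : Set (Q.Pts j'.1 × Q.Pts j'.1)),
      QElem Δ j' g' ∧ Extends e g g' ∧ ∀ q', ∃ q, (q, Q.map e q') ∈ g' := by
  obtain ⟨j', e, g', hg', he, hq⟩ := h.swap.exists_forth hC
  exact ⟨j', e, _, hg'.swap, fun p hp => he p.swap hp, hq⟩

variable {X Y : EqSet L} {f : Rel₃ Q X Y}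

/-- If the points of `Q` are not separated, then there is an extension that does not allow a given
point `x₁` of `X` to be the image of `x₀`. -/
theorem QElem.exists_kill (hC : StablyEmbedded (deltaTheory T Δ) (deltaSort Δ .c))
    (h : IsInternal T Q C X Y f) (hj : ¬ Separated (deltaTheory T Δ)
      (deltaSort Δ .q) (deltaSort Δ .c) (deltaSort Δ .q) (j.delta Δ))
    {g : Set (Q.Pts j.1 × Q.Pts j.1)} (hg : QElem Δ j g) (x₀ x₁ : X.Pts j.1) :
    ∃ (j' : QModel T Q) (e : j.1 ↪ₑ[L] j'.1) (g' : Set (Q.Pts j'.1 × Q.Pts j'.1)),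
      QElem Δ j' g' ∧ Extends e g g' ∧
        ∃ p ∈ g', h.val p.1 (X.map e x₀) ≠ h.val p.2 (X.map e x₁) := by
  obtain ⟨j₁, e₁, q₁, q₂, hne, hq⟩ := j.exists_ne_teq hj fun p : g => p.1.1
  obtain ⟨j₂, e₂, d, hd⟩ := TEq.exists_forth hC (TEq.map hg e₁)
  have h1 : TEq Δ j₂ (Sum.elim (fun _ : Unit => Q.map e₂ q₁) (fun p : g => Q.map e₂ (Q.map e₁ p.1.1)))
      (Sum.elim (fun _ : Unit => d q₁) (fun p : g => Q.map e₂ (Q.map e₁ p.1.2))) := by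
    have := hd.comap (κ := Unit ⊕ g) (Sum.elim (fun _ => .inr q₁) .inl)
    convert this using 1 <;>
    · funext i
      rcases i with i | i <;> rfl
  have h2 : TEq Δ j₂ (Sum.elim (fun _ : Unit => Q.map e₂ q₂) (fun p : g => Q.map e₂ (Q.map e₁ p.1.1)))
      (Sum.elim (fun _ : Unit => d q₁) (fun p : g => Q.map e₂ (Q.map e₁ p.1.2))) := by
    have := hq.symm.map e₂
    refine TEq.trans ?_ h1
    convert this using 1 <;>
    · funext i
      rcases i with i | i <;> rfl
  -- at most one of `q₁`, `q₂` can be mapped to `d q₁` in a way compatible with `x₀ ↦ x₁`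
  obtain ⟨q, hq, hqx⟩ : ∃ q, TEq Δ j₂
      (Sum.elim (fun _ : Unit => q) (fun p : g => Q.map e₂ (Q.map e₁ p.1.1)))
      (Sum.elim (fun _ : Unit => d q₁) (fun p : g => Q.map e₂ (Q.map e₁ p.1.2))) ∧
      h.val q (X.map (e₂.comp e₁) x₀) ≠ h.val (d q₁) (X.map (e₂.comp e₁) x₁) := by
    by_cases h3 : h.val (Q.map e₂ q₁) (X.map (e₂.comp e₁) x₀) = h.val (d q₁) (X.map (e₂.comp e₁) x₁)
    · exact ⟨_, h2, fun h4 => hne (Q.map_injective e₂ (h.val_injective (h3.trans h4.symm)))⟩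
    · exact ⟨_, h1, h3⟩
  refine ⟨j₂, e₂.comp e₁, _, hq.qElem_range, fun p hp => ⟨.inr ⟨p, hp⟩, ?_⟩, _, ⟨.inl (), rfl⟩, hqx⟩
  rw [EqSet.map_comp, EqSet.map_comp]
  rfl

/-- An extension whose domain and range contain all old points of `Q`, and which does not allow any
old point of `X` to be the image of `x₀`. -/
theorem QElem.exists_step (hC : StablyEmbedded (deltaTheory T Δ) (deltaSort Δ .c))
    (h : IsInternal T Q C X Y f) (hj : ¬ Separated (deltaTheory T Δ)
      (deltaSort Δ .q) (deltaSort Δ .c) (deltaSort Δ .q) (j.delta Δ))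
    {g : Set (Q.Pts j.1 × Q.Pts j.1)} (hg : QElem Δ j g) (x₀ : X.Pts j.1) :
    ∃ (j' : QModel T Q) (e : j.1 ↪ₑ[L] j'.1) (g' : Set (Q.Pts j'.1 × Q.Pts j'.1)),
      QElem Δ j' g' ∧ Extends e g g' ∧ (∀ q, ∃ q', (Q.map e q, q') ∈ g') ∧
      (∀ q', ∃ q, (q, Q.map e q') ∈ g') ∧
      ∀ x₁, ∃ p ∈ g', h.val p.1 (X.map e x₀) ≠ h.val p.2 (X.map e x₁) := by
  obtain ⟨j₁, e₁, g₁, hg₁, he₁, hq₁⟩ := hg.exists_forth hC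
  obtain ⟨j₂, e₂, g₂, hg₂, he₂, hq₂⟩ := hg₁.exists_back hC
  have hdom : ∀ q, ∃ q', (Q.map (e₂.comp e₁) q, q') ∈ g₂ := by
    intro q
    obtain ⟨q', hq'⟩ := hq₁ q
    rw [EqSet.map_comp]
    exact ⟨_, he₂ _ hq'⟩
  have hran : ∀ q', ∃ q, (q, Q.map (e₂.comp e₁) q') ∈ g₂ := by
    intro q'
    rw [EqSet.map_comp]
    exact hq₂ _
  by_cases hx : ∃ x₁, ∀ p ∈ g₂,
      h.val p.1 (X.map (e₂.comp e₁) x₀) = h.val p.2 (X.map (e₂.comp e₁) x₁)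
  · obtain ⟨x₁, hx₁⟩ := hx
    have hj₂ : ¬ Separated (deltaTheory T Δ) (deltaSort Δ .q) (deltaSort Δ .c) (deltaSort Δ .q)
        (j₂.delta Δ) := fun h2 => hj (h2.of_map (QModel.map Δ (e₂.comp e₁)))
    obtain ⟨j₃, e₃, g₃, hg₃, he₃, p, hp, hpx⟩ := hg₂.exists_kill hC h hj₂
      (X.map (e₂.comp e₁) x₀) (X.map (e₂.comp e₁) x₁)
    refine ⟨j₃, e₃.comp (e₂.comp e₁), g₃, hg₃, (he₁.comp he₂).comp he₃, fun q => ?_, fun q' => ?_,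
      fun x => ?_⟩
    · obtain ⟨q', hq'⟩ := hdom q
      rw [EqSet.map_comp]
      exact ⟨_, he₃ _ hq'⟩
    · obtain ⟨q, hq⟩ := hran q'
      rw [EqSet.map_comp]
      exact ⟨_, he₃ _ hq⟩
    · rw [EqSet.map_comp X (e₂.comp e₁) e₃ x₀, EqSet.map_comp X (e₂.comp e₁) e₃ x]
      by_cases hxx : x = x₁
      · subst hxx
        exact ⟨p, hp, hpx⟩
      · -- the range of `g₂` contains all old points of `Q`, so that only `x₁` is compatible with `g₂`
        obtain ⟨p, hp, hpx⟩ : ∃ p ∈ g₂,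
            h.val p.1 (X.map (e₂.comp e₁) x₀) ≠ h.val p.2 (X.map (e₂.comp e₁) x) := by
          by_contra! hcon
          refine hxx (h.val_ext fun q' => ?_)
          obtain ⟨q, hq⟩ := hran q'
          exact (h.val_map_eq_iff (e₂.comp e₁)).1 ((hcon _ hq).symm.trans (hx₁ _ hq))
        exact ⟨_, he₃ p hp, fun h2 => hpx ((h.val_map_eq_iff e₃).1 h2)⟩
  · push Not at hx
    exact ⟨j₂, e₂.comp e₁, g₂, hg₂, he₁.comp he₂, hdom, hran, hx⟩

end Step

section Limit

variable {T : L.Theory} {Q C X Y : EqSet L} {Δ : Set (DefRel (QC.set Q C))} {f : Rel₃ Q X Y}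

/-- Permutations of `Q` preserving types over `C` in `M_Δ` preserve all relations in `Δ`. -/
theorem mem_autOver_of_teq {j : QModel T Q} {P : Equiv.Perm (Q.Pts j.1)}
    (h : TEq Δ j (fun q => q) (fun q => P q)) : P ∈ autOver Δ j.1 := by
  intro R hR x
  -- the entries of the tuple that are points of `C` are used as parameters
  let K := {i // R.slot i = QC.c}
  let z : K → (deltaSort Δ .c).Pts (j.delta Δ) := fun k =>
    j.pt Δ .c (cast (congrArg (fun s : QC => (s.set Q C).Pts j.1) k.2) (x k.1))
  have pick : ∀ (s : QC) (k : s = QC.c → K) (y : (s.set Q C).Pts j.1),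
      ∃ t : ∀ N : Model (deltaTheory T Δ), (∀ i, (Sum.elim (fun _ : Q.Pts j.1 => deltaSort Δ .q)
          (fun _ : K => deltaSort Δ .c) i).Pts N) → (deltaSort Δ s).Pts N,
        DVar (carriers (deltaTheory T Δ)) _ t ∧ ∀ P : Equiv.Perm (Q.Pts j.1),
          (∀ h : s = QC.c, z (k h) =
            j.pt Δ .c (cast (congrArg (fun s : QC => (s.set Q C).Pts j.1) h) y)) →
          t (j.delta Δ) (join (S := fun _ : Q.Pts j.1 => deltaSort Δ .q)
            (fun q => j.pt Δ .q (P q)) z) = j.pt Δ s (QC.act Q C j.1 P s y) := by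
    rintro (_ | _) k y
    · exact ⟨fun _ v => v (.inl y), .var _, fun P _ => rfl⟩
    · exact ⟨fun _ v => v (.inr (k rfl)), .var _, fun P h => h rfl⟩
  choose t ht htP using fun i => pick (R.slot i) (fun h => ⟨i, h⟩) (x i)
  -- membership in `R` is expressed by a symbol of `L_Δ`
  let φ : (deltaLang Δ).Formula (Σ i : Fin R.len, Fin (deltaSort Δ (R.slot i)).arity) :=
    Language.Relations.formula (L := deltaLang Δ) (DeltaRel.rel R (Or.inl hR) : DeltaRel Δ R.len)
      fun i => Language.Term.var ⟨i, (0 : Fin 1)⟩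
  let R' : ∀ N : Model (deltaTheory T Δ), (∀ i, (deltaSort Δ (R.slot i)).Pts N) → Prop := fun N y =>
    ∃ a : ∀ i, Fin (deltaSort Δ (R.slot i)).arity → N, (∀ i, EqSet.Rep _ (a i) (y i)) ∧
      φ.Realize (fun p => a p.1 p.2)
  have hR' : ∀ y : ∀ i, ((R.slot i).set Q C).Pts j.1,
      R' (j.delta Δ) (fun i => j.pt Δ (R.slot i) (y i)) ↔ R.Holds j.1 y := by
    intro y
    have h1 : ∀ a : ∀ i, Fin (deltaSort Δ (R.slot i)).arity → j.delta Δ,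
        (∀ i, EqSet.Rep _ (a i) (j.pt Δ (R.slot i) (y i))) →
        (φ.Realize (fun p => a p.1 p.2) ↔ R.Holds j.1 y) := by
      intro a ha
      have h2 : ∀ i, a i = fun _ => DeltaModel.incl Δ j.1 (R.slot i) (y i) := fun i =>
        rep_deltaPt.1 (ha i)
      have h3 : φ.Realize (fun p => a p.1 p.2) ↔ ∃ z : ∀ i, ((R.slot i).set Q C).Pts j.1,
          (∀ i, a i (0 : Fin 1) = DeltaModel.incl Δ j.1 (R.slot i) (z i)) ∧ R.Holds j.1 z :=
        Language.Formula.realize_rel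
      rw [h3]
      constructor
      · rintro ⟨z, hz, hzR⟩
        obtain rfl : y = z := funext fun i => DeltaModel.incl_injective (R.slot i)
          ((congrFun (h2 i) (0 : Fin 1)).symm.trans (hz i))
        exact hzR
      · exact fun h4 => ⟨y, fun i => congrFun (h2 i) (0 : Fin 1), h4⟩
    constructor
    · rintro ⟨a, ha, h2⟩
      exact (h1 a ha).1 h2
    · intro h2
      obtain ⟨a, ha⟩ := EqSet.exists_reps (S := fun i => deltaSort Δ (R.slot i))
        (fun i => j.pt Δ (R.slot i) (y i))
      exact ⟨a, ha, (h1 a ha).2 h2⟩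
  have h1 := (CEq.iff_of_points h (K := K) (R := fun N v z => R' N fun i => t i N
    (join (S := fun _ : Q.Pts j.1 => deltaSort Δ .q) v z)) (((DefOn.holds (N := carriers _) φ).subst
      ht).congr fun N v => by
      have : v = join (S := fun _ : Q.Pts j.1 => deltaSort Δ .q) (Z := fun _ : K => deltaSort Δ .c)
          (fun i => v (.inl i)) (fun i => v (.inr i)) := by
        funext i
        rcases i with i | i <;> rfl
      rw [← this]) z).symm
  have e1 : (fun i => t i (j.delta Δ) (join (S := fun _ : Q.Pts j.1 => deltaSort Δ .q)
      (fun q => j.pt Δ .q (P q)) z)) = fun i => j.pt Δ _ (QC.act Q C j.1 P (R.slot i) (x i)) :=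
    funext fun i => htP i P fun _ => rfl
  have e2 : (fun i => t i (j.delta Δ) (join (S := fun _ : Q.Pts j.1 => deltaSort Δ .q)
      (fun q => j.pt Δ .q q) z)) = fun i => j.pt Δ _ (x i) := by
    have := funext fun i => htP i 1 fun _ => rfl
    rw [map_one] at this
    exact this
  rw [e1, e2, hR', hR'] at h1
  exact h1

/-- The points of `Q` are separated in `M_Δ`: otherwise, there would be an automorphism of `Q` over
`C`, in the union of an elementary chain, that cannot be extended to `X`. -/
theorem separated_of_datum (hC : StablyEmbedded (deltaTheory T Δ) (deltaSort Δ .c))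
    (h : IsDatumFor T Q C X Y f (fun M => (autOver Δ M : Set (Equiv.Perm (Q.Pts M)))))
    (j : QModel T Q) : Separated (deltaTheory T Δ) (deltaSort Δ .q) (deltaSort Δ .c)
      (deltaSort Δ .q) (j.delta Δ) := by
  by_contra hj
  obtain ⟨h, hext⟩ := h
  -- stages of the construction, each with a set of pairs and an image of a fixed point `x₀`
  let St := Σ j : QModel T Q, {s : Set (Q.Pts j.1 × Q.Pts j.1) × X.Pts j.1 // QElem Δ j s.1 ∧
    ¬ Separated (deltaTheory T Δ) (deltaSort Δ .q) (deltaSort Δ .c) (deltaSort Δ .q) (j.delta Δ)}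
  have hstep : ∀ s : St, ∃ (s' : St) (e : s.1.1 ↪ₑ[L] s'.1.1), s'.2.1.2 = X.map e s.2.1.2 ∧
      Extends e s.2.1.1 s'.2.1.1 ∧ (∀ q, ∃ q', (Q.map e q, q') ∈ s'.2.1.1) ∧
      (∀ q', ∃ q, (q, Q.map e q') ∈ s'.2.1.1) ∧
      ∀ x₁, ∃ p ∈ s'.2.1.1, h.val p.1 s'.2.1.2 ≠ h.val p.2 (X.map e x₁) := by
    rintro ⟨j, ⟨g, x₀⟩, hg, hj⟩
    obtain ⟨j', e, g', hg', h1, h2, h3, h4⟩ := hg.exists_step hC h hj x₀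
    exact ⟨⟨j', ⟨g', X.map e x₀⟩, hg', fun h5 => hj (h5.of_map (QModel.map Δ e))⟩, e, rfl, h1, h2,
      h3, h4⟩
  choose next e hx hsub hdom hran hkill using hstep
  obtain ⟨x₀⟩ := h.nonempty j.1
  have h0 : QElem Δ j ∅ := by
    have : (fun p : (∅ : Set (Q.Pts j.1 × Q.Pts j.1)) => p.1.1) = fun p => p.1.2 :=
      funext fun p => p.2.elim
    rw [QElem, this]
    exact fun r z => Iff.rfl
  let s : ℕ → St := fun n => Nat.rec ⟨j, ⟨∅, x₀⟩, h0, hj⟩ (fun _ s => next s) n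
  obtain ⟨N, i, hi, hN⟩ := exists_union (fun n => (s n).1.1) fun n => e (s n)
  have himap : ∀ (Z : EqSet L) n (z : Z.Pts (s n).1.1),
      Z.map (i (n + 1)) (Z.map (e (s n)) z) = Z.map (i n) z := by
    intro Z n z
    obtain ⟨a, ha⟩ := EqSet.exists_rep z
    refine ((ha.map (e (s n))).map (i (n + 1))).unique ?_
    convert ha.map (i n) using 1
    exact funext fun l => hi n (a l)
  let jN : QModel T Q := ⟨N, j.2.map (Q.map (i 0))⟩
  let im : ∀ n, Q.Pts (s n).1.1 × Q.Pts (s n).1.1 → Q.Pts N × Q.Pts N := fun n p =>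
    (Q.map (i n) p.1, Q.map (i n) p.2)
  let g : Set (Q.Pts N × Q.Pts N) := {p | ∃ n, ∃ p' ∈ (s n).2.1.1, im n p' = p}
  have hmono : ∀ {n m : ℕ} (_ : n ≤ m), ∀ p ∈ (s n).2.1.1, ∃ p' ∈ (s m).2.1.1, im m p' = im n p := by
    intro n m hnm
    induction hnm with
    | refl => exact fun p hp => ⟨p, hp, rfl⟩
    | @step m _ ih =>
      intro p hp
      obtain ⟨p', hp', h1⟩ := ih p hp
      exact ⟨_, hsub (s m) p' hp', (Prod.ext (himap Q m p'.1) (himap Q m p'.2)).trans h1⟩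
  have hg : QElem Δ jN g := by
    refine ceq_of_finset fun F => ?_
    choose n p hp hpn using fun p : F => p.1.2
    obtain ⟨m, hm⟩ := (Set.finite_range n).bddAbove
    choose p' hp' hpm using fun q : F => hmono (hm ⟨q, rfl⟩) (p q) (hp q)
    have h1 := (TEq.map (s m).2.2.1 (j' := jN) (i m)).comap fun q : F => ⟨p' q, hp' q⟩
    have e : ∀ q, im m (p' q) = q.1.1 := fun q => (hpm q).trans (hpn q)
    have e1 : (fun q : F => Q.map (i m) (p' q).1) = fun q => q.1.1.1 :=
      funext fun q => congrArg Prod.fst (e q)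
    have e2 : (fun q : F => Q.map (i m) (p' q).2) = fun q => q.1.1.2 :=
      funext fun q => congrArg Prod.snd (e q)
    rw [e1, e2] at h1
    exact h1
  obtain ⟨P, hP, hPg⟩ := hg.exists_perm (fun q => by
      obtain ⟨n, q, rfl⟩ := exists_map_eq hi hN q
      obtain ⟨q', hq'⟩ := hdom (s n) q
      exact ⟨_, n + 1, _, hq', Prod.ext (himap Q n q) rfl⟩) fun q' => by
      obtain ⟨n, q', rfl⟩ := exists_map_eq hi hN q'
      obtain ⟨q, hq⟩ := hran (s n) q'
      exact ⟨_, n + 1, _, hq, Prod.ext rfl (himap Q n q')⟩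
  obtain ⟨τ, hτ⟩ := hext N P (mem_autOver_of_teq (j := jN) hP)
  have hxn : ∀ n, X.map (i n) (s n).2.1.2 = X.map (i 0) x₀ := by
    intro n
    induction n with
    | zero => rfl
    | succ n ih =>
      rw [← ih, ← himap X n]
      exact congrArg _ (hx (s n))
  -- the image of `x₀` under an extension to `X` would come from some stage, where it was excluded
  obtain ⟨n, x₁, hx₁⟩ := exists_map_eq hi hN (τ (X.map (i 0) x₀))
  obtain ⟨p, hp, hpx⟩ := hkill (s n) x₁
  refine hpx ((h.val_map_eq_iff (i (n + 1))).1 ?_)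
  have h1 : P (Q.map (i (n + 1)) p.1) = Q.map (i (n + 1)) p.2 := hPg _ ⟨n + 1, p, hp, rfl⟩
  have h2 := h.mem_intGroup.1 hτ (Q.map (i (n + 1)) p.1) (X.map (i 0) x₀)
  refine Eq.trans ?_ (h2.symm.trans ?_)
  · exact congrArg (h.val _) (hxn (n + 1))
  · change h.val (P _) (τ _) = _
    rw [h1, ← hx₁, himap]

end Limit

/-! ### Internality in `T_Δ` -/

/-- Finitely many ways of separating points can be combined into one. -/
theorem SepData.exists_common {T : L.Theory} {Q C W : EqSet L} (F : Finset (SepData T Q C W)) :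
    ∃ D : SepData T Q C W, ∀ M : Model T, Nonempty (W.Pts M) →
      (∃ D' ∈ F, ∃ b : Fin D'.n → W.Pts M, D'.Sep b) → ∃ b : Fin D.n → W.Pts M, D.Sep b := by
  classical
  let en := Fintype.equivFin (Σ D : F, Fin D.1.n)
  let em := Fintype.equivFin (Σ D : F, Fin D.1.m)
  let t : ∀ D : F, ∀ k, ∀ M : Model T, (∀ i, (Sum.elim (fun _ : Unit => Q)
      (fun _ : Fin (Fintype.card (Σ D : F, Fin D.1.n)) => W) i).Pts M) →
      (Sum.elim (fun _ : Unit => Q) (fun _ : Fin D.1.n => W) k).Pts M := fun D k => match k with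
    | .inl k => fun _ x => x (.inl k)
    | .inr k => fun _ x => x (.inr (en ⟨D, k⟩))
  have ht : ∀ D k, DVar (carriers T) _ (t D k) := by
    rintro D (k | k)
    exacts [.var _, .var _]
  refine ⟨⟨_, _, fun i => ((em.symm i).1.1.r (em.symm i).2).comap (t (em.symm i).1) (ht _)⟩,
    fun M ⟨w⟩ ⟨D, hD, b, hb⟩ => ?_⟩
  let b' : (Σ D : F, Fin D.1.n) → W.Pts M := fun p =>
    if h : p.1 = ⟨D, hD⟩ then b (cast (by rw [h]) p.2) else w
  refine ⟨fun k => b' (en.symm k), fun q q' hq => hb q q' fun i z => ?_⟩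
  have hsame : ∀ p p' : Σ D : F, Fin D.1.m, p = p' →
      ((p.1.1.r p.2).comap (t p.1) (ht p.1)).Same
        (join (S := fun _ : Unit => Q) (fun _ => q) fun k => b' (en.symm k))
        (join (S := fun _ : Unit => Q) (fun _ => q') fun k => b' (en.symm k)) →
      ((p'.1.1.r p'.2).comap (t p'.1) (ht p'.1)).Same
        (join (S := fun _ : Unit => Q) (fun _ => q) fun k => b' (en.symm k))
        (join (S := fun _ : Unit => Q) (fun _ => q') fun k => b' (en.symm k)) := by
    rintro p _ rfl h
    exact h
  have h1 := hsame _ ⟨⟨D, hD⟩, i⟩ (em.symm_apply_apply _) (hq (em ⟨⟨D, hD⟩, i⟩))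
  have key : ∀ q : Q.Pts M, (fun k => t ⟨D, hD⟩ k M (join (S := fun _ : Unit => Q) (fun _ => q)
      fun k => b' (en.symm k))) = join (S := fun _ : Unit => Q) (fun _ => q) b := by
    intro q
    funext k
    rcases k with k | k
    · rfl
    · change b' (en.symm (en ⟨⟨D, hD⟩, k⟩)) = b k
      rw [Equiv.symm_apply_apply]
      exact dif_pos rfl
  have h3 := h1 z
  change (D.r i).R M (fun k => t ⟨D, hD⟩ k M _) z ↔ (D.r i).R M (fun k => t ⟨D, hD⟩ k M _) z at h3
  rwa [key, key] at h3

/-- An internality datum in `T` for the automorphism group of `Q` over `C` gives rise to one in `T_Δ`. -/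
theorem exists_isInternal_delta {T : L.Theory} {Q C X Y : EqSet L} {Δ : Set (DefRel (QC.set Q C))}
    {f : Rel₃ Q X Y} (hC : StablyEmbedded (deltaTheory T Δ) (deltaSort Δ .c))
    (h : IsDatumFor T Q C X Y f (fun M => (autOver Δ M : Set (Equiv.Perm (Q.Pts M))))) :
    ∃ (X Y : EqSet (deltaLang Δ)) (f : Rel₃ (deltaSort Δ .q) X Y),
      IsInternal (deltaTheory T Δ) (deltaSort Δ .q) (deltaSort Δ .c) X Y f := by
  have hdef : ∀ D : SepData (deltaTheory T Δ) (deltaSort Δ .q) (deltaSort Δ .c) (deltaSort Δ .q),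
      DefOn (carriers (deltaTheory T Δ)) (fun _ : Empty => deltaSort Δ .q)
        (fun N _ => ∃ b : Fin D.n → (deltaSort Δ .q).Pts N, D.Sep b) := fun D =>
    DefOn.exFam (D.defOn_sep.subst (S := Sum.elim (fun _ : Empty => deltaSort Δ .q)
      (fun _ : Fin D.n => deltaSort Δ .q)) (t := fun k _ x => x (.inr k)) fun k => .var _)
  -- by compactness, finitely many ways of separating points suffice in all models `M_Δ`; the
  -- condition `∀ q, ¬ q = q` says that `Q` is empty
  obtain ⟨F, hF⟩ := exists_finset_of_forall_imp (T := T) (S := fun _ : Empty => Q)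
    (P := fun (D : SepData (deltaTheory T Δ) (deltaSort Δ .q) (deltaSort Δ .c) (deltaSort Δ .q)) M _ =>
      ¬ ∃ h : Nonempty (Q.Pts M), ∃ b : Fin D.n → (deltaSort Δ .q).Pts (QModel.delta Δ ⟨M, h⟩),
        D.Sep b)
    (fun D => ((hdef D).of_delta (s := fun _ => .q)).of_qcarriers.not)
    (R := fun M _ => ∀ q : Q.Pts M, ¬ q = q)
    (DefOn.all (DefOn.not (DefOn.eq (.var _) (.var _)))) fun M _ hM q => by
      obtain ⟨D, b, hb⟩ := separated_of_datum hC h ⟨M, ⟨q⟩⟩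
      exact (hM D ⟨⟨q⟩, b, hb⟩).elim
  obtain ⟨D, hD⟩ := SepData.exists_common F
  have hall : ∀ N : Model (deltaTheory T Δ), (∀ q : (deltaSort Δ .q).Pts N, ¬ q = q) ∨
      ∃ b : Fin D.n → (deltaSort Δ .q).Pts N, D.Sep b := by
    intro N
    refine DefOn.forall_deltaTheory (S := fun _ : Empty => deltaSort Δ .q)
      (R := fun N _ => (∀ q : (deltaSort Δ .q).Pts N, ¬ q = q) ∨
        ∃ b : Fin D.n → (deltaSort Δ .q).Pts N, D.Sep b)
      (DefOn.or (DefOn.all (DefOn.not (DefOn.eq (.var _) (.var _)))) (hdef D))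
      (fun M hM _ => ?_) N (fun i => i.elim)
    by_cases hQ : Nonempty (Q.Pts M)
    · right
      obtain ⟨q⟩ := hQ
      by_contra hcon
      refine hF M (fun i => i.elim) (fun D' hD' ⟨hQ, hb⟩ => hcon ?_) q rfl
      exact hD (deltaModel Δ M) ⟨deltaPt Δ M .q q⟩ ⟨D', hD', hb⟩
    · left
      intro q
      obtain ⟨q, rfl⟩ := (deltaPt_bijective (Δ := Δ) (M := M) .q).2 q
      exact (hQ ⟨q⟩).elim
  obtain ⟨X, Y, f, hf, -⟩ := D.exists_isInternal hC fun N ⟨q⟩ =>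
    (hall N).resolve_left fun h => h q rfl
  exact ⟨X, Y, f, hf⟩

end Internality

open Internality
theorem mainTheorem1 {L : FirstOrder.Language.{u, v}} (T : L.Theory) (Q C : EqSet L) :
    -- Part 1
    (∀ (X Y : EqSet L) (f : Rel₃ Q X Y), IsInternal T Q C X Y f →
      -- (a)
      (∀ Δ : Set (DefRel (Slot.set Q X)),
        ∃ (G : OmegaGroup T) (α : Rel₃ G.carrier Q Q) (β : Rel₃ G.carrier X X)
          (γ : Set (DefRel (Slot.set Q X)) → Rel₁ G.carrier),
          G.IsAction (fun _ _ => True) Q α ∧ G.IsAction (fun _ _ => True) X β ∧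
          (∀ M : Model T, ActsAs (M := M) G.Mem α β (autGroup f Δ M)) ∧
          G.subs = γ '' {Δ₀ | Δ₀.Finite ∧ Δ₀ ⊆ Δ} ∧
          ∀ Δ₀ : Set (DefRel (Slot.set Q X)), Δ₀.Finite → Δ₀ ⊆ Δ → ∀ M : Model T,
            ActsAs (M := M) (γ Δ₀).Holds α β (autGroup f Δ₀ M)) ∧
      -- (b)
      (∀ (G : OmegaGroup T) (α : Rel₃ G.carrier Q Q),
        G.IsAction (fun _ g => G.Mem g) Q α →
        (∀ (M : Model T) (g h : G.carrier.Pts M), G.Mem g → G.Mem h →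
          (∀ q q' : Q.Pts M, α.Holds g q q' ↔ α.Holds h q q') → g = h) →
        ∃ (X' Y' : EqSet L) (f' : Rel₃ Q X' Y') (Δ : Set (DefRel (Slot.set Q X')))
          (β : Rel₃ G.carrier X' X'),
          IsInternal T Q C X' Y' f' ∧ G.IsAction (fun _ g => G.Mem g) X' β ∧
          ∀ M : Model T, ActsAs (M := M) G.Mem α β (autGroup f' Δ M))) ∧
    -- Part 2
    (∀ Δ : Set (DefRel (QC.set Q C)),
      (∃ (X Y : EqSet L) (f : Rel₃ Q X Y),
        IsDatumFor T Q C X Y f (fun M => (autOver Δ M : Set (Equiv.Perm (Q.Pts M))))) →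
      StablyEmbedded (deltaTheory T Δ) (deltaSort Δ .c) →
      (∃ (X Y : EqSet (deltaLang Δ)) (f : Rel₃ (deltaSort Δ .q) X Y),
        IsInternal (deltaTheory T Δ) (deltaSort Δ .q) (deltaSort Δ .c) X Y f) ∧
      (∀ (X Y : EqSet (deltaLang Δ)) (f : Rel₃ (deltaSort Δ .q) X Y),
        IsInternal (deltaTheory T Δ) (deltaSort Δ .q) (deltaSort Δ .c) X Y f →
        ∀ (M : Model T), ∀ g ∈ autOver Δ M, ∃ τ, DeltaPreserves M f g τ) ∧
      ∃ (G : OmegaGroup T) (α : Rel₃ G.carrier Q Q),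
        G.IsAction (fun _ g => G.Mem g) Q α ∧
        (∀ M : Model T, ActsAsOn (M := M) G.Mem α (autOver Δ M)) ∧
        ∀ (X Y : EqSet L) (f : Rel₃ Q X Y),
          IsDatumFor T Q C X Y f (fun M => (autOver Δ M : Set (Equiv.Perm (Q.Pts M)))) →
          ∃ β : Rel₃ G.carrier X X, G.IsAction (fun _ g => G.Mem g) X β ∧
            ∀ M : Model T, ActsAs (M := M) G.Mem α β (autOverDatum f Δ M)) ∧
    -- Part 3
    (∀ M : Model T, IsSaturated L M → StablyEmbedded (L.completeTheory M) C →
      ∀ H : Set (Equiv.Perm (Q.Pts M)),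
        (H = restrictedAut Q C M ∨
          H = (autOver (Set.univ : Set (DefRel (QC.set Q C))) M : Set (Equiv.Perm (Q.Pts M)))) →
        Cardinal.mk H ≤ Cardinal.mk M →
        ∃ (X Y : EqSet L) (f : Rel₃ Q X Y),
          IsInternal (L.completeTheory M) Q C X Y f ∧
          (∀ p ∈ H, ∃ τ : Equiv.Perm (X.Pts M), (p, τ) ∈ intGroup f M) ∧
          ∃ (G : OmegaGroup (L.completeTheory M)) (α : Rel₃ G.carrier Q Q),
            G.IsAction (fun _ g => G.Mem g) Q α ∧ ActsAsOn (M := M) G.Mem α H) := by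
  refine ⟨fun X Y f h => ⟨h.exists_omegaGroup_autGroup, h.exists_realisation⟩, ?_, fun M hM hC H =>
    exists_internality_of_isSaturated M hM hC H⟩
  rintro Δ ⟨X, Y, f, h⟩ hC
  exact ⟨exists_isInternal_delta hC h, fun X Y f h' M g hg => exists_deltaPreserves h' M hg,
    exists_omegaGroup_of_datum Δ h⟩
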